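/- Let $k$ be an algebraically closed field and let $\mathcal T$ be a $k$-linear triangulated category with split idempotents, with finite-dimensional morphism spaces, and with only finitely many isomorphism classes of indecomposable objects. Write $\mathcal R$ for the radical of $\mathrm{Hom}_{\mathcal T}$. The Auslander–Reiten quiver $\Gamma$ of $\mathcal T$ is the valued translation quiver whose vertices are the isomorphism classes of indecomposable objects, with an arrow $[X]\to[Y]$ of valuation $a_{XY}=\dim_k \mathcal R(X,Y)/\mathcal R^2(X,Y)$ whenever this number is not zero, and whose translation sends $[Z]$ to $[X]$ if there is an Auslander–Reiten triangle $X\to Y\to Z\to X[1]$. We orient and number the simply laced Dynkin trees as follows. $\mathbb A_n$ ($n\ge1$): $1\to2\to\cdots\to n$. $\mathbb D_n$ ($n\ge4$): $1\to2\to\cdots\to n-2$, $\;n-1\to n-2$, $\;n\to n-2$. $\mathbb E_n$ ($n=6,7,8$): $3\to2\to1$, $\;3\to4$, $\;3\to5\to6\to\cdots\to n$. For such a tree $\Delta$, the repetition $\mathbb Z\Delta$ has the vertices $(p,x)$ with $p\in\mathbb Z$ and $x$ a vertex of $\Delta$; each arrow $x\to y$ of $\Delta$ gives arrows $(p,x)\to(p,y)$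 and $(p-1,y)\to(p,x)$ for all $p$; the translation is $\tau(p,x)=(p-1,x)$. An automorphism of $\Delta$ acts on $\mathbb Z\Delta$ through the second coordinate. On $\mathbb Z\mathbb A_n$ let $S(p,q)=(p+q,\,n+1-q)$. Suppose that $\Gamma$ is isomorphic, as a valued translation quiver, to $\mathbb Z\Delta/G$ with all valuations equal to $1$, where $G$ is a group of automorphisms of $\mathbb Z\Delta$ and one of the following holds for some integer $r\ge 0$: - $\Delta=\mathbb A_n$ with $n$ odd, $G$ is generated by $\tau^r$ or by $\tau^r\phi$, where $r\ge\frac{n-1}{2}$ and $\phi=\tau^{\frac{n+1}{2}}S$; - $\Delta=\mathbb A_n$ with $n$ even, $G$ is generated by $\rho^r$, where $r\ge n-1$ and $\rho=\tau^{\frac n2}S$; - $\Delta=\mathbb D_n$ with $n\ge5$, $G$ is generated by $\tau^r$ or by $\tau^r\phi$, where $r\ge n-2$ and $\phi$ is the automorphism of $\mathbb D_n$ that exchanges $n-1$ and $n$; - $\Delta=\mathbb D_4$, $G$ is generated by $\phi\tau^r$, where $r\ge2$ and $\phi\in\mathfrak S_3=\mathrm{Aut}(\mathbb D_4)$; - $\Delta=\mathbb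 E_6$, $G$ is generated by $\tau^r$ or by $\tau^r\phi$, where $r\ge5$ and $\phi$ is the automorphism of $\mathbb E_6$ that exchanges $2$ and $5$, and $1$ and $6$; - $\Delta=\mathbb E_7$, $G$ is generated by $\tau^r$, where $r\ge8$; - $\Delta=\mathbb E_8$, $G$ is generated by $\tau^r$, where $r\ge14$. Then $\mathcal T$ is standard: the full subcategory $\mathrm{ind}\,\mathcal T$ of the indecomposable objects is $k$-linearly equivalent to the mesh category $k(\mathbb Z\Delta/G)$ (the $k$-linear path category modulo the ideal generated by the sums $\sum_{\alpha:y\to x}\alpha\,\sigma(\alpha)$, one for each vertex $x$, where $\sigma(\alpha)$ is the arrow $\tau x\to y$), and hence $\mathcal T$ is $k$-linearly equivalent to the category of finite direct sums of objects of $k(\mathbb Z\Delta/G)$. -/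

import Mathlib

open CategoryTheory CategoryTheory.Limits CategoryTheory.Pretriangulated

/-! ### Stable translation quivers -/

/-- A stable translation quiver without double arrows, so that the arrows form a relation on the
vertices. Loops are allowed. -/
structure StableTranslationQuiver where
  /-- the vertices -/
  V : Type
  /-- `Arrow x y`: there is an arrow from `x` to `y` -/
  Arrow : V → V → Prop
  /-- the translation -/
  τ : Equiv.Perm V
  finite_succ : ∀ x, {y | Arrow x y}.Finite
  finite_pred : ∀ x, {y | Arrow y x}.Finite
  /-- the successors of `τ x` are the predecessors of `x` -/
  arrow_τ : ∀ x y, Arrow (τ x) y ↔ Arrow y x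

namespace StableTranslationQuiver

variable (Q : StableTranslationQuiver)

/-- The automorphism group of a stable translation quiver: permutations of the vertices that
preserve the arrows and commute with the translation. -/
def Aut : Subgroup (Equiv.Perm Q.V) where
  carrier := {g | (∀ x y, Q.Arrow (g x) (g y) ↔ Q.Arrow x y) ∧ ∀ x, g (Q.τ x) = Q.τ (g x)}
  one_mem' := by simp
  mul_mem' := by
    rintro a b ⟨ha, ha'⟩ ⟨hb, hb'⟩
    exact ⟨fun x y => by simp [ha, hb], fun x => by simp [ha', hb']⟩
  inv_mem' := by
    rintro a ⟨ha, ha'⟩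
    refine ⟨fun x y => by rw [← ha]; simp, fun x => ?_⟩
    apply a.injective
    rw [ha']; simp

/-- The translation, as an automorphism. -/
def tauAut : Q.Aut :=
  ⟨Q.τ, fun x y => by rw [Q.arrow_τ, Q.arrow_τ], fun _ => rfl⟩

/-- The quotient `Q / G` by a group of automorphisms: its vertices are the `G`-orbits, and there is
an arrow `[x] → [y]` exactly when it is the image of an arrow of `Q`. (If `G` is weakly admissible,
the images of two arrows with different orbits never have the same source and target, so that no
double arrow is lost.) -/
def quotient (G : Subgroup Q.Aut) : StableTranslationQuiver where
  V := MulAction.orbitRel.Quotient G Q.V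
  Arrow a b := ∃ x y : Q.V, Quotient.mk _ x = a ∧ Quotient.mk _ y = b ∧ Q.Arrow x y
  τ := Quotient.congr Q.τ (by
    intro x y
    change (∃ g : G, g • y = x) ↔ (∃ g : G, g • Q.τ y = Q.τ x)
    refine exists_congr fun g => ?_
    have h : g • Q.τ y = Q.τ (g • y) := g.1.2.2 y
    rw [h, Q.τ.injective.eq_iff])
  finite_succ := by
    intro a
    induction a using Quotient.inductionOn with
    | h x =>
      refine ((Q.finite_succ x).image (Quotient.mk _)).subset ?_
      rintro b ⟨x', y, hx, rfl, h⟩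
      obtain ⟨g, hg⟩ : ∃ g : G, g • x = x' := Quotient.exact hx
      refine ⟨g⁻¹ • y, ?_, Quotient.sound ⟨g⁻¹, rfl⟩⟩
      change Q.Arrow x (g⁻¹ • y)
      rw [← g.1.2.1]
      change Q.Arrow (g • x) (g • g⁻¹ • y)
      rwa [hg, smul_inv_smul]
  finite_pred := by
    intro a
    induction a using Quotient.inductionOn with
    | h x =>
      refine ((Q.finite_pred x).image (Quotient.mk _)).subset ?_
      rintro b ⟨y, x', rfl, hx, h⟩
      obtain ⟨g, hg⟩ : ∃ g : G, g • x = x' := Quotient.exact hx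
      refine ⟨g⁻¹ • y, ?_, Quotient.sound ⟨g⁻¹, rfl⟩⟩
      change Q.Arrow (g⁻¹ • y) x
      rw [← g.1.2.1]
      change Q.Arrow (g • g⁻¹ • y) (g • x)
      rwa [hg, smul_inv_smul]
  arrow_τ := by
    intro a b
    induction a using Quotient.inductionOn with
    | h x =>
      constructor
      · rintro ⟨x', y, hx, rfl, h⟩
        obtain ⟨g, hg⟩ : ∃ g : G, g • Q.τ x = x' := Quotient.exact hx
        refine ⟨y, g • x, rfl, Quotient.sound ⟨g, rfl⟩, ?_⟩
        rw [← Q.arrow_τ]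
        have h' : g • Q.τ x = Q.τ (g • x) := g.1.2.2 x
        rwa [← h', hg]
      · rintro ⟨y, x', rfl, hx, h⟩
        obtain ⟨g, hg⟩ : ∃ g : G, g • x = x' := Quotient.exact hx
        refine ⟨Q.τ x', y, ?_, rfl, (Q.arrow_τ _ _).2 h⟩
        have h' : g • Q.τ x = Q.τ (g • x) := g.1.2.2 x
        exact Quotient.sound ⟨g, by rw [← hg]; exact h'⟩

/-! ### The mesh category -/

/-- The arrows of `Q` as a quiver in the sense of Mathlib. -/
instance : Quiver Q.V where
  Hom x y := PLift (Q.Arrow x y)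

variable (k : Type*) [Field k]

/-- The `k`-linear path category of `Q`. -/
abbrev PathCat := Free k (Paths Q.V)

/-- A vertex, as an object of the path category. -/
def pathObj (x : Q.V) : Q.PathCat k := x

/-- An arrow, as a morphism of the path category. -/
noncomputable def pathArrow {x y : Q.V} (h : Q.Arrow x y) : Q.pathObj k x ⟶ Q.pathObj k y :=
  (Free.embedding k (Paths Q.V)).map ((Paths.of Q.V).map (PLift.up h))

/-- The mesh ending at `x`: the sum, over the arrows `α : y → x`, of the paths
`σ(α)` followed by `α`, where `σ(α) : τ x → y`. -/
noncomputable def mesh (x : Q.V) : Q.pathObj k (Q.τ x) ⟶ Q.pathObj k x :=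
  ∑ᶠ y : {y // Q.Arrow y x},
    Q.pathArrow k ((Q.arrow_τ x y.1).2 y.2) ≫ Q.pathArrow k y.2

/-- The two-sided ideal of the path category generated by the meshes. -/
noncomputable def meshIdeal (a b : Q.PathCat k) : Submodule k (a ⟶ b) :=
  Submodule.span k {f | ∃ (x : Q.V) (p : a ⟶ Q.pathObj k (Q.τ x)) (q : Q.pathObj k x ⟶ b),
    f = p ≫ Q.mesh k x ≫ q}

lemma meshIdeal_comp_left {a b c : Q.PathCat k} (p : a ⟶ b) {f : b ⟶ c}
    (hf : f ∈ Q.meshIdeal k b c) : p ≫ f ∈ Q.meshIdeal k a c := by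
  have h : Q.meshIdeal k b c ≤ (Q.meshIdeal k a c).comap (Linear.leftComp k c p) := by
    refine Submodule.span_le.2 ?_
    rintro _ ⟨x, u, v, rfl⟩
    exact Submodule.subset_span ⟨x, p ≫ u, v, by simp⟩
  exact h hf

lemma meshIdeal_comp_right {a b c : Q.PathCat k} {f : a ⟶ b} (q : b ⟶ c)
    (hf : f ∈ Q.meshIdeal k a b) : f ≫ q ∈ Q.meshIdeal k a c := by
  have h : Q.meshIdeal k a b ≤ (Q.meshIdeal k a c).comap (Linear.rightComp k a q) := by
    refine Submodule.span_le.2 ?_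
    rintro _ ⟨x, u, v, rfl⟩
    exact Submodule.subset_span ⟨x, u, v ≫ q, by simp⟩
  exact h hf

/-- Two morphisms of the path category are identified if they differ by an element of the mesh
ideal. -/
def meshRel : HomRel (Q.PathCat k) := fun a b f g => f - g ∈ Q.meshIdeal k a b

instance : Congruence (Q.meshRel k) where
  equivalence := fun {a b} =>
    { refl := fun f => by simp [meshRel]
      symm := fun {f g} h => by
        have := (Q.meshIdeal k a b).neg_mem h
        rwa [neg_sub] at this
      trans := fun {f g h} h₁ h₂ => by
        have := (Q.meshIdeal k a b).add_mem h₁ h₂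
        rwa [sub_add_sub_cancel] at this }
  comp_left := fun p _ _ h => by
    have := Q.meshIdeal_comp_left k p h
    rwa [Preadditive.comp_sub] at this
  comp_right := fun q h => by
    have := Q.meshIdeal_comp_right k q h
    rwa [Preadditive.sub_comp] at this

/-- The mesh category `k(Q)`: the quotient of the `k`-linear path category by the mesh ideal. -/
abbrev MeshCat := CategoryTheory.Quotient (Q.meshRel k)

lemma meshRel_add ⦃a b : Q.PathCat k⦄ (f₁ f₂ g₁ g₂ : a ⟶ b) (hf : Q.meshRel k f₁ f₂)
    (hg : Q.meshRel k g₁ g₂) : Q.meshRel k (f₁ + g₁) (f₂ + g₂) := by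
  have := (Q.meshIdeal k a b).add_mem hf hg
  rwa [sub_add_sub_comm] at this

lemma meshRel_smul (c : k) ⦃a b : Q.PathCat k⦄ (f₁ f₂ : a ⟶ b) (hf : Q.meshRel k f₁ f₂) :
    Q.meshRel k (c • f₁) (c • f₂) := by
  have := (Q.meshIdeal k a b).smul_mem c hf
  rwa [smul_sub] at this

noncomputable instance : Preadditive (Q.MeshCat k) :=
  Quotient.preadditive _ (Q.meshRel_add k)

instance : (Quotient.functor (Q.meshRel k)).Additive :=
  Quotient.functor_additive _ (Q.meshRel_add k)

noncomputable instance : Linear k (Q.MeshCat k) :=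
  Quotient.linear k _ (Q.meshRel_smul k)

end StableTranslationQuiver

/-- The additive completion of a `k`-linear category (finite formal direct sums of objects, with
matrices as morphisms) is `k`-linear, entry by entry. -/
instance matLinear (k : Type*) [Field k] (C : Type*) [Category C] [Preadditive C] [Linear k C] :
    Linear k (Mat_ C) where
  homModule M N := inferInstanceAs (Module k (∀ (i : M.ι) (j : N.ι), M.X i ⟶ N.X j))
  smul_comp M N K c f g := by
    ext i j
    change ∑ l, (c • f i l) ≫ g l j = c • ∑ l, f i l ≫ g l j
    simp [Finset.smul_sum]
  comp_smul M N K f c g := by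
    ext i j
    change ∑ l, f i l ≫ (c • g l j) = c • ∑ l, f i l ≫ g l j
    simp [Finset.smul_sum]

/-! ### Simply laced Dynkin trees and their repetitions -/

/-- The simply laced Dynkin trees. -/
inductive Dynkin : Type
  | A (n : ℕ) (hn : 1 ≤ n) : Dynkin
  | D (n : ℕ) (hn : 4 ≤ n) : Dynkin
  | E (n : ℕ) (hn : 6 ≤ n) (hn' : n ≤ 8) : Dynkin

namespace Dynkin

/-- The number of vertices. -/
@[reducible] def rank : Dynkin → ℕ
  | A n _ => n
  | D n _ => n
  | E n _ _ => n

/-- The arrows, between vertices numbered `1, …, n`: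
* `A n`: `1 → 2 → ⋯ → n`;
* `D n`: `1 → 2 → ⋯ → n - 2` and `n - 1 → n - 2`, `n → n - 2`;
* `E n`: `3 → 2 → 1`, `3 → 4`, `3 → 5 → ⋯ → n`. -/
def NumArrow : Dynkin → ℕ → ℕ → Prop
  | A _ _, i, j => j = i + 1
  | D n _, i, j => (j = i + 1 ∧ j ≤ n - 2) ∨ (i = n - 1 ∧ j = n - 2) ∨ (i = n ∧ j = n - 2)
  | E _ _ _, i, j => (i = 2 ∧ j = 1) ∨ (i = 3 ∧ (j = 2 ∨ j = 4 ∨ j = 5)) ∨ (5 ≤ i ∧ j = i + 1)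

/-- The vertex set. The element `i : Fin n` is the vertex with number `i + 1`. -/
abbrev Vertex (Δ : Dynkin) : Type := Fin Δ.rank

/-- The arrows of the oriented tree `Δ`. -/
def Arrow (Δ : Dynkin) (x y : Δ.Vertex) : Prop := Δ.NumArrow (x.val + 1) (y.val + 1)

/-- The repetition `ℤΔ`: every arrow `x → y` of `Δ` gives arrows `(n, x) → (n, y)` and
`(n - 1, y) → (n, x)`, and the translation is `(n, x) ↦ (n - 1, x)`. -/
@[reducible] def repetition (Δ : Dynkin) : StableTranslationQuiver where
  V := ℤ × Δ.Vertex
  Arrow a b := (a.1 = b.1 ∧ Δ.Arrow a.2 b.2) ∨ (a.1 = b.1 - 1 ∧ Δ.Arrow b.2 a.2)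
  τ := (Equiv.subRight (1 : ℤ)).prodCongr (Equiv.refl _)
  finite_succ := by
    intro a
    refine (((Set.finite_Icc a.1 (a.1 + 1)).prod (Set.finite_univ (α := Δ.Vertex)))).subset ?_
    rintro b (⟨h, -⟩ | ⟨h, -⟩) <;> simp only [Set.mem_prod, Set.mem_Icc, Set.mem_univ] <;> grind
  finite_pred := by
    intro a
    refine (((Set.finite_Icc (a.1 - 1) a.1).prod (Set.finite_univ (α := Δ.Vertex)))).subset ?_
    rintro b (⟨h, -⟩ | ⟨h, -⟩) <;> simp only [Set.mem_prod, Set.mem_Icc, Set.mem_univ] <;> grind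
  arrow_τ := by
    rintro ⟨m, x⟩ ⟨n, y⟩
    simp only [Equiv.prodCongr_apply, Prod.map, Equiv.subRight_apply, Equiv.refl_apply]
    grind

/-- The translation of `ℤΔ`, as an automorphism. -/
abbrev tau (Δ : Dynkin) : Δ.repetition.Aut := Δ.repetition.tauAut

/-- The automorphisms of the oriented tree `Δ`. -/
abbrev TreeAut (Δ : Dynkin) : Type :=
  {φ : Equiv.Perm Δ.Vertex // ∀ x y, Δ.Arrow (φ x) (φ y) ↔ Δ.Arrow x y}

/-- The automorphism `(p, q) ↦ (p, φ q)` of `ℤΔ` induced by an automorphism `φ` of `Δ`. -/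
def liftAut {Δ : Dynkin} (φ : Δ.TreeAut) : Δ.repetition.Aut :=
  ⟨(Equiv.refl ℤ).prodCongr φ.1, by
    rintro ⟨m, x⟩ ⟨n, y⟩
    change (m = n ∧ Δ.Arrow (φ.1 x) (φ.1 y) ∨ m = n - 1 ∧ Δ.Arrow (φ.1 y) (φ.1 x)) ↔
      (m = n ∧ Δ.Arrow x y ∨ m = n - 1 ∧ Δ.Arrow y x)
    rw [φ.2, φ.2], fun _ => rfl⟩

/-- The bijection underlying the automorphism `S` of `ℤA_n`. -/
def suspAEquiv (n : ℕ) : ℤ × Fin n ≃ ℤ × Fin n where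
  toFun a := (a.1 + (a.2.val + 1), a.2.rev)
  invFun a := (a.1 - (a.2.rev.val + 1), a.2.rev)
  left_inv := by
    rintro ⟨p, q⟩
    simp only [Fin.rev_rev, add_sub_cancel_right]
  right_inv := by
    rintro ⟨p, q⟩
    simp only [Fin.rev_rev, sub_add_cancel]

/-- The automorphism `S` of `ℤA_n`. With vertices numbered `1, …, n` it is
`S (p, q) = (p + q, n + 1 - q)`. -/
def suspA (n : ℕ) (hn : 1 ≤ n) : (A n hn).repetition.Aut :=
  ⟨suspAEquiv n, by
    rintro ⟨m, x⟩ ⟨m', y⟩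
    change (m + (x.val + 1) = m' + (y.val + 1) ∧
          (Fin.rev (n := n) y).val + 1 = (Fin.rev (n := n) x).val + 1 + 1 ∨
        m + (x.val + 1) = m' + (y.val + 1) - 1 ∧
          (Fin.rev (n := n) x).val + 1 = (Fin.rev (n := n) y).val + 1 + 1) ↔
      (m = m' ∧ y.val + 1 = x.val + 1 + 1 ∨ m = m' - 1 ∧ x.val + 1 = y.val + 1 + 1)
    change Fin n at x y
    simp only [Fin.val_rev]
    have hx := x.2
    have hy := y.2
    omega, by
    rintro ⟨m, x⟩
    change (_, _) = (_, _)
    refine Prod.ext ?_ rfl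
    change m - 1 + (x.val + 1 : ℤ) = m + (x.val + 1) - 1
    ring⟩

lemma swapD_val (n : ℕ) (hn : 4 ≤ n) (x : Fin n) :
    (Equiv.swap (⟨n - 2, by omega⟩ : Fin n) ⟨n - 1, by omega⟩ x).val =
      if x.val = n - 2 then n - 1 else if x.val = n - 1 then n - 2 else x.val := by
  rw [Equiv.swap_apply_def]
  simp only [Fin.ext_iff]
  split_ifs <;> rfl

lemma swapD_arrow (n : ℕ) (hn : 4 ≤ n) (x y : Fin n) :
    (D n hn).NumArrow
      ((Equiv.swap (⟨n - 2, by omega⟩ : Fin n) ⟨n - 1, by omega⟩ x).val + 1)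
      ((Equiv.swap (⟨n - 2, by omega⟩ : Fin n) ⟨n - 1, by omega⟩ y).val + 1) ↔
    (D n hn).NumArrow (x.val + 1) (y.val + 1) := by
  rw [swapD_val n hn, swapD_val n hn]
  have hx := x.2
  have hy := y.2
  simp only [NumArrow]
  split_ifs <;> omega

/-- The automorphism of `D_n` that exchanges the vertices `n - 1` and `n`. -/
def swapD (n : ℕ) (hn : 4 ≤ n) : (D n hn).TreeAut :=
  ⟨(Equiv.swap (⟨n - 2, by omega⟩ : Fin n) ⟨n - 1, by omega⟩ : Equiv.Perm (Fin n)), by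
    intro x y
    exact swapD_arrow n hn x y⟩

/-- The automorphism of `E_6` that exchanges `2` and `5`, and `1` and `6`. -/
def swapE6 : (E 6 (by norm_num) (by norm_num)).TreeAut :=
  ⟨(Equiv.swap (1 : Fin 6) 4 * Equiv.swap (0 : Fin 6) 5 : Equiv.Perm (Fin 6)), by
    intro (x : Fin 6) (y : Fin 6)
    simp only [Arrow, NumArrow]
    fin_cases x <;> fin_cases y <;> decide⟩

/-- The automorphisms `φ` of `ℤΔ` with a large translation part, type by type. -/
inductive IsLargeGenerator : (Δ : Dynkin) → Δ.repetition.Aut → Prop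
  | A_odd (n : ℕ) (hn : 1 ≤ n) (h : Odd n) (r : ℕ) (hr : (n - 1) / 2 ≤ r) :
      IsLargeGenerator (A n hn) ((A n hn).tau ^ r)
  | A_odd_flip (n : ℕ) (hn : 1 ≤ n) (h : Odd n) (r : ℕ) (hr : (n - 1) / 2 ≤ r) :
      IsLargeGenerator (A n hn) ((A n hn).tau ^ r * ((A n hn).tau ^ ((n + 1) / 2) * suspA n hn))
  | A_even (n : ℕ) (hn : 1 ≤ n) (h : Even n) (r : ℕ) (hr : n - 1 ≤ r) :
      IsLargeGenerator (A n hn) (((A n hn).tau ^ (n / 2) * suspA n hn) ^ r)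
  | D (n : ℕ) (hn : 4 ≤ n) (h : 5 ≤ n) (r : ℕ) (hr : n - 2 ≤ r) :
      IsLargeGenerator (D n hn) ((D n hn).tau ^ r)
  | D_flip (n : ℕ) (hn : 4 ≤ n) (h : 5 ≤ n) (r : ℕ) (hr : n - 2 ≤ r) :
      IsLargeGenerator (D n hn) ((D n hn).tau ^ r * liftAut (swapD n hn))
  | D4 (hn : 4 ≤ 4) (φ : (D 4 hn).TreeAut) (r : ℕ) (hr : 2 ≤ r) :
      IsLargeGenerator (D 4 hn) (liftAut φ * (D 4 hn).tau ^ r)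
  | E6 (hn : 6 ≤ 6) (hn' : 6 ≤ 8) (r : ℕ) (hr : 5 ≤ r) :
      IsLargeGenerator (E 6 hn hn') ((E 6 hn hn').tau ^ r)
  | E6_flip (hn : 6 ≤ 6) (hn' : 6 ≤ 8) (r : ℕ) (hr : 5 ≤ r) :
      IsLargeGenerator (E 6 hn hn') ((E 6 hn hn').tau ^ r * liftAut swapE6)
  | E7 (hn : 6 ≤ 7) (hn' : 7 ≤ 8) (r : ℕ) (hr : 8 ≤ r) :
      IsLargeGenerator (E 7 hn hn') ((E 7 hn hn').tau ^ r)
  | E8 (hn : 6 ≤ 8) (hn' : 8 ≤ 8) (r : ℕ) (hr : 14 ≤ r) :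
      IsLargeGenerator (E 8 hn hn') ((E 8 hn hn').tau ^ r)

end Dynkin

/-! ### The Auslander-Reiten quiver of a triangulated category -/

section Radical

variable (k : Type*) [Field k] {C : Type*} [Category C] [Preadditive C] [Linear k C]

/-- The radical `R(X, Y)` of the bifunctor `Hom`: the morphisms `f : X ⟶ Y` such that `1 - g f` is
invertible for every `g : Y ⟶ X`. -/
def homRadical (X Y : C) : Submodule k (X ⟶ Y) where
  carrier := {f | ∀ g : Y ⟶ X, IsIso (𝟙 X - f ≫ g)}
  zero_mem' := fun g => by
    rw [zero_comp, sub_zero]; infer_instance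
  add_mem' := by
    intro a b ha hb g
    have := ha g
    have := hb (g ≫ inv (𝟙 X - a ≫ g))
    have h : 𝟙 X - (a + b) ≫ g =
        (𝟙 X - b ≫ g ≫ inv (𝟙 X - a ≫ g)) ≫ (𝟙 X - a ≫ g) := by
      rw [Preadditive.sub_comp, Category.assoc, Category.assoc, IsIso.inv_hom_id,
        Category.comp_id, Category.id_comp, Preadditive.add_comp]
      abel
    rw [h]; infer_instance
  smul_mem' := by
    intro c f hf g
    have := hf (c • g)
    rwa [Linear.comp_smul, ← Linear.smul_comp] at this

/-- The square `R²(X, Y)` of the radical: sums of composites `X ⟶ Z ⟶ Y` of two radical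
morphisms. -/
def homRadicalSq (X Y : C) : Submodule k (X ⟶ Y) :=
  Submodule.span k
    {f | ∃ (Z : C) (h : X ⟶ Z) (g : Z ⟶ Y), h ∈ homRadical k X Z ∧ g ∈ homRadical k Z Y ∧ f = h ≫ g}

/-- `dim_k R(X, Y) / R²(X, Y)`: the valuation of the Auslander-Reiten quiver at `([X], [Y])`; there
is an arrow `[X] → [Y]` exactly when the quotient is not zero. -/
noncomputable def irrDim (X Y : C) : ℕ :=
  Module.finrank k (homRadical k X Y ⧸ (homRadicalSq k X Y).submoduleOf (homRadical k X Y))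

end Radical

section Triangulated

variable (T : Type*) [Category T] [Preadditive T] [HasZeroObject T] [HasShift T ℤ]
  [∀ n : ℤ, (shiftFunctor T n).Additive] [Pretriangulated T]

/-- `ind T`: the full subcategory of the indecomposable objects. -/
abbrev IndObj := ObjectProperty.FullSubcategory (fun X : T => Indecomposable X)

/-- The isomorphism classes of indecomposable objects, that is, the vertices of the
Auslander-Reiten quiver. -/
abbrev IndClass := Quotient (isIsomorphicSetoid (IndObj T))

variable {T}

/-- The class of an indecomposable object. -/
def indClass (X : T) (hX : Indecomposable X) : IndClass T :=
  Quotient.mk (isIsomorphicSetoid (IndObj T)) ⟨X, hX⟩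

/-- Auslander-Reiten triangles `X ⟶ Y ⟶ Z ⟶ X⟦1⟧`. -/
structure IsARTriangle (t : Triangle T) : Prop where
  distinguished : t ∈ distTriang T
  indecomposable₁ : Indecomposable t.obj₁
  indecomposable₃ : Indecomposable t.obj₃
  mor₃_ne_zero : t.mor₃ ≠ 0
  lift : ∀ {W : T} (f : W ⟶ t.obj₃), ¬ IsSplitEpi f → ∃ f' : W ⟶ t.obj₂, f' ≫ t.mor₂ = f
  desc : ∀ {V : T} (g : t.obj₁ ⟶ V), ¬ IsSplitMono g → ∃ g' : t.obj₂ ⟶ V, t.mor₁ ≫ g' = g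

variable (T) (k : Type*) [Field k] [Linear k T]

/-- An isomorphism of valued translation quivers from the Auslander-Reiten quiver of `T` to the
quiver `Q` in which all arrows have valuation `1`: a bijection between the vertices that respects
the arrows, their valuations, and the translation, which on the side of `T` sends the end term of
an Auslander-Reiten triangle to its first term. -/
structure ARQuiverIso (Q : StableTranslationQuiver) where
  /-- the bijection on vertices -/
  θ : IndClass T ≃ Q.V
  irrDim_of_arrow : ∀ (X Y : T) (hX : Indecomposable X) (hY : Indecomposable Y),
    Q.Arrow (θ (indClass X hX)) (θ (indClass Y hY)) → irrDim k X Y = 1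
  irrDim_of_not_arrow : ∀ (X Y : T) (hX : Indecomposable X) (hY : Indecomposable Y),
    ¬ Q.Arrow (θ (indClass X hX)) (θ (indClass Y hY)) → irrDim k X Y = 0
  translation : ∀ (t : Triangle T) (ht : IsARTriangle t),
    θ (indClass t.obj₁ ht.indecomposable₁) = Q.τ (θ (indClass t.obj₃ ht.indecomposable₃))

/-- `T` is standard, with Auslander-Reiten quiver `Q`: `ind T` is `k`-linearly equivalent to the
mesh category `k(Q)`, and `T` itself is `k`-linearly equivalent to the additive category of finite
direct sums of objects of `k(Q)`. -/
def IsStandard (Q : StableTranslationQuiver) : Prop :=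
  (∃ e : IndObj T ≌ Q.MeshCat k, e.functor.Additive ∧ e.functor.Linear k) ∧
    ∃ e : T ≌ Mat_ (Q.MeshCat k), e.functor.Additive ∧ e.functor.Linear k

end Triangulated

/-!
Let `h` be the Coxeter number of `Δ`, and let `Q = ℤΔ / G` be the Auslander-Reiten quiver of `T`.
Choosing an irreducible map for every arrow of `Q` gives a functor from the path category of `Q`
to `ind T`, which is full because the radical of `T` is nilpotent. It remains to choose the
irreducible maps such that the mesh relations hold (`ARSystem.exists_isMesh_self`), and to see
that no further relations occur (`ARSystem.IsMesh.mem_meshIdeal`).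

*Choice of the maps.* Auslander-Reiten triangles exist in `T` (`ARSystem.exists_isARTriangle`):
the triangle on a sink map is one. So a family of irreducible maps, used for the second arrow of
every mesh, determines a second family for the first arrow such that the mesh relations hold, and
conversely. Iterating this gives families `s n` for all integers `n` such that the mesh relations
hold for `s n` followed by `s (n + 1)` (`ARSystem.exists_chain_isMesh`). Composites along paths,
taken with this chain, have a well-defined length: paths of different lengths are linearly
independent, because `Hom(W, -)` and `Hom(-, W)` are exact at the meshes
(`ARSystem.pathSpan_independent_right`, `ARSystem.pathSpan_independent_left`).

The dimensions of the spaces of paths of a given length starting at a fixed vertex are additive on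
the meshes as long as the length does not exceed the maximal one. Pairing them with the solution
`w` of the same recursion on `Δ` that starts with `w 0 = 0` and `w 1 = 1` gives a discrete
Wronskian, which is constant (`StableTranslationQuiver.sum_eq_zero_of_additiveSeq`). Since
`w h = 0` (`Dynkin.additiveSeq_coxeter`), all paths of length `h - 1` vanish
(`ARSystem.pathSpan_eq_bot_of_additiveSeq`).

Grade `ℤΔ` such that arrows have degree one. The hypothesis on `G` says that its generator shifts
this grading by at least `h - 2`. Therefore a path of length at least two that is parallel to an
arrow of `Q` has length at least `h - 1` (`Dynkin.IsLargeGenerator.le_of_hasPath`) and vanishes,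
so that the square of the radical is zero between the ends of an arrow, and any two irreducible
maps there are proportional. In particular two consecutive families of the chain are proportional.
The scalars can be removed by rescaling the maps
(`StableTranslationQuiver.NoCirculation.exists_rescaling`): `kˣ` is divisible, and the characters
by which rescaling acts are independent since `Δ` is a tree (`Dynkin.eq_zero_of_sum_eq_zero`).

*Relations.* With the resulting single family, homogeneous relations follow by induction on the
length: by exactness, a relation between paths ending at `y` is, modulo shorter ones, a multiple
of the mesh ending at `y`. Every relation is a sum of homogeneous ones by the independence of
paths of different lengths.
-/

/-! ### The radical of a Krull-Schmidt category -/

section RadicalBasics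

variable {k : Type*} [Field k] {C : Type*} [Category C] [Preadditive C] [Linear k C]

/-- The inverse of `1 - g f` is `1 + g (1 - f g)⁻¹ f`. -/
lemma isIso_one_sub_comp_swap {X Y : C} {f : X ⟶ Y} {g : Y ⟶ X} (h : IsIso (𝟙 X - f ≫ g)) :
    IsIso (𝟙 Y - g ≫ f) := by
  have h1 : f ≫ g ≫ inv (𝟙 X - f ≫ g) = inv (𝟙 X - f ≫ g) - 𝟙 X := by
    have := IsIso.hom_inv_id (𝟙 X - f ≫ g)
    rw [Preadditive.sub_comp, Category.id_comp, Category.assoc] at this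
    exact (sub_eq_of_eq_add (sub_eq_iff_eq_add'.1 this)).symm
  have h2 : inv (𝟙 X - f ≫ g) ≫ f ≫ g = inv (𝟙 X - f ≫ g) - 𝟙 X := by
    have := IsIso.inv_hom_id (𝟙 X - f ≫ g)
    rw [Preadditive.comp_sub, Category.comp_id] at this
    exact (sub_eq_of_eq_add (sub_eq_iff_eq_add'.1 this)).symm
  refine ⟨𝟙 Y + g ≫ inv (𝟙 X - f ≫ g) ≫ f, ?_, ?_⟩
  · simp only [Preadditive.comp_add, Preadditive.sub_comp, Category.comp_id, Category.id_comp,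
      Category.assoc]
    have := congrArg (fun t => g ≫ t ≫ f) h1
    simp only [Category.assoc, Preadditive.sub_comp, Preadditive.comp_sub, Category.id_comp] at this
    rw [this]; abel
  · simp only [Preadditive.add_comp, Preadditive.comp_sub, Category.comp_id, Category.id_comp,
      Category.assoc]
    have := congrArg (fun t => g ≫ t ≫ f) h2
    simp only [Category.assoc, Preadditive.sub_comp, Preadditive.comp_sub, Category.id_comp] at this
    rw [this]; abel

lemma comp_mem_homRadical_right {X Y Z : C} {f : X ⟶ Y} (hf : f ∈ homRadical k X Y) (h : Y ⟶ Z) :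
    f ≫ h ∈ homRadical k X Z := fun g => by
  rw [Category.assoc]; exact hf (h ≫ g)

lemma comp_mem_homRadical_left {X Y Z : C} (h : X ⟶ Y) {f : Y ⟶ Z} (hf : f ∈ homRadical k Y Z) :
    h ≫ f ∈ homRadical k X Z := fun g => by
  have := isIso_one_sub_comp_swap (f := f ≫ g) (g := h) (by rw [Category.assoc]; exact hf (g ≫ h))
  rwa [Category.assoc]

lemma isIso_one_sub_of_mem {X : C} {f : X ⟶ X} (hf : f ∈ homRadical k X X) : IsIso (𝟙 X - f) := by
  simpa using hf (𝟙 X)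

variable (k) in
lemma isZero_of_isIso_mem {X Y : C} {f : X ⟶ Y} [IsIso f] (hf : f ∈ homRadical k X Y) :
    IsZero X := by
  have h := hf (inv f)
  rw [IsIso.hom_inv_id, sub_self] at h
  exact (IsZero.iff_id_eq_zero X).2 (by
    rw [← IsIso.hom_inv_id (0 : X ⟶ X), zero_comp])

lemma homRadicalSq_le {X Y : C} : homRadicalSq k X Y ≤ homRadical k X Y := by
  refine Submodule.span_le.2 ?_
  rintro _ ⟨Z, h, g, hh, hg, rfl⟩
  exact comp_mem_homRadical_right hh g

lemma comp_mem_homRadicalSq {X Y Z : C} {f : X ⟶ Y} {g : Y ⟶ Z} (hf : f ∈ homRadical k X Y)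
    (hg : g ∈ homRadical k Y Z) : f ≫ g ∈ homRadicalSq k X Z :=
  Submodule.subset_span ⟨Y, f, g, hf, hg, rfl⟩

lemma homRadicalSq_comp_right {X Y Z : C} {f : X ⟶ Y} (hf : f ∈ homRadicalSq k X Y) (g : Y ⟶ Z) :
    f ≫ g ∈ homRadicalSq k X Z := by
  have : homRadicalSq k X Y ≤ (homRadicalSq k X Z).comap (Linear.rightComp k X g) := by
    refine Submodule.span_le.2 ?_
    rintro _ ⟨W, h, h', hh, hg, rfl⟩
    refine Submodule.subset_span ⟨W, h, h' ≫ g, hh, comp_mem_homRadical_right hg g, ?_⟩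
    simp
  exact this hf

lemma homRadicalSq_comp_left {X Y Z : C} (g : X ⟶ Y) {f : Y ⟶ Z} (hf : f ∈ homRadicalSq k Y Z) :
    g ≫ f ∈ homRadicalSq k X Z := by
  have : homRadicalSq k Y Z ≤ (homRadicalSq k X Z).comap (Linear.leftComp k Z g) := by
    refine Submodule.span_le.2 ?_
    rintro _ ⟨W, h, h', hh, hg, rfl⟩
    refine Submodule.subset_span ⟨W, g ≫ h, h', comp_mem_homRadical_left g hh, hg, ?_⟩
    simp
  exact this hf

variable (k) in
lemma not_isSplitEpi_of_mem {X Y : C} (hY : ¬ IsZero Y) {f : X ⟶ Y}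
    (hf : f ∈ homRadical k X Y) : ¬ IsSplitEpi f := by
  rintro ⟨⟨s⟩⟩
  have : 𝟙 Y ∈ homRadical k Y Y := s.id ▸ comp_mem_homRadical_left s.section_ hf
  exact hY (isZero_of_isIso_mem k this)

variable (k) in
lemma not_isSplitMono_of_mem {X Y : C} (hX : ¬ IsZero X) {f : X ⟶ Y}
    (hf : f ∈ homRadical k X Y) : ¬ IsSplitMono f := by
  rintro ⟨⟨s⟩⟩
  have : 𝟙 X ∈ homRadical k X X := s.id ▸ comp_mem_homRadical_right hf s.retraction
  exact hX (isZero_of_isIso_mem k this)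

end RadicalBasics

section Indecomposables

variable {C : Type*} [Category C] [Preadditive C] [HasBinaryBiproducts C]

/-- A split idempotent decomposes its object into its image and the image of its complement. -/
lemma exists_iso_biprod_of_idem [IsIdempotentComplete C] {X : C} (e : X ⟶ X) (he : e ≫ e = e) :
    ∃ (Y Z : C) (i : Y ⟶ X) (p : X ⟶ Y) (i' : Z ⟶ X) (p' : X ⟶ Z),
      i ≫ p = 𝟙 Y ∧ p ≫ i = e ∧ i' ≫ p' = 𝟙 Z ∧ p' ≫ i' = 𝟙 X - e ∧ Nonempty (X ≅ Y ⊞ Z) := by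
  obtain ⟨Y, i, p, h1, h2⟩ := IsIdempotentComplete.idempotents_split X e he
  have he' : (𝟙 X - e) ≫ (𝟙 X - e) = 𝟙 X - e := by simp [he]
  obtain ⟨Z, i', p', h3, h4⟩ := IsIdempotentComplete.idempotents_split X (𝟙 X - e) he'
  refine ⟨Y, Z, i, p, i', p', h1, h2, h3, h4, ⟨biprod.lift p p', biprod.desc i i', ?_, ?_⟩⟩
  · rw [biprod.lift_desc, h2, h4]; abel
  · have a1 : i ≫ p' = 0 := by
      calc i ≫ p' = (i ≫ p) ≫ i ≫ p' ≫ (i' ≫ p') := by rw [h1, h3]; simp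
        _ = i ≫ (p ≫ i) ≫ (p' ≫ i') ≫ p' := by simp only [Category.assoc]
        _ = 0 := by rw [h2, h4]; simp [reassoc_of% he]
    have a2 : i' ≫ p = 0 := by
      calc i' ≫ p = (i' ≫ p') ≫ i' ≫ p ≫ (i ≫ p) := by rw [h1, h3]; simp
        _ = i' ≫ (p' ≫ i') ≫ (p ≫ i) ≫ p := by simp only [Category.assoc]
        _ = 0 := by rw [h2, h4]; simp [reassoc_of% he]
    ext <;> simp [h1, h3, a1, a2]

lemma CategoryTheory.Indecomposable.idem_eq [IsIdempotentComplete C] {X : C}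
    (hX : Indecomposable X) (e : X ⟶ X) (he : e ≫ e = e) : e = 0 ∨ e = 𝟙 X := by
  obtain ⟨Y, Z, i, p, i', p', h1, h2, h3, h4, ⟨φ⟩⟩ := exists_iso_biprod_of_idem e he
  rcases hX.2 Y Z φ with h | h
  · left; rw [← h2, h.eq_of_src i 0, comp_zero]
  · right
    rw [h.eq_of_src i' 0, comp_zero] at h4
    exact (sub_eq_zero.1 h4.symm).symm

lemma indecomposable_of_idem_eq {X : C} (h0 : ¬ IsZero X)
    (h : ∀ e : X ⟶ X, e ≫ e = e → e = 0 ∨ e = 𝟙 X) : Indecomposable X := by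
  refine ⟨h0, fun Y Z φ => ?_⟩
  rcases h (φ.hom ≫ biprod.fst ≫ biprod.inl ≫ φ.inv) (by simp) with h | h
  · left
    rw [IsZero.iff_id_eq_zero]
    have := congrArg (fun t => biprod.inl ≫ φ.inv ≫ t ≫ φ.hom ≫ biprod.fst) h
    simpa using this
  · right
    rw [IsZero.iff_id_eq_zero]
    have := congrArg (fun t => biprod.inr ≫ φ.inv ≫ t ≫ φ.hom ≫ biprod.snd) h
    simpa using this.symm

lemma CategoryTheory.Indecomposable.of_iso {X Y : C} (hX : Indecomposable X) (e : X ≅ Y) :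
    Indecomposable Y :=
  ⟨fun h => hX.1 (h.of_iso e), fun A B φ => hX.2 A B (e ≪≫ φ)⟩

lemma CategoryTheory.Indecomposable.id_ne_zero {X : C} (hX : Indecomposable X) : 𝟙 X ≠ 0 := fun h =>
  hX.1 ((IsZero.iff_id_eq_zero X).2 h)

end Indecomposables

section KrullSchmidt

variable {C : Type*} [Category C] [Preadditive C] [HasBinaryBiproducts C] [IsIdempotentComplete C]

lemma CategoryTheory.Indecomposable.isIso_of_comp_eq_id {X Y : C} (hX : Indecomposable X)
    (hY : Indecomposable Y) {f : X ⟶ Y} {g : Y ⟶ X} (h : f ≫ g = 𝟙 X) : IsIso f := by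
  rcases hY.idem_eq (g ≫ f) (by simp [reassoc_of% h]) with h' | h'
  · exfalso
    apply hX.id_ne_zero
    calc 𝟙 X = f ≫ (g ≫ f) ≫ g := by simp [h]
      _ = 0 := by rw [h']; simp
  · exact ⟨g, h, h'⟩

/-- The endomorphism ring of an indecomposable object is local. By the Fitting lemma for
composition with `f`, the identity is the sum of an idempotent in the stable range and an element
of the stable kernel. -/
lemma CategoryTheory.Indecomposable.isIso_or_isIso_one_sub (k : Type*) [Field k] [Linear k C]
    [∀ X Y : C, Module.Finite k (X ⟶ Y)] {X : C} (hX : Indecomposable X) (f : X ⟶ X) :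
    IsIso f ∨ IsIso (𝟙 X - f) := by
  let L : Module.End k (X ⟶ X) := Linear.rightComp k X f
  obtain ⟨n, hn, hn1⟩ := (L.eventually_isCompl_ker_pow_range_pow.and
    (Filter.eventually_ge_atTop 1)).exists
  have hL : ∀ (m : ℕ) (g h : X ⟶ X), (L ^ m) (g ≫ h) = g ≫ (L ^ m) h := by
    intro m
    induction m with
    | zero => intro g h; simp
    | succ m ih => intro g h; simp only [pow_succ, Module.End.mul_apply]; rw [← ih]; simp [L]
  obtain ⟨e, he, e', he', hee⟩ := Submodule.mem_sup.1
    (show 𝟙 X ∈ LinearMap.ker (L ^ n) ⊔ LinearMap.range (L ^ n) by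
      rw [hn.sup_eq_top]; trivial)
  obtain ⟨g, hg⟩ := he'
  have h1 : e' ≫ e ∈ LinearMap.ker (L ^ n) := by
    rw [LinearMap.mem_ker] at he ⊢
    rw [hL, he, comp_zero]
  have h2 : e' ≫ e ∈ LinearMap.range (L ^ n) := by
    have : e' ≫ e = e' - e' ≫ e' := by
      rw [eq_sub_iff_add_eq, ← Preadditive.comp_add, hee, Category.comp_id]
    rw [this]
    refine Submodule.sub_mem _ ⟨g, hg⟩ ⟨e' ≫ g, ?_⟩
    rw [hL, hg]
  have h3 : e' ≫ e = 0 := Submodule.disjoint_def.1 hn.disjoint _ h1 h2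
  have h4 : e' ≫ e' = e' := by
    have := congrArg (fun t => e' ≫ t) hee
    simpa [h3] using this
  rcases hX.idem_eq e' h4 with h | h
  · right
    have hnil : (L ^ n) (𝟙 X) = 0 := by
      have : e = 𝟙 X := by simpa [h] using hee
      rw [this] at he; exact he
    have hnil' : IsNilpotent (show End X from f) := by
      refine ⟨n, ?_⟩
      rw [← hnil]
      clear * -
      induction n with
      | zero => rfl
      | succ m ih =>
        rw [pow_succ', pow_succ', Module.End.mul_apply, ← ih]
        rfl
    have := (hnil'.isUnit_one_sub)
    exact (isUnit_iff_isIso _).1 this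
  · left
    obtain ⟨m, rfl⟩ : ∃ m, n = m + 1 := ⟨n - 1, by omega⟩
    rw [h, pow_succ', Module.End.mul_apply] at hg
    have hg' : (L ^ m) g ≫ f = 𝟙 X := hg
    have := hX.isIso_of_comp_eq_id hX hg'
    have h5 : f = inv ((L ^ m) g) := by
      rw [IsIso.eq_inv_of_hom_inv_id hg']
    rw [h5]; infer_instance

variable (k : Type*) [Field k] [Linear k C] [∀ X Y : C, Module.Finite k (X ⟶ Y)]

lemma CategoryTheory.Indecomposable.mem_homRadical_of_not_isSplitMono {X Y : C}
    (hX : Indecomposable X) {f : X ⟶ Y} (hf : ¬ IsSplitMono f) : f ∈ homRadical k X Y := fun g => by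
  rcases hX.isIso_or_isIso_one_sub k (f ≫ g) with h | h
  · exact absurd (IsSplitMono.mk' ⟨g ≫ inv (f ≫ g), by
      rw [← Category.assoc, IsIso.hom_inv_id]⟩) hf
  · exact h

lemma CategoryTheory.Indecomposable.mem_homRadical_of_not_isSplitEpi {X Y : C}
    (hY : Indecomposable Y) {f : X ⟶ Y} (hf : ¬ IsSplitEpi f) : f ∈ homRadical k X Y := fun g => by
  rcases hY.isIso_or_isIso_one_sub k (g ≫ f) with h | h
  · exact absurd (IsSplitEpi.mk' ⟨inv (g ≫ f) ≫ g, by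
      rw [Category.assoc, IsIso.inv_hom_id]⟩) hf
  · exact isIso_one_sub_comp_swap h

lemma CategoryTheory.Indecomposable.isIso_or_mem_homRadical {X Y : C} (hX : Indecomposable X)
    (hY : Indecomposable Y) (f : X ⟶ Y) : IsIso f ∨ f ∈ homRadical k X Y := by
  by_cases h : IsSplitMono f
  · obtain ⟨⟨s⟩⟩ := h
    exact Or.inl (hX.isIso_of_comp_eq_id hY s.id)
  · exact Or.inr (hX.mem_homRadical_of_not_isSplitMono k h)

/-- The residue field of the endomorphism ring of an indecomposable object is `k`. -/
lemma CategoryTheory.Indecomposable.exists_smul_sub_mem [IsAlgClosed k] {X : C}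
    (hX : Indecomposable X) (f : X ⟶ X) : ∃ c : k, f - c • 𝟙 X ∈ homRadical k X X := by
  have : Nontrivial (X ⟶ X) := ⟨𝟙 X, 0, hX.id_ne_zero⟩
  obtain ⟨c, hc⟩ := Module.End.exists_eigenvalue (K := k) (Linear.rightComp k X f : Module.End k _)
  obtain ⟨g, hg⟩ := hc.exists_hasEigenvector
  refine ⟨c, (hX.isIso_or_mem_homRadical k hX _).resolve_left fun h => hg.2 ?_⟩
  have h1 : g ≫ f = c • g := hg.apply_eq_smul
  have h2 : g ≫ (f - c • 𝟙 X) = 0 := by simp [h1]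
  rwa [← cancel_mono (f - c • 𝟙 X), zero_comp]

/-- Every object is a finite direct sum of indecomposable objects, in terms of inclusions `b i` and
projections `a i`. -/
lemma exists_decomposition (k : Type*) [Field k] [Linear k C]
    [∀ X Y : C, Module.Finite k (X ⟶ Y)] (X : C) :
    ∃ (ι : Type) (_ : Fintype ι) (Y : ι → C) (a : ∀ i, X ⟶ Y i) (b : ∀ i, Y i ⟶ X),
      (∀ i, Indecomposable (Y i)) ∧ (∀ i, b i ≫ a i = 𝟙 _) ∧
      (∀ i j, i ≠ j → b i ≫ a j = 0) ∧ ∑ i, a i ≫ b i = 𝟙 X := by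
  induction hd : Module.finrank k (X ⟶ X) using Nat.strong_induction_on generalizing X with
  | _ d ih =>
  by_cases h0 : IsZero X
  · exact ⟨Empty, inferInstance, fun i => i.elim, fun i => i.elim, fun i => i.elim,
      fun i => i.elim, fun i => i.elim, fun i => i.elim, by simpa using h0.eq_of_src _ _⟩
  by_cases hX : Indecomposable X
  · exact ⟨Unit, inferInstance, fun _ => X, fun _ => 𝟙 X, fun _ => 𝟙 X, fun _ => hX, by simp,
      fun i j h => absurd rfl h, by simp⟩
  obtain ⟨e, he, he0, he1⟩ : ∃ e : X ⟶ X, e ≫ e = e ∧ e ≠ 0 ∧ e ≠ 𝟙 X := by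
    by_contra! H
    exact hX (indecomposable_of_idem_eq h0 fun e he => or_iff_not_imp_left.2 fun h => H e he h)
  obtain ⟨A, B, i, p, i', p', h1, h2, h3, h4, -⟩ := exists_iso_biprod_of_idem e he
  have hip : i ≫ p' = 0 := by
    calc i ≫ p' = (i ≫ p) ≫ i ≫ p' ≫ (i' ≫ p') := by rw [h1, h3]; simp
      _ = i ≫ (p ≫ i) ≫ (p' ≫ i') ≫ p' := by simp only [Category.assoc]
      _ = 0 := by rw [h2, h4]; simp [reassoc_of% he]
  have hip' : i' ≫ p = 0 := by
    calc i' ≫ p = (i' ≫ p') ≫ i' ≫ p ≫ (i ≫ p) := by rw [h1, h3]; simp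
      _ = i' ≫ (p' ≫ i') ≫ (p ≫ i) ≫ p := by simp only [Category.assoc]
      _ = 0 := by rw [h2, h4]; simp [reassoc_of% he]
  have hA : 𝟙 A ≠ 0 := fun h => he0 (by rw [← h2, ← Category.id_comp i, h]; simp)
  have hB : 𝟙 B ≠ 0 := fun h => he1 (by
    rw [← Category.id_comp i', h] at h4
    simpa using (sub_eq_zero.1 (show 𝟙 X - e = 0 by rw [← h4]; simp)).symm)
  -- the corner embedding `End A × End B → End X` is injective, so both corners are smaller
  let ψ : ((A ⟶ A) × (B ⟶ B)) →ₗ[k] (X ⟶ X) :=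
    ((Linear.leftComp k X p).comp (Linear.rightComp k A i)).coprod
      ((Linear.leftComp k X p').comp (Linear.rightComp k B i'))
  have hψ : Function.Injective ψ := by
    rw [injective_iff_map_eq_zero]
    rintro ⟨f, g⟩ h
    have h' : p ≫ f ≫ i + p' ≫ g ≫ i' = 0 := h
    have e1 := congrArg (fun t => i ≫ t ≫ p) h'
    have e2 := congrArg (fun t => i' ≫ t ≫ p') h'
    simp only [Preadditive.add_comp, Preadditive.comp_add, Category.assoc, h1, reassoc_of% h1,
      reassoc_of% hip, h3, reassoc_of% h3, reassoc_of% hip', zero_comp, comp_zero,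
      Category.comp_id, add_zero, zero_add] at e1 e2
    rw [e1, e2]; rfl
  have hle := LinearMap.finrank_le_finrank_of_injective hψ
  rw [Module.finrank_prod] at hle
  have : Nontrivial (A ⟶ A) := ⟨_, _, hA⟩
  have : Nontrivial (B ⟶ B) := ⟨_, _, hB⟩
  have hA' : 0 < Module.finrank k (A ⟶ A) := Module.finrank_pos
  have hB' : 0 < Module.finrank k (B ⟶ B) := Module.finrank_pos
  obtain ⟨ι, _, Y, a, b, hY, c1, c2, c3⟩ := ih _ (by omega) A rfl
  obtain ⟨ι', _, Y', a', b', hY', c1', c2', c3'⟩ := ih _ (by omega) B rfl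
  refine ⟨ι ⊕ ι', inferInstance, Sum.elim Y Y', fun j => Sum.rec (fun j => p ≫ a j)
    (fun j => p' ≫ a' j) j, fun j => Sum.rec (fun j => b j ≫ i) (fun j => b' j ≫ i') j,
    ?_, ?_, ?_, ?_⟩
  · rintro (j | j)
    exacts [hY j, hY' j]
  · rintro (j | j)
    · simpa [reassoc_of% h1] using c1 j
    · simpa [reassoc_of% h3] using c1' j
  · rintro (j | j) (l | l) h
    · change ((b j ≫ i) ≫ p ≫ a l : Y j ⟶ Y l) = 0
      simpa [reassoc_of% h1] using c2 j l (fun h' => h (congrArg _ h'))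
    · change ((b j ≫ i) ≫ p' ≫ a' l : Y j ⟶ Y' l) = 0
      simp [reassoc_of% hip]
    · change ((b' j ≫ i') ≫ p ≫ a l : Y' j ⟶ Y l) = 0
      simp [reassoc_of% hip']
    · change ((b' j ≫ i') ≫ p' ≫ a' l : Y' j ⟶ Y' l) = 0
      simpa [reassoc_of% h3] using c2' j l (fun h' => h (congrArg _ h'))
  · rw [Fintype.sum_sum_type]
    have d1 : ∑ j, (p ≫ a j) ≫ b j ≫ i = e := by
      rw [← h2]
      conv_rhs => rw [← Category.id_comp i, ← c3, Preadditive.sum_comp, Preadditive.comp_sum]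
      simp
    have d2 : ∑ j, (p' ≫ a' j) ≫ b' j ≫ i' = 𝟙 X - e := by
      rw [← h4]
      conv_rhs => rw [← Category.id_comp i', ← c3', Preadditive.sum_comp, Preadditive.comp_sum]
      simp
    change ∑ j, (p ≫ a j) ≫ b j ≫ i + ∑ j, (p' ≫ a' j) ≫ b' j ≫ i' = _
    rw [d1, d2]; abel

/-- A decomposition by inclusions and projections is an isomorphism with the biproduct. -/
lemma nonempty_iso_biproduct {C : Type*} [Category C] [Preadditive C] [HasFiniteBiproducts C]
    {ι : Type} [Fintype ι] {X : C} (Y : ι → C) (a : ∀ i, X ⟶ Y i)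
    (b : ∀ i, Y i ⟶ X) (h1 : ∀ i, b i ≫ a i = 𝟙 _) (h2 : ∀ i j, i ≠ j → b i ≫ a j = 0)
    (h3 : ∑ i, a i ≫ b i = 𝟙 X) : Nonempty (X ≅ ⨁ Y) := by
  classical
  refine ⟨biproduct.lift a, biproduct.desc b, ?_, ?_⟩
  · rw [biproduct.lift_desc, h3]
  · ext i j
    by_cases h : i = j
    · subst h; simp [h1]
    · simp [h2 _ _ (Ne.symm h), biproduct.ι_π_ne _ (Ne.symm h)]

/-- The radical of the endomorphism ring of an object is nilpotent, because that ring is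
Artinian. -/
lemma exists_pow_homRadical_eq_zero (k : Type*) [Field k] {C : Type*} [Category C] [Preadditive C]
    [Linear k C] [∀ X Y : C, Module.Finite k (X ⟶ Y)] (X : C) : ∃ (N : ℕ) (J : Ideal (End X)),
    J.IsTwoSided ∧ (∀ f : X ⟶ X, f ∈ homRadical k X X → (show End X from f) ∈ J) ∧
      J ^ N = ⊥ := by
  have : Module.Finite k (End X) := inferInstanceAs (Module.Finite k (X ⟶ X))
  have : IsArtinianRing (End X) := .of_finite k _
  obtain ⟨N, hN⟩ := IsArtinianRing.isNilpotent_jacobson_bot (R := End X)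
  refine ⟨N, _, inferInstance, fun f hf => ?_, hN⟩
  rw [Ideal.mem_jacobson_iff]
  intro y
  have hy : IsIso (𝟙 X + f ≫ (show X ⟶ X from y)) := by
    simpa using hf (-(show X ⟶ X from y))
  refine ⟨inv (𝟙 X + f ≫ (show X ⟶ X from y)), ?_⟩
  rw [Ideal.mem_bot]
  have h := IsIso.hom_inv_id (𝟙 X + f ≫ (show X ⟶ X from y))
  change f ≫ (show X ⟶ X from y) ≫ inv (𝟙 X + f ≫ (show X ⟶ X from y)) +
    inv (𝟙 X + f ≫ (show X ⟶ X from y)) - 𝟙 X = 0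
  rw [Preadditive.add_comp, Category.id_comp, Category.assoc, add_comm] at h
  exact sub_eq_zero.2 h

end KrullSchmidt

/-! ### Representatives of the indecomposable objects and powers of the radical -/

section

variable (k : Type*) [Field k] (T : Type*) [Category T] [Preadditive T] [HasZeroObject T]
  [HasShift T ℤ] [∀ n : ℤ, (shiftFunctor T n).Additive] [Pretriangulated T] [Linear k T]

/-- A choice of representatives `M x` of the isomorphism classes of indecomposable objects, indexed
by the vertices of a translation quiver `Q`, such that `Q` is the Auslander-Reiten quiver with all
valuations equal to `1`. This is the data of `ARQuiverIso T k Q` in terms of objects. -/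
structure ARSystem (Q : StableTranslationQuiver) where
  /-- the representative of a vertex -/
  M : Q.V → T
  indec : ∀ x, Indecomposable (M x)
  eq_of_iso : ∀ {x y}, (M x ≅ M y) → x = y
  exists_iso : ∀ X, Indecomposable X → ∃ x, Nonempty (X ≅ M x)
  irrDim_arrow : ∀ x y, Q.Arrow x y → irrDim k (M x) (M y) = 1
  irrDim_not_arrow : ∀ x y, ¬ Q.Arrow x y → irrDim k (M x) (M y) = 0
  translation : ∀ t : Triangle T, IsARTriangle t → ∀ z, (t.obj₃ ≅ M z) →
    Nonempty (t.obj₁ ≅ M (Q.τ z))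

end

namespace ARSystem

variable {k : Type*} [Field k] {T : Type*} [Category T] [Preadditive T] [HasZeroObject T]
  [HasShift T ℤ] [∀ n : ℤ, (shiftFunctor T n).Additive] [Pretriangulated T] [Linear k T]
  {Q : StableTranslationQuiver} (A : ARSystem k T Q)

section Decomposition

variable [IsIdempotentComplete T] [∀ X Y : T, Module.Finite k (X ⟶ Y)]

lemma exists_decomp (X : T) : ∃ (ι : Type) (_ : Fintype ι) (v : ι → Q.V) (a : ∀ i, X ⟶ A.M (v i))
    (b : ∀ i, A.M (v i) ⟶ X), (∀ i, b i ≫ a i = 𝟙 _) ∧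
      (∀ i j, i ≠ j → b i ≫ a j = 0) ∧ ∑ i, a i ≫ b i = 𝟙 X := by
  obtain ⟨ι, _, Y, a, b, hY, h1, h2, h3⟩ := exists_decomposition k X
  choose v e using fun i => A.exists_iso (Y i) (hY i)
  let e' := fun i => (e i).some
  refine ⟨ι, inferInstance, v, fun i => a i ≫ (e' i).hom, fun i => (e' i).inv ≫ b i, ?_, ?_, ?_⟩
  · intro i; simp [reassoc_of% (h1 i)]
  · intro i j h; simp [reassoc_of% (h2 i j h)]
  · simpa using h3

lemma exists_comp_ne_zero {X Y : T} {f : X ⟶ Y} (hf : f ≠ 0) :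
    ∃ (v : Q.V) (a : Y ⟶ A.M v), f ≫ a ≠ 0 := by
  obtain ⟨ι, _, v, a, b, -, -, h⟩ := A.exists_decomp Y
  by_contra! H
  apply hf
  rw [← Category.comp_id f, ← h, Preadditive.comp_sum]
  exact Finset.sum_eq_zero fun i _ => by rw [← Category.assoc, H, zero_comp]

lemma mem_rad_of_ne {x y : Q.V} (h : x ≠ y) (f : A.M x ⟶ A.M y) :
    f ∈ homRadical k (A.M x) (A.M y) :=
  ((A.indec x).isIso_or_mem_homRadical k (A.indec y) f).resolve_left fun _ =>
    h (A.eq_of_iso (asIso f))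

end Decomposition

lemma id_notMem_rad (x : Q.V) : 𝟙 (A.M x) ∉ homRadical k (A.M x) (A.M x) := fun h =>
  (A.indec x).1 (isZero_of_isIso_mem k h)

/-- The powers of the radical, computed with the chosen indecomposable objects. -/
noncomputable def radPow (x : Q.V) : ℕ → ∀ y : Q.V, Submodule k (A.M x ⟶ A.M y)
  | 0, _ => ⊤
  | n + 1, y => ⨆ z, Submodule.map₂ (Linear.comp (S := k) (A.M x) (A.M z) (A.M y)) (radPow x n z)
      (homRadical k (A.M z) (A.M y))

lemma comp_mem_radPow_succ {x y z : Q.V} {n : ℕ} {f : A.M x ⟶ A.M z} (hf : f ∈ A.radPow x n z)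
    {g : A.M z ⟶ A.M y} (hg : g ∈ homRadical k (A.M z) (A.M y)) :
    f ≫ g ∈ A.radPow x (n + 1) y :=
  (le_iSup (fun z => Submodule.map₂ (Linear.comp (S := k) (A.M x) (A.M z) (A.M y)) (A.radPow x n z)
      (homRadical k (A.M z) (A.M y))) z) (Submodule.apply_mem_map₂ _ hf hg)

/-- The induction principle for membership in a power of the radical. -/
lemma radPow_succ_le {x y : Q.V} {n : ℕ} {P : Submodule k (A.M x ⟶ A.M y)}
    (h : ∀ (z : Q.V) (f : A.M x ⟶ A.M z) (g : A.M z ⟶ A.M y), f ∈ A.radPow x n z →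
      g ∈ homRadical k (A.M z) (A.M y) → f ≫ g ∈ P) : A.radPow x (n + 1) y ≤ P :=
  iSup_le fun z => Submodule.map₂_le.2 fun f hf g hg => h z f g hf hg

lemma radPow_succ_le_rad (x y : Q.V) (n : ℕ) :
    A.radPow x (n + 1) y ≤ homRadical k (A.M x) (A.M y) :=
  A.radPow_succ_le fun _ f _ _ hg => comp_mem_homRadical_left f hg

lemma rad_le_radPow_one (x y : Q.V) :
    homRadical k (A.M x) (A.M y) ≤ A.radPow x 1 y := fun f hf => by
  have := A.comp_mem_radPow_succ (n := 0) (f := 𝟙 (A.M x)) trivial hf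
  rwa [Category.id_comp] at this

lemma comp_mem_radPow {x y z : Q.V} {m n : ℕ} {f : A.M x ⟶ A.M z} (hf : f ∈ A.radPow x m z)
    {g : A.M z ⟶ A.M y} (hg : g ∈ A.radPow z n y) : f ≫ g ∈ A.radPow x (m + n) y := by
  induction n generalizing y with
  | zero =>
    cases m with
    | zero => trivial
    | succ m =>
      have : A.radPow x (m + 1) z ≤ (A.radPow x (m + 1) y).comap (Linear.rightComp k _ g) := by
        refine A.radPow_succ_le fun w f' g' hf' hg' => ?_
        rw [Submodule.mem_comap, Linear.rightComp_apply, Category.assoc]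
        exact A.comp_mem_radPow_succ hf' (comp_mem_homRadical_right hg' g)
      exact this hf
  | succ n ih =>
    have : A.radPow z (n + 1) y ≤ (A.radPow x (m + n + 1) y).comap (Linear.leftComp k _ f) := by
      refine A.radPow_succ_le fun w f' g' hf' hg' => ?_
      rw [Submodule.mem_comap, Linear.leftComp_apply, ← Category.assoc]
      exact A.comp_mem_radPow_succ (ih hf') hg'
    exact this hg

/-- The powers of the radical can also be built up from the left. -/
lemma radPow_succ_le' {x y : Q.V} {n : ℕ} {P : Submodule k (A.M x ⟶ A.M y)}
    (h : ∀ (z : Q.V) (f : A.M x ⟶ A.M z) (g : A.M z ⟶ A.M y), f ∈ homRadical k (A.M x) (A.M z) →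
      g ∈ A.radPow z n y → f ≫ g ∈ P) : A.radPow x (n + 1) y ≤ P := by
  induction n generalizing y with
  | zero =>
    intro f hf
    have := h y f (𝟙 _) (A.radPow_succ_le_rad x y 0 hf) trivial
    rwa [Category.comp_id] at this
  | succ n ih =>
    refine A.radPow_succ_le fun z f g hf hg => ?_
    have : A.radPow x (n + 1) z ≤ P.comap (Linear.rightComp k _ g) := by
      refine ih fun w f' g' hf' hg' => ?_
      rw [Submodule.mem_comap, Linear.rightComp_apply, Category.assoc]
      exact h w f' (g' ≫ g) hf' (A.comp_mem_radPow_succ hg' hg)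
    exact this hf

section

variable [∀ X Y : T, Module.Finite k (X ⟶ Y)]

/-- In the square of the radical, all middle objects can be replaced by indecomposable ones. -/
lemma radSq_le_radPow_two [IsIdempotentComplete T] (x y : Q.V) :
    homRadicalSq k (A.M x) (A.M y) ≤ A.radPow x 2 y := by
  refine Submodule.span_le.2 ?_
  rintro _ ⟨Z, h, g, hh, hg, rfl⟩
  obtain ⟨ι, _, v, a, b, -, -, hab⟩ := A.exists_decomp Z
  rw [← Category.id_comp g, ← hab, Preadditive.sum_comp, Preadditive.comp_sum]
  refine Submodule.sum_mem _ fun i _ => ?_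
  have : h ≫ (a i ≫ b i) ≫ g = (h ≫ a i) ≫ (b i ≫ g) := by simp only [Category.assoc]
  rw [this]
  exact A.comp_mem_radPow_succ (A.rad_le_radPow_one _ _ (comp_mem_homRadical_right hh _))
    (comp_mem_homRadical_left _ hg)

/-- The radical is nilpotent, because there are only finitely many indecomposable objects: a
product of `N` radical maps between them gives a product of `N` elements of the radical of
`End (⨁ M x)`. -/
lemma exists_radPow_eq_bot [Finite Q.V] : ∃ N, ∀ x y, A.radPow x N y = ⊥ := by
  classical
  have := Fintype.ofFinite Q.V
  obtain ⟨N, J, _, hJ, hN⟩ := exists_pow_homRadical_eq_zero k (⨁ A.M)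
  have key : ∀ n x y, ∀ f ∈ A.radPow x n y,
      (show End (⨁ A.M) from biproduct.π A.M x ≫ f ≫ biproduct.ι A.M y) ∈ J ^ n := by
    intro n
    induction n with
    | zero => intro x y f _; rw [Submodule.pow_zero, Ideal.one_eq_top]; trivial
    | succ n ih =>
      intro x y
      let φ : (A.M x ⟶ A.M y) →ₗ[k] (⨁ A.M ⟶ ⨁ A.M) :=
        (Linear.leftComp k _ (biproduct.π A.M x)).comp (Linear.rightComp k _ (biproduct.ι A.M y))
      intro f hf
      have h1 : A.radPow x (n + 1) y ≤
          (show Submodule k (⨁ A.M ⟶ ⨁ A.M) from (J ^ (n + 1)).restrictScalars k).comap φ := by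
        refine A.radPow_succ_le fun z g h hg hh => ?_
        change (show End (⨁ A.M) from biproduct.π A.M x ≫ (g ≫ h) ≫ biproduct.ι A.M y) ∈ J ^ (n + 1)
        have e : (show End (⨁ A.M) from biproduct.π A.M x ≫ (g ≫ h) ≫ biproduct.ι A.M y) =
            (show End (⨁ A.M) from biproduct.π A.M z ≫ h ≫ biproduct.ι A.M y) *
            (show End (⨁ A.M) from biproduct.π A.M x ≫ g ≫ biproduct.ι A.M z) := by
          rw [End.mul_def]
          change biproduct.π A.M x ≫ (g ≫ h) ≫ biproduct.ι A.M y =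
            (biproduct.π A.M x ≫ g ≫ biproduct.ι A.M z) ≫
              biproduct.π A.M z ≫ h ≫ biproduct.ι A.M y
          simp
        rw [e, Ideal.IsTwoSided.pow_succ]
        exact Ideal.mul_mem_mul (hJ _ (comp_mem_homRadical_left _ (comp_mem_homRadical_right hh _)))
          (ih x z g hg)
      exact h1 hf
  refine ⟨N, fun x y => (Submodule.eq_bot_iff _).2 fun f hf => ?_⟩
  have := key N x y f hf
  rw [hN, Ideal.mem_bot] at this
  have h2 := congrArg (fun t : ⨁ A.M ⟶ ⨁ A.M => biproduct.ι A.M x ≫ t ≫ biproduct.π A.M y) this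
  change biproduct.ι A.M x ≫ (biproduct.π A.M x ≫ f ≫ biproduct.ι A.M y) ≫ biproduct.π A.M y
    = biproduct.ι A.M x ≫ 0 ≫ biproduct.π A.M y at h2
  simpa using h2

end

/-! ### Irreducible morphisms -/

/-- `f` lies in the radical but not in its square. -/
def IsIrr (k : Type*) [Field k] [Linear k T] {X Y : T} (f : X ⟶ Y) : Prop :=
  f ∈ homRadical k X Y ∧ f ∉ homRadicalSq k X Y

/-- Irreducible maps along an arrow are unique up to scalars modulo the square of the radical, since
the valuations are equal to `1`. -/
lemma IsIrr.exists_smul_sub_mem {x y : Q.V} (h : Q.Arrow x y) {f : A.M x ⟶ A.M y}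
    (hf : IsIrr k f) {g : A.M x ⟶ A.M y} (hg : g ∈ homRadical k (A.M x) (A.M y)) :
    ∃ c : k, g - c • f ∈ homRadicalSq k (A.M x) (A.M y) := by
  have h1 := A.irrDim_arrow x y h
  let S := (homRadicalSq k (A.M x) (A.M y)).submoduleOf (homRadical k (A.M x) (A.M y))
  have h2 : (S.mkQ ⟨f, hf.1⟩) ≠ 0 := by
    rw [Submodule.mkQ_apply, Ne, Submodule.Quotient.mk_eq_zero]
    exact hf.2
  obtain ⟨c, hc⟩ := (finrank_eq_one_iff_of_nonzero' _ h2).1 h1 (S.mkQ ⟨g, hg⟩)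
  refine ⟨c, ?_⟩
  rw [← map_smul, Submodule.mkQ_apply, Submodule.mkQ_apply, eq_comm, Submodule.Quotient.eq] at hc
  exact hc

section

variable [∀ X Y : T, Module.Finite k (X ⟶ Y)]

lemma rad_le_radSq {x y : Q.V} (h : ¬ Q.Arrow x y) :
    homRadical k (A.M x) (A.M y) ≤ homRadicalSq k (A.M x) (A.M y) := by
  have h1 := A.irrDim_not_arrow x y h
  rw [irrDim, Module.finrank_zero_iff] at h1
  rw [Submodule.Quotient.subsingleton_iff, Submodule.submoduleOf,
    Submodule.comap_subtype_eq_top] at h1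
  exact h1

lemma exists_isIrr {x y : Q.V} (h : Q.Arrow x y) : ∃ f : A.M x ⟶ A.M y, IsIrr k f := by
  have h1 := A.irrDim_arrow x y h
  by_contra! H
  have h2 : homRadical k (A.M x) (A.M y) ≤ homRadicalSq k (A.M x) (A.M y) := fun f hf => by
    by_contra h3
    exact H f ⟨hf, h3⟩
  have : irrDim k (A.M x) (A.M y) = 0 := by
    rw [irrDim, Module.finrank_zero_iff, Submodule.Quotient.subsingleton_iff, Submodule.submoduleOf,
      Submodule.comap_subtype_eq_top]
    exact h2
  omega

end

end ARSystem

/-! ### Auslander-Reiten triangles -/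

namespace ARSystem

variable {k : Type*} [Field k] {T : Type*} [Category T] [Preadditive T] [HasZeroObject T]
  [HasShift T ℤ] [∀ n : ℤ, (shiftFunctor T n).Additive] [Pretriangulated T] [Linear k T]
  {Q : StableTranslationQuiver} (A : ARSystem k T Q)

/-- The middle term of the Auslander-Reiten triangle ending at `M z`. -/
noncomputable def mid [Finite Q.V] (z : Q.V) : T :=
  ⨁ fun y : {y // Q.Arrow y z} => A.M y

section Mid

variable [Finite Q.V] {A}

/-- The inclusion of a direct summand of the middle term. -/
noncomputable def inc {y z : Q.V} (h : Q.Arrow y z) : A.M y ⟶ A.mid z :=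
  biproduct.ι (fun y : {y // Q.Arrow y z} => A.M y) ⟨y, h⟩

/-- The projection to a direct summand of the middle term. -/
noncomputable def prj {y z : Q.V} (h : Q.Arrow y z) : A.mid z ⟶ A.M y :=
  biproduct.π (fun y : {y // Q.Arrow y z} => A.M y) ⟨y, h⟩

lemma inc_prj {y z : Q.V} (h : Q.Arrow y z) : inc (A := A) h ≫ prj h = 𝟙 _ := by
  classical
  exact biproduct.ι_π_self _ _

lemma inc_prj_ne {y y' z : Q.V} (h : Q.Arrow y z) (h' : Q.Arrow y' z) (hne : y ≠ y') :
    inc (A := A) h ≫ prj h' = 0 := by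
  classical
  exact biproduct.ι_π_ne _ (fun e => hne (congrArg Subtype.val e))

lemma mid_total [Fintype Q.V] [DecidableRel Q.Arrow] (z : Q.V) :
    ∑ y : {y // Q.Arrow y z}, prj (A := A) y.2 ≫ inc y.2 = 𝟙 (A.mid z) := by
  classical
  exact biproduct.total

lemma mid_hom_ext {W : T} {z : Q.V} {f g : W ⟶ A.mid z}
    (h : ∀ y (hy : Q.Arrow y z), f ≫ prj hy = g ≫ prj hy) : f = g :=
  biproduct.hom_ext _ _ fun y => h y.1 y.2

lemma mid_hom_ext' {W : T} {z : Q.V} {f g : A.mid z ⟶ W}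
    (h : ∀ y (hy : Q.Arrow y z), inc hy ≫ f = inc hy ≫ g) : f = g :=
  biproduct.hom_ext' _ _ fun y => h y.1 y.2

lemma mem_rad_of_inc {W : T} {z : Q.V} {f : A.mid z ⟶ W}
    (h : ∀ y (hy : Q.Arrow y z), inc hy ≫ f ∈ homRadical k _ _) : f ∈ homRadical k _ _ := by
  classical
  have := Fintype.ofFinite Q.V
  rw [← Category.id_comp f, ← mid_total, Preadditive.sum_comp]
  refine Submodule.sum_mem _ fun y _ => ?_
  rw [Category.assoc]
  exact comp_mem_homRadical_left _ (h y y.2)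

lemma mem_rad_of_prj {W : T} {z : Q.V} {f : W ⟶ A.mid z}
    (h : ∀ y (hy : Q.Arrow y z), f ≫ prj hy ∈ homRadical k _ _) : f ∈ homRadical k _ _ := by
  classical
  have := Fintype.ofFinite Q.V
  rw [← Category.comp_id f, ← mid_total, Preadditive.comp_sum]
  refine Submodule.sum_mem _ fun y _ => ?_
  rw [← Category.assoc]
  exact comp_mem_homRadical_right (h y y.2) _

/-- All components of `F` out of the middle term are irreducible. -/
def IsSink {z : Q.V} (F : A.mid z ⟶ A.M z) : Prop :=
  ∀ y (h : Q.Arrow y z), IsIrr k (inc h ≫ F)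

/-- All components of `I` into the middle term are irreducible. -/
def IsSource {x z : Q.V} (I : A.M x ⟶ A.mid z) : Prop :=
  ∀ y (h : Q.Arrow y z), IsIrr k (I ≫ prj h)

lemma IsSink.mem_rad {z : Q.V} {F : A.mid z ⟶ A.M z} (hF : IsSink F) : F ∈ homRadical k _ _ :=
  mem_rad_of_inc fun y hy => (hF y hy).1

variable [IsIdempotentComplete T] [∀ X Y : T, Module.Finite k (X ⟶ Y)]

/-- A family of irreducible maps ending at `M z` generates the radical maps to `M z`: it does so
modulo all powers of the radical, and the radical is nilpotent. -/
lemma IsSink.exists_factor {z : Q.V} {F : A.mid z ⟶ A.M z} (hF : IsSink F) {U : T}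
    {g : U ⟶ A.M z} (hg : g ∈ homRadical k _ _) : ∃ t : U ⟶ A.mid z, t ≫ F = g := by
  have key : ∀ n x, homRadical k (A.M x) (A.M z) ≤
      LinearMap.range (Linear.rightComp k (A.M x) F) ⊔ A.radPow x (n + 1) z := by
    intro n x
    induction n with
    | zero => exact (A.rad_le_radPow_one x z).trans le_sup_right
    | succ n ih =>
      refine ih.trans (sup_le le_sup_left (A.radPow_succ_le fun y h g hh hg => ?_))
      by_cases hyz : Q.Arrow y z
      · obtain ⟨c, hc⟩ := IsIrr.exists_smul_sub_mem A hyz (hF y hyz) hg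
        have h1 : h ≫ g = (c • h ≫ inc hyz) ≫ F + h ≫ (g - c • (inc hyz ≫ F)) := by simp
        rw [h1]
        refine add_mem (Submodule.mem_sup_left ⟨_, rfl⟩) (Submodule.mem_sup_right ?_)
        exact A.comp_mem_radPow (n := 2) hh (A.radSq_le_radPow_two _ _ hc)
      · exact Submodule.mem_sup_right
          (A.comp_mem_radPow (n := 2) hh (A.radSq_le_radPow_two _ _ (A.rad_le_radSq hyz hg)))
  obtain ⟨N, hN⟩ := A.exists_radPow_eq_bot
  have key' : ∀ x, ∀ g ∈ homRadical k (A.M x) (A.M z), ∃ t, t ≫ F = g := by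
    intro x g hg
    have h1 := key N x hg
    have h2 : A.radPow x (N + 1) z = ⊥ := by
      rw [eq_bot_iff]
      refine A.radPow_succ_le fun y h g hh _ => ?_
      rw [hN, Submodule.mem_bot] at hh
      simp [hh]
    rw [h2, sup_bot_eq] at h1
    exact h1
  obtain ⟨ι, _, v, a, b, -, -, hab⟩ := A.exists_decomp U
  choose t ht using fun i => key' (v i) (b i ≫ g) (comp_mem_homRadical_left _ hg)
  refine ⟨∑ i, a i ≫ t i, ?_⟩
  rw [Preadditive.sum_comp]
  conv_rhs => rw [← Category.id_comp g, ← hab, Preadditive.sum_comp]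
  exact Finset.sum_congr rfl fun i _ => by rw [Category.assoc, ht, Category.assoc]

/-- A family of irreducible maps starting at `M (τ z)` generates the radical maps from it. -/
lemma IsSource.exists_factor {z : Q.V} {I : A.M (Q.τ z) ⟶ A.mid z} (hI : IsSource I) {U : T}
    {g : A.M (Q.τ z) ⟶ U} (hg : g ∈ homRadical k _ _) : ∃ t : A.mid z ⟶ U, I ≫ t = g := by
  have key : ∀ n y, homRadical k (A.M (Q.τ z)) (A.M y) ≤
      LinearMap.range (Linear.leftComp k (A.M y) I) ⊔ A.radPow (Q.τ z) (n + 1) y := by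
    intro n y
    induction n with
    | zero => exact (A.rad_le_radPow_one _ _).trans le_sup_right
    | succ n ih =>
      refine ih.trans (sup_le le_sup_left (A.radPow_succ_le' fun x g h hg hh => ?_))
      by_cases hxz : Q.Arrow x z
      · obtain ⟨c, hc⟩ := IsIrr.exists_smul_sub_mem A ((Q.arrow_τ z x).2 hxz) (hI x hxz) hg
        have h1 : g ≫ h = I ≫ (c • prj hxz ≫ h) + (g - c • (I ≫ prj hxz)) ≫ h := by simp
        rw [h1]
        refine add_mem (Submodule.mem_sup_left ⟨_, rfl⟩) (Submodule.mem_sup_right ?_)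
        have := A.comp_mem_radPow (m := 2) (A.radSq_le_radPow_two _ _ hc) hh
        rwa [add_comm] at this
      · have := A.comp_mem_radPow (m := 2) (A.radSq_le_radPow_two _ _
          (A.rad_le_radSq (fun h => hxz ((Q.arrow_τ z x).1 h)) hg)) hh
        rw [add_comm] at this
        exact Submodule.mem_sup_right this
  obtain ⟨N, hN⟩ := A.exists_radPow_eq_bot
  have key' : ∀ y, ∀ g ∈ homRadical k (A.M (Q.τ z)) (A.M y), ∃ t, I ≫ t = g := by
    intro y g hg
    have h1 := key N y hg
    have h2 : A.radPow (Q.τ z) (N + 1) y = ⊥ := by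
      rw [eq_bot_iff]
      refine A.radPow_succ_le fun y h g hh _ => ?_
      rw [hN, Submodule.mem_bot] at hh
      simp [hh]
    rw [h2, sup_bot_eq] at h1
    exact h1
  obtain ⟨ι, _, v, a, b, -, -, hab⟩ := A.exists_decomp U
  choose t ht using fun i => key' (v i) (g ≫ a i) (comp_mem_homRadical_right hg _)
  refine ⟨∑ i, t i ≫ b i, ?_⟩
  rw [Preadditive.comp_sum]
  conv_rhs => rw [← Category.comp_id g, ← hab, Preadditive.comp_sum]
  exact Finset.sum_congr rfl fun i _ => by rw [← Category.assoc, ht, Category.assoc]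

/-- A sink map is right minimal. -/
lemma IsSink.mem_rad_of_comp_eq_zero {z : Q.V} {F : A.mid z ⟶ A.M z} (hF : IsSink F)
    {j : A.mid z ⟶ A.mid z} (hj : j ≫ F = 0) : j ∈ homRadical k _ _ := by
  classical
  have := Fintype.ofFinite Q.V
  refine mem_rad_of_inc fun y hy => mem_rad_of_prj fun y' hy' => ?_
  by_cases hne : y = y'
  · subst hne
    refine ((A.indec y).isIso_or_mem_homRadical k (A.indec y) _).resolve_left fun hiso => ?_
    apply (hF y hy).2
    -- the component of `j ≫ F = 0` at `y` expresses `inc hy ≫ F` through radical squares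
    have h1 : inc hy ≫ j ≫ (∑ w : {y // Q.Arrow y z}, prj (A := A) w.2 ≫ inc w.2) ≫ F = 0 := by
      rw [mid_total, Category.id_comp, hj, comp_zero]
    rw [Preadditive.sum_comp, Preadditive.comp_sum, Preadditive.comp_sum,
      ← Finset.add_sum_erase _ _ (Finset.mem_univ (⟨y, hy⟩ : {y // Q.Arrow y z}))] at h1
    have h2 : ((inc hy ≫ j) ≫ prj hy) ≫ (inc hy ≫ F) ∈ homRadicalSq k (A.M y) (A.M z) := by
      have h3 : ((inc hy ≫ j) ≫ prj hy) ≫ (inc hy ≫ F) =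
          - ∑ w ∈ Finset.univ.erase (⟨y, hy⟩ : {y // Q.Arrow y z}),
            inc hy ≫ j ≫ (prj w.2 ≫ inc w.2) ≫ F := by
        rw [← add_eq_zero_iff_eq_neg, ← h1]
        simp only [Category.assoc]
      rw [h3]
      refine neg_mem (Submodule.sum_mem _ fun w hw => ?_)
      have : inc hy ≫ j ≫ (prj w.2 ≫ inc w.2) ≫ F =
          (inc hy ≫ j ≫ prj w.2) ≫ (inc w.2 ≫ F) := by simp only [Category.assoc]
      rw [this]
      refine comp_mem_homRadicalSq (A.mem_rad_of_ne (fun h => ?_) _) (hF _ _).1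
      exact (Finset.mem_erase.1 hw).1 (Subtype.ext h.symm)
    have h4 := homRadicalSq_comp_left (inv ((inc hy ≫ j) ≫ prj hy)) h2
    rwa [IsIso.inv_hom_id_assoc] at h4
  · exact A.mem_rad_of_ne hne _

end Mid

/-- The properties of the two maps of an Auslander-Reiten triangle `M x ⟶ mid z ⟶ M z` that are used
below: the composite vanishes and both `Hom(W, -)` and `Hom(-, W)` are exact at the middle term. -/
structure IsARPair [Finite Q.V] {x z : Q.V} (I : A.M x ⟶ A.mid z) (F : A.mid z ⟶ A.M z) :
    Prop where
  source : IsSource I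
  sink : IsSink F
  comp_eq_zero : I ≫ F = 0
  lift : ∀ {W : T} (p : W ⟶ A.mid z), p ≫ F = 0 → ∃ h, h ≫ I = p
  desc : ∀ {W : T} (q : A.mid z ⟶ W), I ≫ q = 0 → ∃ h, F ≫ h = q

section Existence

variable [Finite Q.V] [IsIdempotentComplete T] [∀ X Y : T, Module.Finite k (X ⟶ Y)]

/-- There is a nonzero map `w` starting at `M z` that is killed by the radical on both sides.
The radical is nilpotent, so that a map killed on the left can be composed with radical maps until
it is killed on the right, too. -/
lemma exists_socle_map {z : Q.V} {X : T} {δ : A.M z ⟶ X} (hδ : δ ≠ 0)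
    (hl : ∀ {U : T} (g : U ⟶ A.M z), g ∈ homRadical k _ _ → g ≫ δ = 0) :
    ∃ (v : Q.V) (w : A.M z ⟶ A.M v), w ≠ 0 ∧
      (∀ {U : T} (g : U ⟶ A.M z), g ∈ homRadical k _ _ → g ≫ w = 0) ∧
      (∀ {U : T} (g : A.M v ⟶ U), g ∈ homRadical k _ _ → w ≫ g = 0) := by
  by_contra! H
  have key : ∀ n, ∃ (v : Q.V) (w : A.M z ⟶ A.M v), w ≠ 0 ∧ w ∈ A.radPow z n v ∧
      (∀ (U : T) (g : U ⟶ A.M z), g ∈ homRadical k _ _ → g ≫ w = 0) := by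
    intro n
    induction n with
    | zero =>
      obtain ⟨v, a, ha⟩ := A.exists_comp_ne_zero hδ
      exact ⟨v, δ ≫ a, ha, trivial, fun U g hg => by rw [← Category.assoc, hl g hg, zero_comp]⟩
    | succ n ih =>
      obtain ⟨v, w, hw0, hw, hl'⟩ := ih
      obtain ⟨U, g, hg, hne⟩ := H v w hw0 (fun {U} g hg => hl' U g hg)
      obtain ⟨u, a, ha⟩ := A.exists_comp_ne_zero hne
      refine ⟨u, w ≫ g ≫ a, by rwa [Category.assoc] at ha,
        A.comp_mem_radPow_succ hw (comp_mem_homRadical_right hg a), fun U g' hg' => ?_⟩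
      rw [← Category.assoc, hl' U g' hg', zero_comp]
  obtain ⟨N, hN⟩ := A.exists_radPow_eq_bot
  obtain ⟨v, w, hw0, hw, -⟩ := key N
  rw [hN] at hw
  exact hw0 hw

/-- A sink map extends to an Auslander-Reiten triangle. In the distinguished triangle
`K ⟶ mid z ⟶ M z ⟶ K⟦1⟧` on it, the last map `δ` and a map `w : M z ⟶ M v` killed by the radical on
both sides factor through each other. Hence `M v` is a direct summand of `K⟦1⟧`, and it is all of
`K⟦1⟧` since the sink map is right minimal. -/
lemma exists_isARTriangle {z : Q.V} {F : A.mid z ⟶ A.M z} (hF : IsSink F) :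
    ∃ (K : T) (i : K ⟶ A.mid z) (δ : A.M z ⟶ K⟦(1 : ℤ)⟧), IsARTriangle (Triangle.mk i F δ) := by
  obtain ⟨K, i, δ, hT⟩ := distinguished_cocone_triangle₁ F
  refine ⟨K, i, δ, ?_⟩
  have hz := (A.indec z)
  have hFδ : F ≫ δ = 0 := comp_distTriang_mor_zero₂₃ _ hT
  have hδ : δ ≠ 0 := by
    intro h
    obtain ⟨s, hs⟩ := Triangle.coyoneda_exact₃ _ hT (𝟙 (A.M z)) (by
      change 𝟙 _ ≫ δ = 0; rw [h, comp_zero])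
    exact not_isSplitEpi_of_mem k hz.1 hF.mem_rad (IsSplitEpi.mk' ⟨s, hs.symm⟩)
  have hl : ∀ {U : T} (g : U ⟶ A.M z), g ∈ homRadical k _ _ → g ≫ δ = 0 := by
    intro U g hg
    obtain ⟨t, rfl⟩ := hF.exists_factor hg
    rw [Category.assoc, hFδ, comp_zero]
  obtain ⟨v, w, hw0, hwl, hwr⟩ := A.exists_socle_map hδ hl
  obtain ⟨u, hu⟩ : ∃ u, w = δ ≫ u := Triangle.yoneda_exact₃ _ hT w (hwl _ hF.mem_rad)
  obtain ⟨C, c, h', hT'⟩ := distinguished_cocone_triangle₁ w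
  obtain ⟨r, hr⟩ : ∃ r, δ = w ≫ r := by
    refine Triangle.yoneda_exact₂ _ hT' δ
      (hl c (hz.mem_homRadical_of_not_isSplitEpi k fun hc => ?_))
    have hcw : c ≫ w = 0 := comp_distTriang_mor_zero₁₂ _ hT'
    exact hw0 (by rw [← cancel_epi c, hcw, comp_zero])
  have hw : w ≫ r ≫ u = w := by rw [← Category.assoc, ← hr, ← hu]
  have hiso : IsIso (r ≫ u) := ((A.indec v).isIso_or_mem_homRadical k (A.indec v) _).resolve_right
    fun h => hw0 (by rw [← hw, hwr _ h])
  -- the complement of the direct summand `M v` of `K⟦1⟧` vanishes, because the sink map is minimal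
  have huir : u ≫ inv (r ≫ u) ≫ r = 𝟙 _ := by
    set q := 𝟙 (K⟦(1 : ℤ)⟧) - u ≫ inv (r ≫ u) ≫ r with hq
    have hqq : q ≫ q = q := by
      have : r ≫ u ≫ inv (r ≫ u) ≫ r = r := by
        rw [← Category.assoc, ← Category.assoc, IsIso.hom_inv_id, Category.id_comp]
      simp [hq, this]
    have hδq : δ ≫ q = 0 := by
      have h1 : w ≫ inv (r ≫ u) = w := by
        conv_lhs => rw [← hw]
        simp
      have h2 : δ ≫ u ≫ inv (r ≫ u) ≫ r = δ := by
        rw [← Category.assoc, ← hu, ← Category.assoc, h1, ← hr]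
      rw [hq, Preadditive.comp_sub, Category.comp_id, h2, sub_self]
    obtain ⟨t, ht⟩ : ∃ t, q = (-i⟦(1 : ℤ)⟧') ≫ t :=
      Triangle.yoneda_exact₃ _ (rot_of_distTriang _ hT) q hδq
    obtain ⟨j, hj⟩ := (shiftFunctor T (1 : ℤ)).map_surjective (t ≫ (-i⟦(1 : ℤ)⟧'))
    have hjF : j ≫ F = 0 := by
      apply (shiftFunctor T (1 : ℤ)).map_injective
      have hiF : i ≫ F = 0 := comp_distTriang_mor_zero₁₂ _ hT
      rw [Functor.map_comp, hj, Category.assoc, Preadditive.neg_comp, ← Functor.map_comp, hiF]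
      simp
    have h1 : IsIso (𝟙 _ - j) := isIso_one_sub_of_mem (hF.mem_rad_of_comp_eq_zero hjF)
    have h2 : IsIso (𝟙 _ - t ≫ (-i⟦(1 : ℤ)⟧')) := by
      rw [← hj, ← (shiftFunctor T (1 : ℤ)).map_id, ← Functor.map_sub]
      infer_instance
    have h3 := isIso_one_sub_comp_swap h2
    rw [← ht] at h3
    have h4 : q = 0 := by
      rw [← cancel_epi (𝟙 _ - q)]
      simp [hqq]
    rw [hq, sub_eq_zero] at h4
    exact h4.symm
  have hu_iso : IsIso u := ⟨inv (r ≫ u) ≫ r, huir, by rw [Category.assoc, IsIso.inv_hom_id]⟩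
  have hr_iso : IsIso r := by
    have : r = (r ≫ u) ≫ inv u := by simp
    rw [this]; infer_instance
  have hK1 : Indecomposable (K⟦(1 : ℤ)⟧) := (A.indec v).of_iso (asIso r)
  have hK : Indecomposable K := by
    refine indecomposable_of_idem_eq (fun h => hK1.1 ?_) fun e he => ?_
    · exact Functor.map_isZero (shiftFunctor T (1 : ℤ)) h
    · rcases hK1.idem_eq (e⟦(1 : ℤ)⟧') (by rw [← Functor.map_comp, he]) with h | h
      · left
        apply (shiftFunctor T (1 : ℤ)).map_injective
        rw [h, Functor.map_zero]
      · right
        apply (shiftFunctor T (1 : ℤ)).map_injective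
        rw [h, CategoryTheory.Functor.map_id]
  have hdesc : ∀ (V : T) (g : K ⟶ V), ¬ IsSplitMono g → ∃ g' : A.mid z ⟶ V, i ≫ g' = g := by
    intro V g hg
    have h1 : ¬ IsSplitMono (r ≫ g⟦(1 : ℤ)⟧') := by
      rintro ⟨⟨s⟩⟩
      apply hg
      obtain ⟨s', hs'⟩ := (shiftFunctor T (1 : ℤ)).map_surjective (s.retraction ≫ r)
      refine IsSplitMono.mk' ⟨s', ?_⟩
      apply (shiftFunctor T (1 : ℤ)).map_injective
      have h2 := s.id
      rw [Category.assoc] at h2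
      rw [Functor.map_comp, hs', CategoryTheory.Functor.map_id, ← cancel_epi r, Category.comp_id,
        reassoc_of% h2]
    have h2 : δ ≫ g⟦(1 : ℤ)⟧' = 0 := by
      rw [hr, Category.assoc]
      exact hwr _ ((A.indec v).mem_homRadical_of_not_isSplitMono k h1)
    obtain ⟨t, ht⟩ : ∃ t, g⟦(1 : ℤ)⟧' = (-i⟦(1 : ℤ)⟧') ≫ t :=
      Triangle.yoneda_exact₃ _ (rot_of_distTriang _ hT) _ h2
    obtain ⟨t', ht'⟩ := (shiftFunctor T (1 : ℤ)).map_surjective t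
    refine ⟨-t', ?_⟩
    apply (shiftFunctor T (1 : ℤ)).map_injective
    rw [ht, Functor.map_comp, Functor.map_neg, ht']
    simp
  exact ⟨hT, hK, hz, hδ, fun f hf => hF.exists_factor (hz.mem_homRadical_of_not_isSplitEpi k hf),
    fun g hg => hdesc _ g hg⟩

/-- Every vertex has an Auslander-Reiten triangle whose middle term and maps are as prescribed by
the quiver. -/
lemma exists_isARPair (z : Q.V) :
    ∃ (I : A.M (Q.τ z) ⟶ A.mid z) (F : A.mid z ⟶ A.M z), A.IsARPair I F := by
  classical
  have := Fintype.ofFinite Q.V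
  choose f hf using fun y : {y // Q.Arrow y z} => A.exists_isIrr y.2
  let F : A.mid z ⟶ A.M z := biproduct.desc f
  have hF : IsSink F := fun y hy => by
    have : inc hy ≫ F = f ⟨y, hy⟩ := biproduct.ι_desc _ _
    rw [this]; exact hf _
  obtain ⟨K, i, δ, ht⟩ := A.exists_isARTriangle hF
  obtain ⟨e⟩ := A.translation _ ht z (Iso.refl _)
  have hT := ht.distinguished
  have hiF : i ≫ F = 0 := comp_distTriang_mor_zero₁₂ _ hT
  let e' : K ≅ A.M (Q.τ z) := e
  have hrad : ∀ y (hy : Q.Arrow y z), (e'.inv ≫ i) ≫ prj hy ∈ homRadical k _ _ := by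
    intro y hy
    refine ((A.indec _).isIso_or_mem_homRadical k (A.indec y) _).resolve_left fun h => ?_
    have hi : IsSplitMono i := by
      refine IsSplitMono.mk' ⟨prj hy ≫ inv ((e'.inv ≫ i) ≫ prj hy) ≫ e'.inv, ?_⟩
      rw [← cancel_epi e'.inv, ← Category.assoc, ← Category.assoc, ← Category.assoc,
        IsIso.hom_inv_id, Category.id_comp, Category.comp_id]
    have h1 : δ ≫ i⟦(1 : ℤ)⟧' = 0 := comp_distTriang_mor_zero₃₁ _ hT
    exact ht.mor₃_ne_zero (by
      change δ = 0
      rw [← cancel_mono (i⟦(1 : ℤ)⟧'), h1, zero_comp])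
  refine ⟨e'.inv ≫ i, F, fun y hy => ⟨hrad y hy, fun hsq => ?_⟩, hF, by
    rw [Category.assoc, hiF, comp_zero], fun {W} p hp => ?_, fun {W} q hq => ?_⟩
  · -- an irreducible map `g` factors through the triangle, which forces the component at `y` to be
    -- irreducible
    obtain ⟨g, hg, hg'⟩ := A.exists_isIrr ((Q.arrow_τ z y).2 hy)
    obtain ⟨t, ht'⟩ : ∃ t : A.mid z ⟶ A.M y, i ≫ t = e'.hom ≫ g :=
      ht.desc (e'.hom ≫ g) (fun h => not_isSplitMono_of_mem k
        ht.indecomposable₁.1 (comp_mem_homRadical_left e'.hom hg) h)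
    apply hg'
    have h1 : g = ∑ w : {y // Q.Arrow y z}, ((e'.inv ≫ i) ≫ prj w.2) ≫ (inc w.2 ≫ t) := by
      have h2 : g = (e'.inv ≫ i) ≫ 𝟙 _ ≫ t := by
        rw [Category.id_comp, Category.assoc, ht', Iso.inv_hom_id_assoc]
      rw [h2, ← mid_total, Preadditive.sum_comp, Preadditive.comp_sum]
      simp only [Category.assoc]
    rw [h1]
    refine Submodule.sum_mem _ fun w _ => ?_
    by_cases hwy : w.1 = y
    · obtain ⟨w, hw⟩ := w
      subst hwy
      exact homRadicalSq_comp_right hsq _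
    · exact comp_mem_homRadicalSq (hrad _ _) (A.mem_rad_of_ne hwy _)
  · obtain ⟨h, hh⟩ : ∃ h : W ⟶ K, p = h ≫ i := Triangle.coyoneda_exact₂ _ hT p hp
    refine ⟨h ≫ e'.hom, ?_⟩
    rw [Category.assoc, Iso.hom_inv_id_assoc]
    exact hh.symm
  · have hq' : i ≫ q = 0 := by
      rw [Category.assoc] at hq
      rwa [← cancel_epi e'.inv, comp_zero]
    obtain ⟨h, hh⟩ : ∃ h : A.M z ⟶ W, q = F ≫ h := Triangle.yoneda_exact₂ _ hT q hq'
    exact ⟨h, hh.symm⟩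

end Existence

end ARSystem

/-! ### Families of irreducible morphisms and mesh relations -/

lemma ARSystem.IsIrr.of_sub_mem {k : Type*} [Field k] {T : Type*} [Category T] [Preadditive T]
    [Linear k T] {X Y : T} {f g : X ⟶ Y} (hf : IsIrr k f) (h : f - g ∈ homRadicalSq k X Y) :
    IsIrr k g := by
  refine ⟨?_, fun hg => hf.2 ?_⟩
  · have := sub_mem hf.1 (homRadicalSq_le h)
    rwa [sub_sub_cancel] at this
  · have := add_mem h hg
    rwa [sub_add_cancel] at this

namespace ARSystem

variable {k : Type*} [Field k] {T : Type*} [Category T] [Preadditive T] [HasZeroObject T]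
  [HasShift T ℤ] [∀ n : ℤ, (shiftFunctor T n).Additive] [Pretriangulated T] [Linear k T]
  {Q : StableTranslationQuiver} {A : ARSystem k T Q}

lemma IsSource.mem_rad [Finite Q.V] {x z : Q.V} {I : A.M x ⟶ A.mid z} (hI : IsSource I) :
    I ∈ homRadical k _ _ :=
  mem_rad_of_prj fun y hy => (hI y hy).1

section

variable [Finite Q.V] [IsIdempotentComplete T] [∀ X Y : T, Module.Finite k (X ⟶ Y)]

/-- An endomorphism of the middle term is invertible if its diagonal entries are isomorphisms: the
other entries lie in the radical. -/
lemma isIso_of_diag {z : Q.V} (e : A.mid z ⟶ A.mid z)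
    (h : ∀ y (hy : Q.Arrow y z), inc hy ≫ e ≫ prj hy ∉ homRadical k _ _) : IsIso e := by
  classical
  have := Fintype.ofFinite Q.V
  have hiso : ∀ y (hy : Q.Arrow y z), IsIso (inc hy ≫ e ≫ prj hy) := fun y hy =>
    ((A.indec y).isIso_or_mem_homRadical k (A.indec y) _).resolve_right (h y hy)
  let d : A.mid z ⟶ A.mid z :=
    ∑ y : {y // Q.Arrow y z}, prj y.2 ≫ inv (inc y.2 ≫ e ≫ prj y.2) ≫ inc y.2
  let d' : A.mid z ⟶ A.mid z :=
    ∑ y : {y // Q.Arrow y z}, prj y.2 ≫ (inc y.2 ≫ e ≫ prj y.2) ≫ inc y.2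
  have hinc : ∀ y (hy : Q.Arrow y z), inc hy ≫ d = inv (inc hy ≫ e ≫ prj hy) ≫ inc hy := by
    intro y hy
    rw [Preadditive.comp_sum, Finset.sum_eq_single (⟨y, hy⟩ : {y // Q.Arrow y z})]
    · rw [← Category.assoc, inc_prj, Category.id_comp]
    · intro w _ hw
      rw [← Category.assoc, inc_prj_ne _ _ (fun h => hw (Subtype.ext h.symm)), zero_comp]
    · simp
  have hinc' : ∀ y (hy : Q.Arrow y z), inc hy ≫ d' = (inc hy ≫ e ≫ prj hy) ≫ inc hy := by
    intro y hy
    rw [Preadditive.comp_sum, Finset.sum_eq_single (⟨y, hy⟩ : {y // Q.Arrow y z})]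
    · rw [← Category.assoc, inc_prj, Category.id_comp]
    · intro w _ hw
      rw [← Category.assoc, inc_prj_ne _ _ (fun h => hw (Subtype.ext h.symm)), zero_comp]
    · simp
  have hd1 : d ≫ d' = 𝟙 _ := mid_hom_ext' fun y hy => by
    rw [← Category.assoc, hinc, Category.assoc, hinc', IsIso.inv_hom_id_assoc, Category.comp_id]
  have hd2 : d' ≫ d = 𝟙 _ := mid_hom_ext' fun y hy => by
    rw [← Category.assoc, hinc', Category.assoc, hinc, IsIso.hom_inv_id_assoc, Category.comp_id]
  have hd : IsIso d := ⟨d', hd1, hd2⟩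
  have hrad : 𝟙 _ - d ≫ e ∈ homRadical k (A.mid z) (A.mid z) := by
    refine mem_rad_of_inc fun y hy => mem_rad_of_prj fun y' hy' => ?_
    by_cases hne : y = y'
    · subst hne
      rw [Preadditive.comp_sub, Category.comp_id, ← Category.assoc (inc hy), hinc,
        Preadditive.sub_comp, inc_prj]
      simp
    · exact A.mem_rad_of_ne hne _
  have hde : IsIso (d ≫ e) := by
    have := isIso_one_sub_of_mem hrad
    rwa [sub_sub_cancel] at this
  exact IsIso.of_isIso_comp_left d e

/-- Off-diagonal entries do not matter modulo the square of the radical. -/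
lemma sub_diag_mem_of_comp {z : Q.V} (e : A.mid z ⟶ A.mid z) {F : A.mid z ⟶ A.M z}
    (hF : F ∈ homRadical k _ _) {y : Q.V} (hy : Q.Arrow y z) :
    inc hy ≫ e ≫ F - (inc hy ≫ e ≫ prj hy) ≫ inc hy ≫ F ∈ homRadicalSq k _ _ := by
  have h : inc hy ≫ e ≫ F - (inc hy ≫ e ≫ prj hy) ≫ inc hy ≫ F =
      (inc hy ≫ e ≫ (𝟙 _ - prj hy ≫ inc hy)) ≫ F := by simp
  rw [h]
  refine comp_mem_homRadicalSq (mem_rad_of_prj fun w hw => ?_) hF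
  by_cases hne : y = w
  · subst hne
    simp [inc_prj]
  · exact A.mem_rad_of_ne hne _

lemma sub_diag_mem_of_comp' {x z : Q.V} (e : A.mid z ⟶ A.mid z) {I : A.M x ⟶ A.mid z}
    (hI : I ∈ homRadical k _ _) {y : Q.V} (hy : Q.Arrow y z) :
    (I ≫ e) ≫ prj hy - (I ≫ prj hy) ≫ inc hy ≫ e ≫ prj hy ∈ homRadicalSq k _ _ := by
  have h : (I ≫ e) ≫ prj hy - (I ≫ prj hy) ≫ inc hy ≫ e ≫ prj hy =
      I ≫ ((𝟙 _ - prj hy ≫ inc hy) ≫ e ≫ prj hy) := by simp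
  rw [h]
  refine comp_mem_homRadicalSq hI (mem_rad_of_inc fun w hw => ?_)
  by_cases hne : w = y
  · subst hne
    rw [← Category.assoc, Preadditive.comp_sub, ← Category.assoc (inc hw) (prj hw), inc_prj]
    simp
  · exact A.mem_rad_of_ne hne _

/-- Every sink map belongs to an Auslander-Reiten triangle, since it differs from a given one by an
automorphism of the middle term. -/
lemma exists_isARPair_of_isSink {z : Q.V} {F' : A.mid z ⟶ A.M z} (hF' : IsSink F') :
    ∃ I : A.M (Q.τ z) ⟶ A.mid z, A.IsARPair I F' := by
  obtain ⟨I, F, h⟩ := A.exists_isARPair z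
  obtain ⟨e, rfl⟩ := h.sink.exists_factor hF'.mem_rad
  have he : IsIso e := isIso_of_diag e fun y hy hr => by
    have h1 := (hF' y hy).of_sub_mem (sub_diag_mem_of_comp e h.sink.mem_rad hy)
    exact h1.2 (comp_mem_homRadicalSq hr (h.sink y hy).1)
  have hI : I ≫ inv e ∈ homRadical k _ _ := comp_mem_homRadical_right h.source.mem_rad _
  refine ⟨I ≫ inv e, fun y hy => ⟨comp_mem_homRadical_right hI _, fun hsq => ?_⟩, hF', ?_, ?_, ?_⟩
  · have h1 := sub_diag_mem_of_comp' e hI hy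
    have h2 := add_mem h1 (homRadicalSq_comp_right hsq (inc hy ≫ e ≫ prj hy))
    rw [sub_add_cancel, Category.assoc I, IsIso.inv_hom_id, Category.comp_id] at h2
    exact (h.source y hy).2 h2
  · rw [Category.assoc, IsIso.inv_hom_id_assoc, h.comp_eq_zero]
  · intro W p hp
    obtain ⟨t, ht⟩ := h.lift (p ≫ e) (by rw [Category.assoc, hp])
    exact ⟨t, by rw [← Category.assoc, ht, Category.assoc, IsIso.hom_inv_id, Category.comp_id]⟩
  · intro W q hq
    obtain ⟨t, ht⟩ := h.desc (inv e ≫ q) (by rw [← Category.assoc, hq])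
    exact ⟨t, by rw [Category.assoc, ht, IsIso.hom_inv_id_assoc]⟩

lemma exists_isARPair_of_isSource {z : Q.V} {I' : A.M (Q.τ z) ⟶ A.mid z} (hI' : IsSource I') :
    ∃ F : A.mid z ⟶ A.M z, A.IsARPair I' F := by
  obtain ⟨I, F, h⟩ := A.exists_isARPair z
  obtain ⟨e, rfl⟩ := h.source.exists_factor hI'.mem_rad
  have he : IsIso e := isIso_of_diag e fun y hy hr => by
    have h1 := (hI' y hy).of_sub_mem (sub_diag_mem_of_comp' e h.source.mem_rad hy)
    exact h1.2 (comp_mem_homRadicalSq (h.source y hy).1 hr)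
  have hF : inv e ≫ F ∈ homRadical k _ _ := comp_mem_homRadical_left _ h.sink.mem_rad
  refine ⟨inv e ≫ F, hI', fun y hy => ⟨comp_mem_homRadical_left _ hF, fun hsq => ?_⟩, ?_, ?_, ?_⟩
  · have h1 := sub_diag_mem_of_comp e hF hy
    have h2 := add_mem h1 (homRadicalSq_comp_left (inc hy ≫ e ≫ prj hy) hsq)
    rw [sub_add_cancel, IsIso.hom_inv_id_assoc] at h2
    exact (h.sink y hy).2 h2
  · rw [Category.assoc, IsIso.hom_inv_id_assoc, h.comp_eq_zero]
  · intro W p hp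
    obtain ⟨t, ht⟩ := h.lift (p ≫ inv e) (by rw [Category.assoc, hp])
    exact ⟨t, by rw [← Category.assoc, ht, Category.assoc, IsIso.inv_hom_id, Category.comp_id]⟩
  · intro W q hq
    obtain ⟨t, ht⟩ := h.desc (e ≫ q) (by rw [← Category.assoc, hq])
    exact ⟨t, by rw [Category.assoc, ht, IsIso.inv_hom_id_assoc]⟩

end

variable (A) in
/-- A choice of an irreducible map for every arrow, extended by zero to all pairs of vertices. -/
structure IrrFamily where
  /-- the map from `M x` to `M y` -/
  map : ∀ x y : Q.V, A.M x ⟶ A.M y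
  isIrr : ∀ x y, Q.Arrow x y → IsIrr k (map x y)
  map_eq_zero : ∀ x y, ¬ Q.Arrow x y → map x y = 0

variable (A) in
lemma nonempty_irrFamily [∀ X Y : T, Module.Finite k (X ⟶ Y)] : Nonempty A.IrrFamily := by
  classical
  choose f hf using fun (x y : Q.V) (h : Q.Arrow x y) => A.exists_isIrr h
  refine ⟨⟨fun x y => if h : Q.Arrow x y then f x y h else 0, fun x y h => ?_, fun x y h => ?_⟩⟩
  · simpa [h] using hf x y h
  · simp [h]

/-- Composites of two consecutive maps, the first from `s` and the second from `t`, satisfy the mesh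
relations, and `Hom(M w, -)` and `Hom(-, M w)` are exact at the middle of every mesh. -/
structure IsMesh [Fintype Q.V] (s t : A.IrrFamily) : Prop where
  comp_eq_zero : ∀ z, ∑ y, s.map (Q.τ z) y ≫ t.map y z = 0
  lift : ∀ {w z} (p : ∀ y, A.M w ⟶ A.M y), ∑ y, p y ≫ t.map y z = 0 →
    ∃ h : A.M w ⟶ A.M (Q.τ z), ∀ y, Q.Arrow y z → p y = h ≫ s.map (Q.τ z) y
  desc : ∀ {w z} (q : ∀ y, A.M y ⟶ A.M w), ∑ y, s.map (Q.τ z) y ≫ q y = 0 →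
    ∃ h : A.M z ⟶ A.M w, ∀ y, Q.Arrow y z → q y = t.map y z ≫ h

section

variable [Fintype Q.V]

/-- A sum over all vertices `y` whose terms vanish unless `y → z` is a composite through the middle
term. -/
lemma sum_comp_eq {X Y : T} {z : Q.V} (I : X ⟶ A.mid z) (F : A.mid z ⟶ Y)
    (p : ∀ y, X ⟶ A.M y) (q : ∀ y, A.M y ⟶ Y) (hp : ∀ y (hy : Q.Arrow y z), I ≫ prj hy = p y)
    (hq : ∀ y (hy : Q.Arrow y z), inc hy ≫ F = q y)
    (h0 : ∀ y, ¬ Q.Arrow y z → p y ≫ q y = 0) : ∑ y, p y ≫ q y = I ≫ F := by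
  classical
  rw [← Category.id_comp F, ← mid_total, Preadditive.sum_comp, Preadditive.comp_sum,
    ← Finset.sum_filter_of_ne (p := fun y => Q.Arrow y z) (fun y _ h => by
      by_contra h'; exact h (h0 y h')),
    Finset.sum_subtype (p := fun y => Q.Arrow y z) _ (by simp)]
  refine Finset.sum_congr rfl fun y _ => ?_
  rw [← hp y y.2, ← hq y y.2]
  simp only [Category.assoc]

/-- The map to the middle term with given components. -/
noncomputable def midLift {X : T} (z : Q.V) (p : ∀ y, X ⟶ A.M y) : X ⟶ A.mid z :=
  biproduct.lift fun y : {y // Q.Arrow y z} => p y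

/-- The map from the middle term with given components. -/
noncomputable def midDesc {Y : T} (z : Q.V) (q : ∀ y, A.M y ⟶ Y) : A.mid z ⟶ Y :=
  biproduct.desc fun y : {y // Q.Arrow y z} => q y

lemma midLift_prj {X : T} {z : Q.V} (p : ∀ y, X ⟶ A.M y) {y : Q.V} (hy : Q.Arrow y z) :
    midLift z p ≫ prj hy = p y :=
  biproduct.lift_π _ _

lemma inc_midDesc {Y : T} {z : Q.V} (q : ∀ y, A.M y ⟶ Y) {y : Q.V} (hy : Q.Arrow y z) :
    inc hy ≫ midDesc z q = q y :=
  biproduct.ι_desc _ _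

/-- The map from the middle term given by a family of irreducible maps. -/
noncomputable def IrrFamily.sink (t : A.IrrFamily) (z : Q.V) : A.mid z ⟶ A.M z :=
  midDesc z fun y => t.map y z

/-- The map to the middle term given by a family of irreducible maps. -/
noncomputable def IrrFamily.source (s : A.IrrFamily) (z : Q.V) : A.M (Q.τ z) ⟶ A.mid z :=
  midLift z fun y => s.map (Q.τ z) y

lemma isMesh_of_isARPair {s t : A.IrrFamily} (h : ∀ z, A.IsARPair (s.source z) (t.sink z)) :
    IsMesh s t := by
  refine ⟨fun z => ?_, fun {w z} p hp => ?_, fun {w z} q hq => ?_⟩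
  · rw [sum_comp_eq (s.source z) (t.sink z) _ _ (fun y hy => midLift_prj _ hy)
      (fun y hy => inc_midDesc (fun y => t.map y z) hy)
      (fun y hy => by rw [t.map_eq_zero y z hy, comp_zero])]
    exact (h z).comp_eq_zero
  · rw [sum_comp_eq (midLift z p) (t.sink z) _ _
      (fun y hy => midLift_prj _ hy)
      (fun y hy => inc_midDesc (fun y => t.map y z) hy)
      (fun y hy => by rw [t.map_eq_zero y z hy, comp_zero])] at hp
    obtain ⟨g, hg⟩ := (h z).lift _ hp
    refine ⟨g, fun y hy => ?_⟩
    rw [← midLift_prj p hy, ← hg, Category.assoc]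
    exact congrArg (g ≫ ·) (midLift_prj _ hy)
  · rw [sum_comp_eq (s.source z) (midDesc z q) _ _
      (fun y hy => midLift_prj _ hy)
      (fun y hy => inc_midDesc q hy)
      (fun y hy => by
        rw [s.map_eq_zero _ y (fun h' => hy ((Q.arrow_τ z y).1 h')), zero_comp])] at hq
    obtain ⟨g, hg⟩ := (h z).desc _ hq
    refine ⟨g, fun y hy => ?_⟩
    rw [← inc_midDesc q hy, ← hg, ← Category.assoc]
    exact congrArg (· ≫ g) (inc_midDesc (fun y => t.map y z) hy)

variable [IsIdempotentComplete T] [∀ X Y : T, Module.Finite k (X ⟶ Y)]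

lemma exists_isMesh_left (t : A.IrrFamily) : ∃ s : A.IrrFamily, IsMesh s t := by
  classical
  have key : ∀ x, ∃ row : ∀ y, A.M x ⟶ A.M y, (∀ y, Q.Arrow x y → IsIrr k (row y)) ∧
      (∀ y, ¬ Q.Arrow x y → row y = 0) ∧ ∀ z, Q.τ z = x →
        A.IsARPair (midLift z row) (t.sink z) := by
    intro x
    obtain ⟨z, rfl⟩ := Q.τ.surjective x
    obtain ⟨I, hI⟩ := exists_isARPair_of_isSink (F' := t.sink z) fun y hy => by
      rw [IrrFamily.sink, inc_midDesc (fun y => t.map y z) hy]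
      exact t.isIrr y z hy
    refine ⟨fun y => if h : Q.Arrow y z then I ≫ prj h else 0, fun y hy => ?_, fun y hy => ?_,
      fun z' hz' => ?_⟩
    · rw [Q.arrow_τ] at hy
      simpa [hy] using hI.source y hy
    · rw [Q.arrow_τ] at hy
      simp [hy]
    · obtain rfl := Q.τ.injective hz'
      convert hI using 1
      refine mid_hom_ext fun y hy => ?_
      rw [midLift_prj (fun y => if h : Q.Arrow y z' then I ≫ prj h else 0) hy, dif_pos hy]
  choose row h1 h2 h3 using key
  exact ⟨⟨row, h1, h2⟩, isMesh_of_isARPair fun z => h3 _ z rfl⟩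

lemma exists_isMesh_right (s : A.IrrFamily) : ∃ t : A.IrrFamily, IsMesh s t := by
  classical
  have key : ∀ z, ∃ F : A.mid z ⟶ A.M z, A.IsARPair (s.source z) F := fun z =>
    exists_isARPair_of_isSource fun y hy => by
      rw [IrrFamily.source, midLift_prj (fun y => s.map (Q.τ z) y) hy]
      exact s.isIrr _ _ ((Q.arrow_τ z y).2 hy)
  choose F hF using key
  refine ⟨⟨fun y z => if h : Q.Arrow y z then inc h ≫ F z else 0, fun y z h => ?_,
    fun y z h => ?_⟩, isMesh_of_isARPair fun z => ?_⟩
  · simpa [h] using (hF z).sink y h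
  · simp [h]
  · convert hF z using 1
    refine mid_hom_ext' fun y hy => ?_
    rw [IrrFamily.sink,
      inc_midDesc (fun y => if h : Q.Arrow y z then inc h ≫ F z else 0) hy, dif_pos hy]

lemma _root_.exists_int_chain {α : Type*} (r : α → α → Prop) (a : α) (h₁ : ∀ x, ∃ y, r x y)
    (h₂ : ∀ y, ∃ x, r x y) : ∃ s : ℤ → α, ∀ n, r (s n) (s (n + 1)) := by
  choose f hf using h₁
  choose g hg using h₂
  refine ⟨fun n => if 0 ≤ n then f^[n.toNat] a else g^[(-n).toNat] a, fun n => ?_⟩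
  rcases lt_trichotomy n (-1) with h | rfl | h
  · obtain ⟨m, rfl⟩ : ∃ m : ℕ, n = -(m + 2) := ⟨(-n - 2).toNat, by omega⟩
    have e1 : (-(-(m + 2 : ℤ))).toNat = (m + 1) + 1 := by omega
    have e2 : (-(-(m + 2 : ℤ) + 1)).toNat = m + 1 := by omega
    simp only [if_neg (show ¬ (0 : ℤ) ≤ -(m + 2) by omega),
      if_neg (show ¬ (0 : ℤ) ≤ -(m + 2) + 1 by omega), e1, e2]
    rw [Function.iterate_succ_apply' g (m + 1)]
    exact hg _
  · simpa using hg a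
  · obtain ⟨m, rfl⟩ : ∃ m : ℕ, n = m := ⟨n.toNat, by omega⟩
    have e2 : ((m : ℤ) + 1).toNat = m + 1 := by omega
    simp only [if_pos (show (0 : ℤ) ≤ m by omega), if_pos (show (0 : ℤ) ≤ m + 1 by omega), e2,
      Int.toNat_natCast]
    rw [Function.iterate_succ_apply']
    exact hf _

variable (A) in
/-- Families of irreducible maps, one for each integer, such that consecutive families satisfy the
mesh relations. They amount to a functor on the mesh category of the covering `Q × ℤ` of `Q`. -/
lemma exists_chain_isMesh : ∃ s : ℤ → A.IrrFamily, ∀ n, IsMesh (s n) (s (n + 1)) :=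
  exists_int_chain _ A.nonempty_irrFamily.some exists_isMesh_right exists_isMesh_left

end

end ARSystem

/-! ### The grading by path length -/

namespace ARSystem

variable {k : Type*} [Field k] {T : Type*} [Category T] [Preadditive T] [HasZeroObject T]
  [HasShift T ℤ] [∀ n : ℤ, (shiftFunctor T n).Additive] [Pretriangulated T] [Linear k T]
  {Q : StableTranslationQuiver} {A : ARSystem k T Q}

/-- The span of the composites along the paths of length `n` from `x` to `y`, where the `i`-th arrow
of the path is represented by the family `s (l + i)`. -/
noncomputable def pathSpan (s : ℤ → A.IrrFamily) (l : ℤ) (x : Q.V) :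
    ℕ → ∀ y : Q.V, Submodule k (A.M x ⟶ A.M y)
  | 0, y => Submodule.span k {f | ∃ h : x = y, f = eqToHom (congrArg A.M h)}
  | n + 1, y => ⨆ z, (pathSpan s l x n z).map (Linear.rightComp k (A.M x) ((s (l + n)).map z y))

variable {s : ℤ → A.IrrFamily}

lemma id_mem_pathSpan (l : ℤ) (x : Q.V) : 𝟙 (A.M x) ∈ pathSpan s l x 0 x :=
  Submodule.subset_span ⟨rfl, rfl⟩

lemma exists_of_mem_pathSpan_zero {l : ℤ} {x : Q.V} {f : A.M x ⟶ A.M x}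
    (hf : f ∈ pathSpan s l x 0 x) : ∃ c : k, f = c • 𝟙 _ := by
  have h : {f | ∃ h : x = x, f = eqToHom (congrArg A.M h)} = {𝟙 (A.M x)} := by
    ext g; simp
  rw [pathSpan, h, Submodule.mem_span_singleton] at hf
  obtain ⟨c, rfl⟩ := hf
  exact ⟨c, rfl⟩

lemma pathSpan_zero_of_ne {l : ℤ} {x y : Q.V} (h : x ≠ y) : pathSpan s l x 0 y = ⊥ := by
  rw [pathSpan, Submodule.span_eq_bot]
  rintro f ⟨h', -⟩
  exact absurd h' h

lemma comp_map_mem_pathSpan {l m : ℤ} {n : ℕ} (hm : l + n = m) {x z : Q.V} {f : A.M x ⟶ A.M z}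
    (hf : f ∈ pathSpan s l x n z) (y : Q.V) : f ≫ (s m).map z y ∈ pathSpan s l x (n + 1) y := by
  subst hm
  exact Submodule.mem_iSup_of_mem z ⟨f, hf, rfl⟩

lemma pathSpan_succ_le {l : ℤ} {n : ℕ} {x y : Q.V} {P : Submodule k (A.M x ⟶ A.M y)}
    (h : ∀ z, ∀ f ∈ pathSpan s l x n z, f ≫ (s (l + n)).map z y ∈ P) :
    pathSpan s l x (n + 1) y ≤ P :=
  iSup_le fun z => Submodule.map_le_iff_le_comap.2 fun f hf => h z f hf

lemma map_comp_mem_pathSpan {l : ℤ} {n : ℕ} {x y z : Q.V} {f : A.M z ⟶ A.M y}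
    (hf : f ∈ pathSpan s (l + 1) z n y) : (s l).map x z ≫ f ∈ pathSpan s l x (n + 1) y := by
  induction n generalizing y with
  | zero =>
    by_cases hzy : z = y
    · subst hzy
      obtain ⟨c, rfl⟩ := exists_of_mem_pathSpan_zero hf
      have := comp_map_mem_pathSpan (m := l) (n := 0) (by simp) (id_mem_pathSpan (s := s) l x) z
      rw [Category.id_comp] at this
      simpa using Submodule.smul_mem _ c this
    · rw [pathSpan_zero_of_ne hzy, Submodule.mem_bot] at hf
      simp [hf]
  | succ n ih =>
    have : pathSpan s (l + 1) z (n + 1) y ≤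
        (pathSpan s l x (n + 2) y).comap (Linear.leftComp k _ ((s l).map x z)) := by
      refine pathSpan_succ_le fun w g hg => ?_
      rw [Submodule.mem_comap, Linear.leftComp_apply, ← Category.assoc]
      exact comp_map_mem_pathSpan (by push_cast; ring) (ih hg) y
    exact this hf

lemma IrrFamily.map_mem_rad (t : A.IrrFamily) (x y : Q.V) :
    t.map x y ∈ homRadical k (A.M x) (A.M y) := by
  by_cases h : Q.Arrow x y
  · exact (t.isIrr x y h).1
  · rw [t.map_eq_zero x y h]; exact zero_mem _

lemma pathSpan_le_radPow (l : ℤ) (x : Q.V) (n : ℕ) (y : Q.V) :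
    pathSpan s l x n y ≤ A.radPow x n y := by
  induction n generalizing y with
  | zero => exact le_top
  | succ n ih =>
    exact pathSpan_succ_le fun z f hf =>
      A.comp_mem_radPow_succ (ih z hf) ((s (l + n)).map_mem_rad z y)

lemma exists_sub_mem_rad [IsIdempotentComplete T] [∀ X Y : T, Module.Finite k (X ⟶ Y)]
    [IsAlgClosed k] (s : ℤ → A.IrrFamily) (l : ℤ) {x y : Q.V} (f : A.M x ⟶ A.M y) :
    ∃ e ∈ pathSpan s l x 0 y, f - e ∈ homRadical k (A.M x) (A.M y) := by
  by_cases h : x = y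
  · subst h
    obtain ⟨c, hc⟩ := (A.indec x).exists_smul_sub_mem k f
    exact ⟨_, Submodule.smul_mem _ c (id_mem_pathSpan (s := s) l x), hc⟩
  · exact ⟨0, zero_mem _, A.mem_rad_of_ne h _⟩

section

variable [Fintype Q.V]

lemma exists_sum_right {l m : ℤ} {n : ℕ} (hm : l + n = m) {x y : Q.V} {f : A.M x ⟶ A.M y}
    (hf : f ∈ pathSpan s l x (n + 1) y) : ∃ p : ∀ z, A.M x ⟶ A.M z,
      (∀ z, p z ∈ pathSpan s l x n z) ∧ ∑ z, p z ≫ (s m).map z y = f := by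
  subst hm
  rw [pathSpan, Submodule.mem_iSup_iff_exists_finsupp] at hf
  obtain ⟨g, hg, rfl⟩ := hf
  choose p hp hp' using hg
  refine ⟨p, hp, ?_⟩
  rw [Finsupp.sum_fintype _ _ (fun _ => rfl)]
  exact Finset.sum_congr rfl fun z _ => hp' z

lemma exists_sum_left {l : ℤ} {n : ℕ} {x y : Q.V} {f : A.M x ⟶ A.M y}
    (hf : f ∈ pathSpan s l x (n + 1) y) : ∃ p : ∀ z, A.M z ⟶ A.M y,
      (∀ z, p z ∈ pathSpan s (l + 1) z n y) ∧ ∑ z, (s l).map x z ≫ p z = f := by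
  classical
  -- the elements of this form are a submodule, and it contains all paths of length `n + 1`
  let φ : (∀ z, A.M z ⟶ A.M y) →ₗ[k] (A.M x ⟶ A.M y) :=
    ∑ z, (Linear.leftComp k _ ((s l).map x z)).comp (LinearMap.proj z)
  have hφ : ∀ p, φ p = ∑ z, (s l).map x z ≫ p z := fun p => by simp [φ]
  suffices H : pathSpan s l x (n + 1) y ≤
      (Submodule.pi Set.univ fun z => pathSpan s (l + 1) z n y).map φ by
    obtain ⟨p, hp, rfl⟩ := H hf
    exact ⟨p, fun z => hp z trivial, (hφ p).symm⟩
  clear hf f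
  clear_value φ
  induction n generalizing y with
  | zero =>
    refine pathSpan_succ_le fun z f hf => ?_
    by_cases hxz : x = z
    · subst hxz
      obtain ⟨c, rfl⟩ := exists_of_mem_pathSpan_zero hf
      refine ⟨Pi.single y (c • 𝟙 _), fun w _ => ?_, ?_⟩
      · by_cases hw : w = y
        · subst hw
          simpa using Submodule.smul_mem _ c (id_mem_pathSpan (s := s) (l + 1) w)
        · simp [hw]
      · rw [hφ, Finset.sum_eq_single y (fun w _ hw => by simp [hw]) (by simp)]
        simp
    · rw [pathSpan_zero_of_ne hxz, Submodule.mem_bot] at hf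
      rw [hf, zero_comp]
      exact zero_mem _
  | succ n ih =>
    refine pathSpan_succ_le fun w f hf => ?_
    obtain ⟨p, hp, rfl⟩ := ih (y := w)
      (∑ z, (Linear.leftComp k _ ((s l).map x z)).comp (LinearMap.proj z)) (by simp) hf
    refine ⟨fun z => p z ≫ (s (l + (n + 1 : ℕ))).map w y, fun z _ => ?_, ?_⟩
    · exact comp_map_mem_pathSpan (by push_cast; ring) (hp z trivial) y
    · rw [hφ]; simp [Preadditive.sum_comp]

variable [IsIdempotentComplete T] [∀ X Y : T, Module.Finite k (X ⟶ Y)]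

lemma IrrFamily.exists_right (t : A.IrrFamily) {X : T} {y : Q.V} {f : X ⟶ A.M y}
    (hf : f ∈ homRadical k _ _) : ∃ p : ∀ z, X ⟶ A.M z, ∑ z, p z ≫ t.map z y = f := by
  classical
  have hsink : IsSink (t.sink y) := fun z hz => by
    rw [IrrFamily.sink, inc_midDesc (fun z => t.map z y) hz]
    exact t.isIrr z y hz
  obtain ⟨g, rfl⟩ := hsink.exists_factor hf
  refine ⟨fun z => if h : Q.Arrow z y then g ≫ prj h else 0, ?_⟩
  exact sum_comp_eq g (t.sink y) _ _ (fun z hz => by simp [hz])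
    (fun z hz => inc_midDesc (fun z => t.map z y) hz) (fun z hz => by simp [hz])

lemma IrrFamily.exists_left (t : A.IrrFamily) {Y : T} {x : Q.V} {f : A.M x ⟶ Y}
    (hf : f ∈ homRadical k _ _) : ∃ q : ∀ z, A.M z ⟶ Y, ∑ z, t.map x z ≫ q z = f := by
  classical
  obtain ⟨y, rfl⟩ := Q.τ.surjective x
  have hsource : IsSource (t.source y) := fun z hz => by
    rw [IrrFamily.source, midLift_prj (fun z => t.map (Q.τ y) z) hz]
    exact t.isIrr _ z ((Q.arrow_τ y z).2 hz)
  obtain ⟨g, rfl⟩ := hsource.exists_factor hf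
  refine ⟨fun z => if h : Q.Arrow z y then inc h ≫ g else 0, ?_⟩
  exact sum_comp_eq (t.source y) g _ _ (fun z hz => midLift_prj (fun z => t.map (Q.τ y) z) hz)
    (fun z hz => by simp [hz]) (fun z hz => by simp [hz])

variable [IsAlgClosed k]

/-- The paths ending at a fixed level generate all morphisms. -/
lemma exists_sum_pathSpan_right (s : ℤ → A.IrrFamily) {N : ℕ} (hN : ∀ x y, A.radPow x N y = ⊥)
    (m : ℤ) {x y : Q.V} (f : A.M x ⟶ A.M y) : ∃ g : ℕ → (A.M x ⟶ A.M y),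
      (∀ i : ℕ, g i ∈ pathSpan s (m - i) x i y) ∧ ∑ i ∈ Finset.range N, g i = f := by
  have key : ∀ (j : ℕ) (m : ℤ) (y : Q.V) (f : A.M x ⟶ A.M y), ∃ g : ℕ → (A.M x ⟶ A.M y),
      (∀ i : ℕ, g i ∈ pathSpan s (m - i) x i y) ∧
        f - ∑ i ∈ Finset.range j, g i ∈ A.radPow x j y := by
    intro j
    induction j with
    | zero => exact fun m y f => ⟨0, fun i => zero_mem _, trivial⟩
    | succ j ih =>
      intro m y f
      obtain ⟨e, he, hfe⟩ := exists_sub_mem_rad s (m - (0 : ℕ)) f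
      obtain ⟨p, hp⟩ := (s (m - 1)).exists_right hfe
      choose g hg hg' using fun z => ih (m - 1) z (p z)
      refine ⟨fun i => Nat.casesOn i e fun i => ∑ z, g z i ≫ (s (m - 1)).map z y, ?_, ?_⟩
      · rintro (_ | i)
        · exact he
        · refine sum_mem fun z _ => comp_map_mem_pathSpan (by push_cast; ring) ?_ y
          have := hg z i
          rwa [show m - 1 - (i : ℤ) = m - (i + 1 : ℕ) by push_cast; ring] at this
      · have h1 : f - ∑ i ∈ Finset.range (j + 1),
            (Nat.casesOn i e fun i => ∑ z, g z i ≫ (s (m - 1)).map z y : A.M x ⟶ A.M y) =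
            ∑ z, (p z - ∑ i ∈ Finset.range j, g z i) ≫ (s (m - 1)).map z y := by
          rw [Finset.sum_range_succ', ← sub_sub, sub_right_comm]
          simp only [Preadditive.sub_comp, Finset.sum_sub_distrib, hp, Preadditive.sum_comp]
          rw [Finset.sum_comm]
          rfl
        rw [h1]
        exact sum_mem fun z _ => A.comp_mem_radPow_succ (hg' z) ((s (m - 1)).map_mem_rad z y)
  obtain ⟨g, hg, hg'⟩ := key N m y f
  rw [hN, Submodule.mem_bot, sub_eq_zero] at hg'
  exact ⟨g, hg, hg'.symm⟩

/-- The paths starting at a fixed level generate all morphisms. -/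
lemma exists_sum_pathSpan_left (s : ℤ → A.IrrFamily) {N : ℕ} (hN : ∀ x y, A.radPow x N y = ⊥)
    (l : ℤ) {x y : Q.V} (f : A.M x ⟶ A.M y) : ∃ g : ℕ → (A.M x ⟶ A.M y),
      (∀ i : ℕ, g i ∈ pathSpan s l x i y) ∧ ∑ i ∈ Finset.range N, g i = f := by
  have key : ∀ (j : ℕ) (l : ℤ) (x : Q.V) (f : A.M x ⟶ A.M y), ∃ g : ℕ → (A.M x ⟶ A.M y),
      (∀ i : ℕ, g i ∈ pathSpan s l x i y) ∧
        f - ∑ i ∈ Finset.range j, g i ∈ A.radPow x j y := by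
    intro j
    induction j with
    | zero => exact fun l x f => ⟨0, fun i => zero_mem _, trivial⟩
    | succ j ih =>
      intro l x f
      obtain ⟨e, he, hfe⟩ := exists_sub_mem_rad s l f
      obtain ⟨p, hp⟩ := (s l).exists_left hfe
      choose g hg hg' using fun z => ih (l + 1) z (p z)
      refine ⟨fun i => Nat.casesOn i e fun i => ∑ z, (s l).map x z ≫ g z i, ?_, ?_⟩
      · rintro (_ | i)
        · exact he
        · exact sum_mem fun z _ => map_comp_mem_pathSpan (hg z i)
      · have h1 : f - ∑ i ∈ Finset.range (j + 1),
            (Nat.casesOn i e fun i => ∑ z, (s l).map x z ≫ g z i : A.M x ⟶ A.M y) =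
            ∑ z, (s l).map x z ≫ (p z - ∑ i ∈ Finset.range j, g z i) := by
          rw [Finset.sum_range_succ', ← sub_sub, sub_right_comm]
          simp only [Preadditive.comp_sub, Finset.sum_sub_distrib, hp, Preadditive.comp_sum]
          rw [Finset.sum_comm]
          rfl
        rw [h1]
        refine sum_mem fun z _ => ?_
        have := A.comp_mem_radPow (m := 1) (A.rad_le_radPow_one _ _ ((s l).map_mem_rad x z)) (hg' z)
        rwa [add_comm] at this
  obtain ⟨g, hg, hg'⟩ := key N l x f
  rw [hN, Submodule.mem_bot, sub_eq_zero] at hg'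
  exact ⟨g, hg, hg'.symm⟩

end

end ARSystem

/-! ### Independence of paths of different lengths -/

namespace ARSystem

variable {k : Type*} [Field k] {T : Type*} [Category T] [Preadditive T] [HasZeroObject T]
  [HasShift T ℤ] [∀ n : ℤ, (shiftFunctor T n).Additive] [Pretriangulated T] [Linear k T]
  {Q : StableTranslationQuiver} {A : ARSystem k T Q} {s : ℤ → A.IrrFamily}

lemma radPow_add_eq_bot {N : ℕ} (hN : ∀ x y, A.radPow x N y = ⊥) (i : ℕ) (x y : Q.V) :
    A.radPow x (N + i) y = ⊥ := by
  induction i generalizing y with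
  | zero => exact hN x y
  | succ i ih =>
    rw [eq_bot_iff]
    refine A.radPow_succ_le (n := N + i) fun z f g hf _ => ?_
    rw [ih, Submodule.mem_bot] at hf
    simp [hf]

lemma pathSpan_eq_bot {N : ℕ} (hN : ∀ x y, A.radPow x N y = ⊥) (l : ℤ) (x y : Q.V) :
    pathSpan s l x N y = ⊥ :=
  eq_bot_iff.2 ((pathSpan_le_radPow l x N y).trans (hN x y).le)

lemma eq_zero_of_mem_pathSpan_zero {l : ℤ} {x y : Q.V} {f : A.M x ⟶ A.M y}
    (hf : f ∈ pathSpan s l x 0 y) (hr : f ∈ homRadical k (A.M x) (A.M y)) : f = 0 := by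
  by_cases h : x = y
  · subst h
    obtain ⟨c, rfl⟩ := exists_of_mem_pathSpan_zero hf
    by_cases hc : c = 0
    · simp [hc]
    · exfalso
      apply A.id_notMem_rad x
      have := Submodule.smul_mem _ c⁻¹ hr
      rwa [smul_smul, inv_mul_cancel₀ hc, one_smul] at this
  · rw [pathSpan_zero_of_ne h, Submodule.mem_bot] at hf
    exact hf

lemma mem_rad_of_mem_pathSpan_succ {l : ℤ} {n : ℕ} {x y : Q.V} {f : A.M x ⟶ A.M y}
    (hf : f ∈ pathSpan s l x (n + 1) y) : f ∈ homRadical k (A.M x) (A.M y) :=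
  A.radPow_succ_le_rad x y n (pathSpan_le_radPow l x _ y hf)

section

variable [Fintype Q.V] [IsIdempotentComplete T] [∀ X Y : T, Module.Finite k (X ⟶ Y)]
  [IsAlgClosed k]

/-- The key step of both independence statements: relations between paths ending at a vertex come
from maps to its translate, and these maps can be split into paths. -/
lemma exists_lift_pathSpan (hs : ∀ n, IsMesh (s n) (s (n + 1))) {N : ℕ}
    (hN : ∀ x y, A.radPow x N y = ⊥) (m : ℤ) {x y : Q.V} (p : ∀ z, A.M x ⟶ A.M z)
    (hp : ∑ z, p z ≫ (s (m + 1)).map z y = 0) : ∃ h : ℕ → (A.M x ⟶ A.M (Q.τ y)),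
      (∀ i : ℕ, h i ∈ pathSpan s (m - i) x i (Q.τ y)) ∧
      ∀ z, Q.Arrow z y → p z = ∑ i ∈ Finset.range N, h i ≫ (s m).map (Q.τ y) z := by
  obtain ⟨h, hh⟩ := (hs m).lift p hp
  obtain ⟨g, hg, rfl⟩ := exists_sum_pathSpan_right s hN m h
  exact ⟨g, hg, fun z hz => by rw [hh z hz, Preadditive.sum_comp]⟩

/-- Prepend a zero to a sequence. -/
def shiftSeq {M : Type*} [Zero M] (h : ℕ → M) : ℕ → M
  | 0 => 0
  | i + 1 => h i

lemma sum_shiftSeq {M : Type*} [AddCommMonoid M] (h : ℕ → M) (N : ℕ) (hN : shiftSeq h N = 0) :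
    ∑ i ∈ Finset.range N, shiftSeq h i = ∑ i ∈ Finset.range N, h i := by
  have h1 := Finset.sum_range_succ (shiftSeq h) N
  rw [Finset.sum_range_succ', hN] at h1
  simpa [shiftSeq] using h1.symm

/-- Paths of different lengths ending at a fixed level are linearly independent. A relation comes
from a map to the translate of the end point, and splitting this map into paths gives shorter
relations that end at the neighbours. -/
lemma pathSpan_independent_right (hs : ∀ n, IsMesh (s n) (s (n + 1))) {N : ℕ}
    (hN : ∀ x y, A.radPow x N y = ⊥) (n : ℕ) : ∀ (m : ℤ) {x y : Q.V} (g : ℕ → (A.M x ⟶ A.M y)),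
      (∀ i : ℕ, g i ∈ pathSpan s (m - i) x i y) → ∑ i ∈ Finset.range N, g i = 0 →
        ∀ i < n, g i = 0 := by
  induction n with
  | zero => intro m x y g _ _ i hi; omega
  | succ n ih =>
    intro m x y g hg hsum
    have hgN : g N = 0 := by
      have := hg N
      rwa [pathSpan_eq_bot hN, Submodule.mem_bot] at this
    have hsum' : ∑ i ∈ Finset.range N, g (i + 1) + g 0 = 0 := by
      rw [← Finset.sum_range_succ', Finset.sum_range_succ, hsum, hgN, add_zero]
    have h0 : g 0 = 0 := by
      refine eq_zero_of_mem_pathSpan_zero (hg 0) ?_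
      rw [eq_neg_of_add_eq_zero_right hsum']
      exact neg_mem (sum_mem fun i _ => mem_rad_of_mem_pathSpan_succ (hg (i + 1)))
    rw [h0, add_zero] at hsum'
    choose p hp hpg using fun i : ℕ =>
      exists_sum_right (m := m - 1) (by push_cast; ring) (hg (i + 1))
    have hrel : ∑ z, (∑ i ∈ Finset.range N, p i z) ≫ (s (m - 2 + 1)).map z y = 0 := by
      rw [← hsum', show m - 2 + 1 = m - 1 by ring]
      simp only [← hpg, Preadditive.sum_comp]
      exact Finset.sum_comm
    obtain ⟨h, hh, hph⟩ := exists_lift_pathSpan hs hN (m - 2) _ hrel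
    have hlift : ∀ z, Q.Arrow z y → ∀ i < n,
        p i z = shiftSeq (fun i => h i ≫ (s (m - 2)).map (Q.τ y) z) i := by
      intro z hz i hi
      have hmem : ∀ i : ℕ, shiftSeq (fun i => h i ≫ (s (m - 2)).map (Q.τ y) z) i ∈
          pathSpan s (m - 1 - i) x i z := by
        rintro (_ | i)
        · exact zero_mem _
        · have := comp_map_mem_pathSpan (m := m - 2) (by ring) (hh i) z
          rwa [show m - 2 - (i : ℤ) = m - 1 - (i + 1 : ℕ) by push_cast; ring] at this
      refine sub_eq_zero.1 (ih (m - 1)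
        (fun i => p i z - shiftSeq (fun i => h i ≫ (s (m - 2)).map (Q.τ y) z) i)
        (fun i => sub_mem ?_ (hmem i)) ?_ i hi)
      · have := hp i z
        rwa [show m - ((i + 1 : ℕ) : ℤ) = m - 1 - i by push_cast; ring] at this
      · rw [Finset.sum_sub_distrib, hph z hz, sum_shiftSeq, sub_self]
        have := hmem N
        rwa [pathSpan_eq_bot hN, Submodule.mem_bot] at this
    rintro (_ | i) hi
    · exact h0
    · rw [← hpg i]
      have hz : ∀ z, p i z ≫ (s (m - 1)).map z y =
          shiftSeq (fun i => h i ≫ (s (m - 2)).map (Q.τ y) z) i ≫ (s (m - 1)).map z y := by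
        intro z
        by_cases hzy : Q.Arrow z y
        · rw [hlift z hzy i (by omega)]
        · rw [(s (m - 1)).map_eq_zero z y hzy, comp_zero, comp_zero]
      simp only [hz]
      cases i with
      | zero => simp [shiftSeq]
      | succ i =>
        have := (hs (m - 2)).comp_eq_zero y
        rw [show m - 2 + 1 = m - 1 by ring] at this
        simp only [shiftSeq, Category.assoc, ← Preadditive.comp_sum, this, comp_zero]

/-- Paths of different lengths starting at a fixed level are linearly independent. -/
lemma pathSpan_independent_left (hs : ∀ n, IsMesh (s n) (s (n + 1))) {N : ℕ}
    (hN : ∀ x y, A.radPow x N y = ⊥) (n : ℕ) : ∀ (l : ℤ) {x y : Q.V} (g : ℕ → (A.M x ⟶ A.M y)),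
      (∀ i : ℕ, g i ∈ pathSpan s l x i y) → ∑ i ∈ Finset.range N, g i = 0 →
        ∀ i < n, g i = 0 := by
  induction n with
  | zero => intro l x y g _ _ i hi; omega
  | succ n ih =>
    intro l x y g hg hsum
    obtain ⟨w, rfl⟩ := Q.τ.surjective x
    have hgN : g N = 0 := by
      have := hg N
      rwa [pathSpan_eq_bot hN, Submodule.mem_bot] at this
    have hsum' : ∑ i ∈ Finset.range N, g (i + 1) + g 0 = 0 := by
      rw [← Finset.sum_range_succ', Finset.sum_range_succ, hsum, hgN, add_zero]
    have h0 : g 0 = 0 := by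
      refine eq_zero_of_mem_pathSpan_zero (hg 0) ?_
      rw [eq_neg_of_add_eq_zero_right hsum']
      exact neg_mem (sum_mem fun i _ => mem_rad_of_mem_pathSpan_succ (hg (i + 1)))
    rw [h0, add_zero] at hsum'
    choose p hp hpg using fun i : ℕ => exists_sum_left (hg (i + 1))
    have hrel : ∑ z, (s l).map (Q.τ w) z ≫ (∑ i ∈ Finset.range N, p i z) = 0 := by
      rw [← hsum']
      simp only [← hpg, Preadditive.comp_sum]
      exact Finset.sum_comm
    obtain ⟨h', hh'⟩ := (hs l).desc _ hrel
    obtain ⟨h, hh, rfl⟩ := exists_sum_pathSpan_left s hN (l + 2) h'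
    have hlift : ∀ z, Q.Arrow z w → ∀ i < n,
        p i z = shiftSeq (fun i => (s (l + 1)).map z w ≫ h i) i := by
      intro z hz i hi
      have hmem : ∀ i : ℕ, shiftSeq (fun i => (s (l + 1)).map z w ≫ h i) i ∈
          pathSpan s (l + 1) z i y := by
        rintro (_ | i)
        · exact zero_mem _
        · refine map_comp_mem_pathSpan ?_
          rw [show l + 1 + 1 = l + 2 by ring]
          exact hh i
      refine sub_eq_zero.1 (ih (l + 1)
        (fun i => p i z - shiftSeq (fun i => (s (l + 1)).map z w ≫ h i) i)
        (fun i => sub_mem (hp i z) (hmem i)) ?_ i hi)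
      rw [Finset.sum_sub_distrib, hh' z hz, sum_shiftSeq, Preadditive.comp_sum, sub_self]
      have := hmem N
      rwa [pathSpan_eq_bot hN, Submodule.mem_bot] at this
    rintro (_ | i) hi
    · exact h0
    · rw [← hpg i]
      have hz : ∀ z, (s l).map (Q.τ w) z ≫ p i z =
          (s l).map (Q.τ w) z ≫ shiftSeq (fun i => (s (l + 1)).map z w ≫ h i) i := by
        intro z
        by_cases hzy : Q.Arrow z w
        · rw [hlift z hzy i (by omega)]
        · rw [(s l).map_eq_zero _ z (fun h' => hzy ((Q.arrow_τ w z).1 h')), zero_comp, zero_comp]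
      simp only [hz]
      cases i with
      | zero => simp [shiftSeq]
      | succ i =>
        have := (hs l).comp_eq_zero w
        simp only [shiftSeq, ← Category.assoc, ← Preadditive.sum_comp, this, zero_comp]

lemma eq_zero_of_mem_pathSpan_of_ne (hs : ∀ n, IsMesh (s n) (s (n + 1))) {l : ℤ} {n n' : ℕ}
    (hne : n ≠ n') {x y : Q.V} {f : A.M x ⟶ A.M y} (hf : f ∈ pathSpan s l x n y)
    (hf' : f ∈ pathSpan s l x n' y) : f = 0 := by
  obtain ⟨N, hN⟩ := A.exists_radPow_eq_bot
  by_contra hf0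
  have hlt : ∀ j, f ∈ pathSpan s l x j y → j < N := by
    intro j hj
    by_contra hNj
    obtain ⟨i, rfl⟩ := Nat.exists_eq_add_of_le (not_lt.1 hNj)
    have h2 := pathSpan_le_radPow l x _ y hj
    rw [radPow_add_eq_bot hN] at h2
    exact hf0 h2
  let g : ℕ → (A.M x ⟶ A.M y) := fun i => if i = n then f else if i = n' then -f else 0
  have hg : ∀ i, g i ∈ pathSpan s l x i y := by
    intro i
    simp only [g]
    split_ifs with h1 h2
    · exact h1 ▸ hf
    · exact neg_mem (h2 ▸ hf')
    · exact zero_mem _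
  have hsum : ∑ i ∈ Finset.range N, g i = 0 := by
    have : ∀ i, g i = (if i = n then f else 0) + (if i = n' then -f else 0) := by
      intro i
      simp only [g]
      split_ifs with h1 h2 <;> simp_all
    simp only [this, Finset.sum_add_distrib, Finset.sum_ite_eq', Finset.mem_range, hlt n hf,
      hlt n' hf', if_true, add_neg_cancel]
  have := pathSpan_independent_left hs hN (n + 1) l g hg hsum n (by omega)
  simp only [g, if_true] at this
  exact hf0 this

/-- A relation between paths of length `n` ending at neighbours of `y` comes from a map to `M (τ
y)`. This map is a sum of paths of all lengths that end at the same level, and only the paths of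
length `n - 1` contribute. -/
lemma exists_eq_shiftSeq (hs : ∀ n, IsMesh (s n) (s (n + 1))) {l : ℤ} {n : ℕ} {x y : Q.V}
    (p : ∀ z, A.M x ⟶ A.M z) (hp : ∀ z, p z ∈ pathSpan s l x n z)
    (hrel : ∑ z, p z ≫ (s (l + n)).map z y = 0) : ∃ h : ℕ → (A.M x ⟶ A.M (Q.τ y)),
      (∀ i : ℕ, h i ∈ pathSpan s (l + n - 1 - i) x i (Q.τ y)) ∧
      ∀ z, Q.Arrow z y → p z = shiftSeq (fun i => h i ≫ (s (l + n - 1)).map (Q.τ y) z) n := by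
  obtain ⟨N, hN⟩ := A.exists_radPow_eq_bot
  -- the index has to lie in the range of the sums below
  have hN' : ∀ x y, A.radPow x (N + n + 1) y = ⊥ := fun x y => by
    rw [add_assoc, radPow_add_eq_bot hN]
  rw [show l + n = l + n - 1 + 1 by ring] at hrel
  obtain ⟨h, hh, hph⟩ := exists_lift_pathSpan hs hN' (l + n - 1) p hrel
  refine ⟨h, hh, fun z hz => ?_⟩
  have hmem : ∀ i : ℕ, shiftSeq (fun i => h i ≫ (s (l + n - 1)).map (Q.τ y) z) i ∈
      pathSpan s (l + n - i) x i z := by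
    rintro (_ | i)
    · exact zero_mem _
    · have := comp_map_mem_pathSpan (m := l + n - 1) (by ring) (hh i) z
      rwa [show l + n - 1 - (i : ℤ) = l + n - (i + 1 : ℕ) by push_cast; ring] at this
  have := pathSpan_independent_right hs hN' (n + 1) (l + n)
    (fun i => (if i = n then p z else 0) -
      shiftSeq (fun i => h i ≫ (s (l + n - 1)).map (Q.τ y) z) i)
    (fun i => sub_mem ?_ (hmem i)) ?_ n (by omega)
  · simpa [sub_eq_zero] using this
  · split_ifs with hi
    · subst hi
      simpa using hp z
    · exact zero_mem _
  · rw [Finset.sum_sub_distrib, sum_shiftSeq, ← hph z hz, Finset.sum_ite_eq',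
      if_pos (Finset.mem_range.2 (by omega)), sub_self]
    have := hmem (N + n + 1)
    rwa [pathSpan_eq_bot hN', Submodule.mem_bot] at this

end

end ARSystem

/-! ### The length of the longest paths -/

/-- The integers `w n z` with `w 0 = 0`, `w 1 = 1`, and `w (n + 2) z + w n (τ⁻¹ z) = ∑ w (n + 1) y`,
the sum being over the arrows `z → y`. If `w h = 0`, then all paths of length `h - 1` vanish; see
`ARSystem.pathSpan_eq_bot_of_additiveSeq`. -/
noncomputable def StableTranslationQuiver.additiveSeq (Q : StableTranslationQuiver) [Fintype Q.V] :
    ℕ → Q.V → ℤ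
  | 0 => 0
  | 1 => 1
  | n + 2 => fun z => open Classical in
    ∑ y, (if Q.Arrow z y then Q.additiveSeq (n + 1) y else 0) - Q.additiveSeq n (Q.τ.symm z)

lemma StableTranslationQuiver.sum_arrow (Q : StableTranslationQuiver) [Fintype Q.V] {M : Type*}
    [AddCommMonoid M] {y : Q.V} [Fintype {z // Q.Arrow z y}] (F : Q.V → M)
    (hF : ∀ z, ¬ Q.Arrow z y → F z = 0) : ∑ z, F z = ∑ z : {z // Q.Arrow z y}, F z := by
  classical
  rw [← Finset.sum_subtype (Finset.univ.filter fun z => Q.Arrow z y) (by simp), Finset.sum_filter]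
  exact Finset.sum_congr rfl fun z _ => by
    split_ifs with h
    · rfl
    · exact hF z h

open Classical in
/-- A solution `d` of the dual recursion pairs with `w = StableTranslationQuiver.additiveSeq`: the
discrete Wronskian `∑ w (j + 1) y * d (n + 1) y - ∑ w j y * d n (τ y)` depends only on `j + n`. For
`j = 0` it is the sum of the values of `d (n + 1)`, and for `n = 0` it vanishes with `w (j + 1)`. -/
lemma StableTranslationQuiver.sum_eq_zero_of_additiveSeq (Q : StableTranslationQuiver)
    [Fintype Q.V] {m : ℕ} (hm : Q.additiveSeq (m + 1) = 0) (d : ℕ → Q.V → ℤ) (hd0 : d 0 = 0)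
    (hd : ∀ n < m, ∀ y, d (n + 2) y + d n (Q.τ y) = ∑ z, if Q.Arrow z y then d (n + 1) z else 0) :
    ∑ y, d (m + 1) y = 0 := by
  let w := Q.additiveSeq
  let W : ℕ → ℕ → ℤ := fun j n => ∑ y, w (j + 1) y * d (n + 1) y - ∑ y, w j y * d n (Q.τ y)
  have step : ∀ j, ∀ n < m, W j (n + 1) = W (j + 1) n := by
    intro j n hn
    have hd' : ∀ y, d (n + 1 + 1) y =
        ∑ z, (if Q.Arrow z y then d (n + 1) z else 0) - d n (Q.τ y) := fun y => by
      rw [← hd n hn y]; ring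
    have hw : ∀ z, w (j + 1 + 1) z =
        ∑ y, (if Q.Arrow z y then w (j + 1) y else 0) - w j (Q.τ.symm z) := fun z => rfl
    have hτ : ∑ y, w j y * d (n + 1) (Q.τ y) = ∑ y, w j (Q.τ.symm y) * d (n + 1) y :=
      Fintype.sum_equiv Q.τ _ _ fun y => by simp
    simp only [W, hd', hw, hτ, mul_sub, sub_mul, Finset.sum_sub_distrib, Finset.mul_sum,
      Finset.sum_mul, mul_ite, ite_mul, mul_zero, zero_mul]
    rw [Finset.sum_comm]
    ring
  have key : ∀ j ≤ m, W j (m - j) = W 0 m := by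
    intro j hj
    induction j with
    | zero => rfl
    | succ j ih =>
      rw [← ih (by omega), ← step j (m - (j + 1)) (by omega)]
      congr 1
      omega
  have h1 := key m le_rfl
  have hw1 : w 1 = 1 := rfl
  have hw0 : w 0 = 0 := rfl
  have hwm : w (m + 1) = 0 := hm
  simp only [W, Nat.sub_self, hwm, hw1, hw0, hd0, zero_add, Pi.zero_apply, Pi.one_apply, zero_mul,
    mul_zero, one_mul, Finset.sum_const_zero, sub_zero] at h1
  exact h1.symm

namespace ARSystem

variable {k : Type*} [Field k] {T : Type*} [Category T] [Preadditive T] [HasZeroObject T]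
  [HasShift T ℤ] [∀ n : ℤ, (shiftFunctor T n).Additive] [Pretriangulated T] [Linear k T]
  {Q : StableTranslationQuiver} {A : ARSystem k T Q}

variable {s : ℤ → A.IrrFamily}

/-- The span of the paths of length `n - 1`, which is zero for `n = 0`. -/
noncomputable def predSpan (s : ℤ → A.IrrFamily) (l : ℤ) (x : Q.V) :
    ℕ → ∀ y : Q.V, Submodule k (A.M x ⟶ A.M y)
  | 0, _ => ⊥
  | n + 1, y => pathSpan s l x n y

lemma comp_map_mem_of_mem_predSpan {l : ℤ} {n : ℕ} {x z : Q.V} {f : A.M x ⟶ A.M z}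
    (hf : f ∈ predSpan s l x n z) (y : Q.V) :
    f ≫ (s (l + n - 1)).map z y ∈ pathSpan s l x n y := by
  cases n with
  | zero =>
    rw [predSpan, Submodule.mem_bot] at hf
    rw [hf, zero_comp]
    exact zero_mem _
  | succ n => exact comp_map_mem_pathSpan (by push_cast; ring) hf y

variable [Fintype Q.V] [IsIdempotentComplete T] [∀ X Y : T, Module.Finite k (X ⟶ Y)]

variable (A) in
/-- Every nonzero map from `M x` can be prolonged to a fixed nonzero map `w`. -/
lemma exists_comp_eq_of_ne_zero (x : Q.V) : ∃ (v : Q.V) (w : A.M x ⟶ A.M v), w ≠ 0 ∧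
    ∀ (Y : T) (a : A.M x ⟶ Y), a ≠ 0 → ∃ g, a ≫ g = w := by
  obtain ⟨t⟩ := A.nonempty_irrFamily
  have hsink : IsSink (t.sink x) := fun z hz => by
    rw [IrrFamily.sink, inc_midDesc (fun z => t.map z x) hz]
    exact t.isIrr z x hz
  obtain ⟨K, i, δ, hT⟩ := A.exists_isARTriangle hsink
  have hl : ∀ {U : T} (g : U ⟶ A.M x), g ∈ homRadical k _ _ → g ≫ δ = 0 := by
    intro U g hg
    obtain ⟨f, hf⟩ : ∃ f, f ≫ t.sink x = g :=
      hT.lift g (not_isSplitEpi_of_mem k (A.indec x).1 hg)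
    have h0 : t.sink x ≫ δ = 0 := comp_distTriang_mor_zero₂₃ _ hT.distinguished
    rw [← hf, Category.assoc, h0, comp_zero]
  obtain ⟨v, w, hw0, hwl, -⟩ := A.exists_socle_map hT.mor₃_ne_zero hl
  refine ⟨v, w, hw0, fun Y a ha => ?_⟩
  obtain ⟨C, c, δ', hT'⟩ := distinguished_cocone_triangle₁ a
  have hca : c ≫ a = 0 := comp_distTriang_mor_zero₁₂ _ hT'
  obtain ⟨g, hg⟩ : ∃ g, w = a ≫ g := by
    refine Triangle.yoneda_exact₂ _ hT' w (hwl c ?_)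
    refine (A.indec x).mem_homRadical_of_not_isSplitEpi k fun hc => ha ?_
    rw [← cancel_epi c, hca, comp_zero]
  exact ⟨g, hg.symm⟩

lemma IrrFamily.comp_eq_zero_of_mem_rad (t : A.IrrFamily) {X Y : T} {x : Q.V} {a : X ⟶ A.M x}
    (h : ∀ z, a ≫ t.map x z = 0) {g : A.M x ⟶ Y} (hg : g ∈ homRadical k _ _) : a ≫ g = 0 := by
  obtain ⟨q, rfl⟩ := t.exists_left hg
  simp [Preadditive.comp_sum, reassoc_of% h]

variable [IsAlgClosed k]

/-- The maps from `M x` annihilated by the radical are unique up to scalars. -/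
lemma exists_eq_smul_of_killed {x y y' : Q.V} {a : A.M x ⟶ A.M y} {b : A.M x ⟶ A.M y'}
    (ha0 : a ≠ 0) (hb0 : b ≠ 0)
    (ha : ∀ (Y : T) (g : A.M y ⟶ Y), g ∈ homRadical k _ _ → a ≫ g = 0)
    (hb : ∀ (Y : T) (g : A.M y' ⟶ Y), g ∈ homRadical k _ _ → b ≫ g = 0) :
    ∃ (h : y = y') (c : k), a = c • b ≫ eqToHom (congrArg A.M h.symm) := by
  obtain ⟨v, w, hw0, hw⟩ := A.exists_comp_eq_of_ne_zero x
  have key : ∀ {y : Q.V} {a : A.M x ⟶ A.M y}, a ≠ 0 →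
      (∀ (Y : T) (g : A.M y ⟶ Y), g ∈ homRadical k _ _ → a ≫ g = 0) →
      ∃ (h : y = v) (c : k), c ≠ 0 ∧ c • a ≫ eqToHom (congrArg A.M h) = w := by
    intro y a ha0 ha
    obtain ⟨g, hg⟩ := hw _ a ha0
    have hyv : y = v := by
      by_contra hne
      exact hw0 (by rw [← hg, ha _ g (A.mem_rad_of_ne hne g)])
    subst hyv
    obtain ⟨c, hc⟩ := (A.indec y).exists_smul_sub_mem k g
    have h1 := ha _ _ hc
    rw [Preadditive.comp_sub, sub_eq_zero, hg, Linear.comp_smul, Category.comp_id] at h1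
    refine ⟨rfl, c, fun h => hw0 (by rw [h1, h, zero_smul]), by simpa using h1.symm⟩
  obtain ⟨rfl, c, hc, hcw⟩ := key ha0 ha
  obtain ⟨rfl, c', hc', hcw'⟩ := key hb0 hb
  refine ⟨rfl, c⁻¹ * c', ?_⟩
  simp only [eqToHom_refl, Category.comp_id] at hcw hcw' ⊢
  rw [mul_smul, hcw', ← hcw, smul_smul, inv_mul_cancel₀ hc, one_smul]

/-- Relations between paths of length `n` ending at neighbours of `y` come from paths of length
`n - 1` ending at `τ y`. -/
lemma exists_mem_predSpan (hs : ∀ n, IsMesh (s n) (s (n + 1))) {l : ℤ} {n : ℕ} {x y : Q.V}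
    (p : ∀ z, A.M x ⟶ A.M z) (hp : ∀ z, p z ∈ pathSpan s l x n z)
    (hrel : ∑ z, p z ≫ (s (l + n)).map z y = 0) : ∃ h ∈ predSpan s l x n (Q.τ y),
      ∀ z, Q.Arrow z y → p z = h ≫ (s (l + n - 1)).map (Q.τ y) z := by
  obtain ⟨h, hh, hp⟩ := exists_eq_shiftSeq hs p hp hrel
  cases n with
  | zero => exact ⟨0, zero_mem _, fun z hz => by rw [hp z hz, zero_comp]; rfl⟩
  | succ n =>
    refine ⟨h n, ?_, hp⟩
    have hn := hh n
    rwa [show l + ((n + 1 : ℕ) : ℤ) - 1 - n = l by push_cast; ring] at hn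

open Classical in
/-- The dimensions of the spaces of paths are additive on meshes, up to the length of the longest
nonzero path. -/
lemma finrank_pathSpan (hs : ∀ n, IsMesh (s n) (s (n + 1))) {l : ℤ} {x : Q.V} {n : ℕ} {y : Q.V}
    (hinj : ∀ a ∈ predSpan s l x n (Q.τ y), (∀ z, a ≫ (s (l + n - 1)).map (Q.τ y) z = 0) → a = 0) :
    Module.finrank k (pathSpan s l x (n + 1) y) + Module.finrank k (predSpan s l x n (Q.τ y)) =
      ∑ z, if Q.Arrow z y then Module.finrank k (pathSpan s l x n z) else 0 := by
  -- the paths to `y` are the cokernel of `ψ`, and `ψ` is injective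
  let φ : ((z : {z // Q.Arrow z y}) → pathSpan s l x n z.1) →ₗ[k] (A.M x ⟶ A.M y) :=
    ∑ z : {z // Q.Arrow z y}, (Linear.rightComp k _ ((s (l + n)).map z.1 y)).comp
      ((pathSpan s l x n z.1).subtype.comp (LinearMap.proj z))
  have hφ : ∀ p, φ p = ∑ z, (p z).1 ≫ (s (l + n)).map z.1 y := fun p => by simp [φ]
  let ψ : predSpan s l x n (Q.τ y) →ₗ[k] ((z : {z // Q.Arrow z y}) → pathSpan s l x n z.1) :=
    LinearMap.pi fun z => ((Linear.rightComp k _ ((s (l + n - 1)).map (Q.τ y) z.1)).comp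
      (predSpan s l x n (Q.τ y)).subtype).codRestrict _
        fun a => comp_map_mem_of_mem_predSpan a.2 z.1
  have hψ : ∀ a z, (ψ a z).1 = a.1 ≫ (s (l + n - 1)).map (Q.τ y) z.1 := fun a z => rfl
  have hrange : LinearMap.range φ = pathSpan s l x (n + 1) y := by
    apply le_antisymm
    · rintro _ ⟨p, rfl⟩
      rw [hφ]
      exact sum_mem fun z _ => comp_map_mem_pathSpan rfl (p z).2 y
    · intro f hf
      obtain ⟨p, hp, rfl⟩ := exists_sum_right (m := l + n) rfl hf
      refine ⟨fun z => ⟨p z.1, hp z.1⟩, ?_⟩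
      rw [hφ, Q.sum_arrow fun z => p z ≫ (s (l + n)).map z y]
      intro z hz
      rw [(s (l + n)).map_eq_zero z y hz, comp_zero]
  have hker : LinearMap.ker φ = LinearMap.range ψ := by
    apply le_antisymm
    · intro p hp
      rw [LinearMap.mem_ker, hφ] at hp
      let p' : ∀ z, A.M x ⟶ A.M z := fun z => if h : Q.Arrow z y then (p ⟨z, h⟩).1 else 0
      have hp' : ∀ z : {z // Q.Arrow z y}, p' z.1 = (p z).1 := fun z => by simp [p', z.2]
      obtain ⟨h, hh, hhp⟩ := exists_mem_predSpan (n := n) (l := l) (y := y) hs p'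
        (fun z => by
          by_cases hz : Q.Arrow z y
          · rw [hp' ⟨z, hz⟩]; exact (p ⟨z, hz⟩).2
          · simp [p', hz])
        (by
          rw [Q.sum_arrow (y := y) _ fun z hz => by simp [p', hz], ← hp]
          exact Finset.sum_congr rfl fun z _ => by rw [hp'])
      refine ⟨⟨h, hh⟩, ?_⟩
      ext z
      rw [hψ, ← hp', hhp z.1 z.2]
    · rintro _ ⟨a, rfl⟩
      rw [LinearMap.mem_ker, hφ]
      have := (hs (l + n - 1)).comp_eq_zero y
      rw [sub_add_cancel] at this
      simp only [hψ, Category.assoc]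
      rw [← Q.sum_arrow (fun z => a.1 ≫ (s (l + n - 1)).map (Q.τ y) z ≫ (s (l + n)).map z y)
        (fun z hz => by rw [(s (l + n)).map_eq_zero z y hz, comp_zero, comp_zero]), ←
        Preadditive.comp_sum, this, comp_zero]
  have hψi : Function.Injective ψ := by
    rw [injective_iff_map_eq_zero]
    intro a ha
    refine Subtype.ext (hinj a.1 a.2 fun z => ?_)
    by_cases hz : Q.Arrow z y
    · have := congrArg Subtype.val (congrFun ha ⟨z, hz⟩)
      rwa [hψ] at this
    · rw [(s (l + n - 1)).map_eq_zero _ _ fun h => hz ((Q.arrow_τ y z).1 h), comp_zero]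
  have h1 := LinearMap.finrank_range_add_finrank_ker φ
  rw [hker, LinearMap.finrank_range_of_inj hψi, hrange, Module.finrank_pi_fintype] at h1
  rw [h1, ← Finset.sum_filter]
  exact (Finset.sum_subtype (Finset.univ.filter fun z => Q.Arrow z y) (by simp)
    (fun z => Module.finrank k (pathSpan s l x n z))).symm

/-- If the additive sequence vanishes at `m + 1`, then all paths of length `m` vanish. Before the
length of the longest nonzero path from `x`, no path is killed by all arrows, because the maps from
`M x` that are killed by the radical form a line. So up to this length the dimensions of the spaces
of paths solve the dual recursion, and the sum of the dimensions for length `m` is zero. -/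
theorem pathSpan_eq_bot_of_additiveSeq (hs : ∀ n, IsMesh (s n) (s (n + 1))) {m : ℕ}
    (hm : Q.additiveSeq (m + 1) = 0) (l : ℤ) (x y : Q.V) : pathSpan s l x m y = ⊥ := by
  classical
  obtain ⟨N, hN⟩ := A.exists_radPow_eq_bot
  by_contra hne
  -- the length `n₀` of the longest nonzero path from `x`, and such a path `b`
  let p : ℕ → Prop := fun n => ∃ y, pathSpan s l x n y ≠ ⊥
  have hp : ∀ n, p n → n < N := by
    rintro n ⟨y, hy⟩
    by_contra hn
    obtain ⟨i, rfl⟩ := Nat.exists_eq_add_of_le (not_lt.1 hn)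
    exact hy (eq_bot_iff.2 ((pathSpan_le_radPow l x _ y).trans (radPow_add_eq_bot hN i x y).le))
  have hpm : p m := ⟨y, hne⟩
  set n₀ := Nat.findGreatest p N with hn₀
  obtain ⟨y₁, hy₁⟩ : p n₀ := Nat.findGreatest_spec (hp m hpm).le hpm
  have hmn : m ≤ n₀ := Nat.le_findGreatest (hp m hpm).le hpm
  obtain ⟨b, hb, hb0⟩ := (Submodule.ne_bot_iff _).1 hy₁
  have hbz : ∀ z, b ≫ (s (l + n₀)).map y₁ z = 0 := by
    intro z
    by_contra hz
    have hpn : p (n₀ + 1) :=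
      ⟨z, (Submodule.ne_bot_iff _).2 ⟨_, comp_map_mem_pathSpan rfl hb z, hz⟩⟩
    exact Nat.findGreatest_is_greatest (Nat.lt_succ_self n₀) (hp _ hpn).le hpn
  have hinj : ∀ n < n₀, ∀ y, ∀ a ∈ pathSpan s l x n y, (∀ z, a ≫ (s (l + n)).map y z = 0) →
      a = 0 := by
    intro n hn y a ha haz
    by_contra ha0
    obtain ⟨rfl, c, hc⟩ := exists_eq_smul_of_killed ha0 hb0
      (fun Y g hg => (s (l + n)).comp_eq_zero_of_mem_rad haz hg)
      (fun Y g hg => (s (l + n₀)).comp_eq_zero_of_mem_rad hbz hg)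
    rw [eqToHom_refl, Category.comp_id] at hc
    exact ha0 (eq_zero_of_mem_pathSpan_of_ne hs hn.ne ha (hc ▸ Submodule.smul_mem _ c hb))
  have h0 := Q.sum_eq_zero_of_additiveSeq hm
    (fun n y => (Module.finrank k (predSpan s l x n y) : ℤ)) (by
      ext
      exact congrArg Nat.cast (finrank_bot k _)) (by
      intro n hn y
      have := finrank_pathSpan (n := n) (l := l) (x := x) (y := y) hs (by
        intro a ha haz
        cases n with
        | zero => exact ha
        | succ n =>
          refine hinj n (by omega) _ a ha fun z => ?_
          have := haz z
          rwa [show l + ((n + 1 : ℕ) : ℤ) - 1 = l + n by push_cast; ring] at this)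
      exact_mod_cast this)
  rw [Finset.sum_eq_zero_iff_of_nonneg (fun _ _ => by positivity)] at h0
  have h1 := h0 y (Finset.mem_univ y)
  exact hne (Submodule.finrank_eq_zero.1 (Nat.cast_eq_zero.1 h1))

end ARSystem

/-! ### Combinatorics of the Dynkin trees -/

namespace Dynkin

instance : ∀ (Δ : Dynkin) (i j : ℕ), Decidable (Δ.NumArrow i j)
  | A _ _, i, j => inferInstanceAs (Decidable (j = i + 1))
  | D n _, i, j => inferInstanceAs
      (Decidable ((j = i + 1 ∧ j ≤ n - 2) ∨ (i = n - 1 ∧ j = n - 2) ∨ (i = n ∧ j = n - 2)))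
  | E _ _ _, i, j => inferInstanceAs (Decidable
      ((i = 2 ∧ j = 1) ∨ (i = 3 ∧ (j = 2 ∨ j = 4 ∨ j = 5)) ∨ (5 ≤ i ∧ j = i + 1)))

/-- A height function on the vertices of the tree, in terms of their numbers: every arrow raises it
by one. -/
def numHeight : Dynkin → ℕ → ℤ
  | A _ _, i => i
  | D n _, i => if n ≤ i + 1 then n - 3 else i
  | E _ _ _, i => if i ≤ 3 then 3 - i else if i = 4 then 1 else i - 4

/-- The grading of the vertices of `ℤΔ` for which every arrow raises the degree by one. -/
def level (Δ : Dynkin) (v : Δ.repetition.V) : ℤ := 2 * v.1 + Δ.numHeight (v.2.val + 1)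

lemma numHeight_arrow (Δ : Dynkin) {x y : Δ.Vertex} (h : Δ.Arrow x y) :
    Δ.numHeight (y.val + 1) = Δ.numHeight (x.val + 1) + 1 := by
  cases Δ with
  | A n hn =>
    simp only [Arrow, NumArrow] at h
    simp only [numHeight]
    omega
  | D n hn =>
    simp only [Arrow, NumArrow] at h
    simp only [numHeight]
    split_ifs <;> omega
  | E n hn hn' =>
    simp only [Arrow, NumArrow] at h
    simp only [numHeight]
    split_ifs <;> omega

lemma level_arrow (Δ : Dynkin) {v w : Δ.repetition.V} (h : Δ.repetition.Arrow v w) :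
    Δ.level w = Δ.level v + 1 := by
  simp only [level]
  rcases h with ⟨h1, h2⟩ | ⟨h1, h2⟩ <;> have := Δ.numHeight_arrow h2 <;> omega

/-- The automorphism `φ` shifts the grading by `c`. -/
def Shifts {Δ : Dynkin} (φ : Δ.repetition.Aut) (c : ℤ) : Prop :=
  ∀ v, Δ.level (φ.1 v) = Δ.level v + c

section Shifts

variable {Δ : Dynkin} {φ ψ : Δ.repetition.Aut} {c d : ℤ}

lemma Shifts.mul (hφ : Shifts φ c) (hψ : Shifts ψ d) : Shifts (φ * ψ) (c + d) := fun v => by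
  have h : (φ * ψ).1 v = φ.1 (ψ.1 v) := rfl
  rw [h, hφ, hψ]
  ring

lemma Shifts.pow (hφ : Shifts φ c) (r : ℕ) : Shifts (φ ^ r) (r * c) := by
  induction r with
  | zero => intro v; simp
  | succ r ih =>
    rw [pow_succ, show ((r + 1 : ℕ) : ℤ) * c = r * c + c by push_cast; ring]
    exact ih.mul hφ

lemma Shifts.inv (hφ : Shifts φ c) : Shifts φ⁻¹ (-c) := fun v => by
  have h := hφ (φ⁻¹.1 v)
  have h' : φ.1 (φ⁻¹.1 v) = v := φ.1.apply_symm_apply v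
  rw [h'] at h
  rw [h]
  ring

lemma Shifts.zpow (hφ : Shifts φ c) (r : ℤ) : Shifts (φ ^ r) (r * c) := by
  cases r with
  | ofNat r => exact hφ.pow r
  | negSucc r =>
    rw [zpow_negSucc, show Int.negSucc r * c = -(((r + 1 : ℕ) : ℤ) * c) by
      rw [Int.negSucc_eq]; push_cast; ring]
    exact (hφ.pow (r + 1)).inv

lemma shifts_tau : Shifts Δ.tau (-2) := fun v => by
  have h : Δ.tau.1 v = (v.1 - 1, v.2) := rfl
  rw [h]
  simp only [level]
  ring

lemma shifts_tau_pow (r : ℕ) : Shifts (Δ.tau ^ r) (-(2 * r)) := by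
  have := shifts_tau (Δ := Δ).pow r
  rwa [show (r : ℤ) * -2 = -(2 * r) by ring] at this

lemma shifts_liftAut {φ : Δ.TreeAut}
    (h : ∀ x, Δ.numHeight ((φ.1 x).val + 1) = Δ.numHeight (x.val + 1)) : Shifts (liftAut φ) 0 :=
  fun v => by
    have h' : (liftAut φ).1 v = (v.1, φ.1 v.2) := rfl
    rw [h']
    simp only [level, h, add_zero]

lemma shifts_suspA (n : ℕ) (hn : 1 ≤ n) : Shifts (suspA n hn) (n + 1) := by
  rintro ⟨p, (x : Fin n)⟩
  have h : (suspA n hn).1 (p, x) = (p + (x.val + 1), x.rev) := rfl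
  rw [h]
  have hx := x.2
  have hr : (A n hn).rank = n := rfl
  simp only [level, numHeight, Fin.val_rev]
  omega

lemma shifts_swapD (n : ℕ) (hn : 4 ≤ n) : Shifts (liftAut (swapD n hn)) 0 := by
  refine shifts_liftAut ?_
  intro (x : Fin n)
  have h := swapD_val n hn x
  have hx := x.2
  change (D n hn).numHeight
    ((Equiv.swap (⟨n - 2, by omega⟩ : Fin n) ⟨n - 1, by omega⟩ x).val + 1) = _
  rw [h]
  simp only [numHeight]
  split_ifs <;> omega

lemma shifts_swapE6 : Shifts (liftAut swapE6) 0 := by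
  refine shifts_liftAut ?_
  intro (x : Fin 6)
  revert x
  decide

/-- An automorphism of `D₄` fixes the centre, since this is the only vertex that is a target. -/
lemma shifts_D4 (hn : 4 ≤ 4) (φ : (D 4 hn).TreeAut) : Shifts (liftAut φ) 0 := by
  refine shifts_liftAut ?_
  intro (x : Fin 4)
  have key : ∀ (hn : 4 ≤ 4) (y : Fin 4), (D 4 hn).numHeight (y.val + 1) =
      if ∃ z : Fin 4, (D 4 hn).NumArrow (z.val + 1) (y.val + 1) then 2 else 1 := by
    decide
  have h1 : (∃ z : Fin 4, (D 4 hn).NumArrow (z.val + 1) ((φ.1 x).val + 1)) ↔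
      ∃ z : Fin 4, (D 4 hn).NumArrow (z.val + 1) (x.val + 1) := by
    constructor
    · rintro ⟨z, hz⟩
      obtain ⟨z, rfl⟩ := φ.1.surjective z
      exact ⟨z, (φ.2 z x).1 hz⟩
    · rintro ⟨z, hz⟩
      exact ⟨φ.1 z, (φ.2 z x).2 hz⟩
  rw [key hn, key hn x]
  simp only [h1]

end Shifts

/-- The Coxeter number. -/
def coxeter : Dynkin → ℕ
  | A n _ => n + 1
  | D n _ => 2 * n - 2
  | E n _ _ => if n = 6 then 12 else if n = 7 then 18 else 30

/-- The bounds on the exponents say that the grading is shifted by at least `h - 2`, where `h` is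
the Coxeter number. The shift is zero only for the trivial group on `ℤA₁`, where there are no
arrows. -/
lemma IsLargeGenerator.exists_shifts {Δ : Dynkin} {φ : Δ.repetition.Aut}
    (hφ : Δ.IsLargeGenerator φ) : ∃ c : ℤ, Shifts φ c ∧ (Δ.coxeter : ℤ) - 2 ≤ |c| ∧
      (c = 0 → ∀ x y, ¬ Δ.Arrow x y) := by
  cases hφ with
  | A_odd n hn h r hr =>
    refine ⟨_, shifts_tau_pow r, ?_, fun hc (x : Fin n) (y : Fin n) hxy => ?_⟩
    · rw [abs_neg, abs_of_nonneg (by positivity)]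
      simp only [coxeter]
      obtain ⟨j, rfl⟩ := h
      omega
    · simp only [Arrow, NumArrow] at hxy
      have hx : x.val < n := x.2
      have hy : y.val < n := y.2
      change y.val + 1 = x.val + 1 + 1 at hxy
      obtain ⟨j, rfl⟩ := h
      omega
  | A_odd_flip n hn h r hr =>
    have hs := (shifts_tau_pow r).mul ((shifts_tau_pow ((n + 1) / 2)).mul (shifts_suspA n hn))
    have hc : -(2 * (r : ℤ)) + (-(2 * ((n + 1) / 2 : ℕ)) + (n + 1)) = -(2 * r) := by
      obtain ⟨j, rfl⟩ := h
      omega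
    rw [hc] at hs
    refine ⟨_, hs, ?_, fun hc (x : Fin n) (y : Fin n) hxy => ?_⟩
    · rw [abs_neg, abs_of_nonneg (by positivity)]
      simp only [coxeter]
      obtain ⟨j, rfl⟩ := h
      omega
    · simp only [Arrow, NumArrow] at hxy
      have hx : x.val < n := x.2
      have hy : y.val < n := y.2
      change y.val + 1 = x.val + 1 + 1 at hxy
      obtain ⟨j, rfl⟩ := h
      omega
  | A_even n hn h r hr =>
    have hs := ((shifts_tau_pow (n / 2)).mul (shifts_suspA n hn)).pow r
    have hc : (r : ℤ) * (-(2 * (n / 2 : ℕ)) + (n + 1)) = r := by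
      obtain ⟨j, rfl⟩ := h
      rw [show (j + j) / 2 = j by omega]
      push_cast
      ring
    rw [hc] at hs
    refine ⟨_, hs, ?_, fun hc => ?_⟩
    · rw [abs_of_nonneg (by positivity)]
      simp only [coxeter]
      omega
    · obtain ⟨j, rfl⟩ := h
      omega
  | D n hn h r hr =>
    refine ⟨_, shifts_tau_pow r, ?_, fun hc => by omega⟩
    rw [abs_neg, abs_of_nonneg (by positivity)]
    simp only [coxeter]
    omega
  | D_flip n hn h r hr =>
    refine ⟨_, (shifts_tau_pow r).mul (shifts_swapD n hn), ?_, fun hc => by omega⟩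
    rw [add_zero, abs_neg, abs_of_nonneg (by positivity)]
    simp only [coxeter]
    omega
  | D4 hn φ r hr =>
    refine ⟨_, (shifts_D4 hn φ).mul (shifts_tau_pow r), ?_, fun hc => by omega⟩
    rw [zero_add, abs_neg, abs_of_nonneg (by positivity)]
    simp only [coxeter]
    omega
  | E6 hn hn' r hr =>
    refine ⟨_, shifts_tau_pow r, ?_, fun hc => by omega⟩
    rw [abs_neg, abs_of_nonneg (by positivity)]
    simp only [coxeter, if_true]
    omega
  | E6_flip hn hn' r hr =>
    refine ⟨_, (shifts_tau_pow r).mul shifts_swapE6, ?_, fun hc => by omega⟩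
    rw [add_zero, abs_neg, abs_of_nonneg (by positivity)]
    simp only [coxeter, if_true]
    omega
  | E7 hn hn' r hr =>
    refine ⟨_, shifts_tau_pow r, ?_, fun hc => by omega⟩
    rw [abs_neg, abs_of_nonneg (by positivity)]
    simp [coxeter]
    omega
  | E8 hn hn' r hr =>
    refine ⟨_, shifts_tau_pow r, ?_, fun hc => by omega⟩
    rw [abs_neg, abs_of_nonneg (by positivity)]
    simp [coxeter]
    omega

/-- Two vertices of `Δ` are neighbours. -/
def Adj (Δ : Dynkin) (x y : Δ.Vertex) : Prop := Δ.Arrow x y ∨ Δ.Arrow y x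

instance (Δ : Dynkin) : DecidableRel Δ.Adj := fun x y =>
  inferInstanceAs (Decidable (Δ.NumArrow (x.val + 1) (y.val + 1) ∨
    Δ.NumArrow (y.val + 1) (x.val + 1)))

/-- A ranking of the vertices for which every vertex has at most one neighbour that is not ranked
lower. -/
def numRank : Dynkin → ℕ → ℕ
  | A _ _, i => i
  | D n _, i => if i = n then 0 else i
  | E _ _ _, i => if i = 4 then 0 else i

lemma eq_of_numRank_le (Δ : Dynkin) {x y z : Δ.Vertex} (hy : Δ.Adj x y) (hz : Δ.Adj x z)
    (hxy : Δ.numRank (x.val + 1) ≤ Δ.numRank (y.val + 1))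
    (hxz : Δ.numRank (x.val + 1) ≤ Δ.numRank (z.val + 1)) : y = z := by
  have hx := x.2
  have hy' := y.2
  have hz' := z.2
  apply Fin.ext
  cases Δ <;> simp only [Adj, Arrow, NumArrow] at hy hz <;> simp only [numRank] at hxy hxz <;>
    simp only [rank] at hx hy' hz'
  · omega
  · split_ifs at hxy hxz <;> omega
  · split_ifs at hxy hxz <;> omega

/-- The integers `u n x` with `u 0 = 0`, `u 1 = 1`, and `u (n + 2) x + u n x = ∑ u (n + 1) y`, the
sum being over the neighbours `y` of `x`. -/
def additiveSeq (Δ : Dynkin) : ℕ → Δ.Vertex → ℤ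
  | 0 => 0
  | 1 => 1
  | n + 2 => fun x => ∑ y, (if Δ.Adj x y then Δ.additiveSeq (n + 1) y else 0) - Δ.additiveSeq n x

/-- The recursion is symmetric, so that the sequence is symmetric about `c + 1` if it is so at the
two neighbours of `c + 1`, and then its value at `2 * (c + 1)` is that at `0`. -/
lemma additiveSeq_reflect (Δ : Dynkin) {c : ℕ} (h : Δ.additiveSeq (c + 2) = Δ.additiveSeq c) :
    Δ.additiveSeq (2 * (c + 1)) = 0 := by
  have key : ∀ j, j ≤ c + 1 → Δ.additiveSeq (c + 1 + j) = Δ.additiveSeq (c + 1 - j) := by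
    intro j
    induction j using Nat.twoStepInduction with
    | zero => intro _; rfl
    | one => intro _; exact h
    | more j ih1 ih2 =>
      intro hj
      have h1 := ih1 (by omega)
      have h2 := ih2 (by omega)
      obtain ⟨i, hi⟩ : ∃ i, c + 1 - (j + 2) = i := ⟨_, rfl⟩
      rw [show c + 1 - (j + 1) = i + 1 by omega] at h2
      rw [show c + 1 - j = i + 2 by omega] at h1
      rw [hi]
      funext x
      have e1 : Δ.additiveSeq (c + 1 + (j + 2)) x =
        ∑ y, (if Δ.Adj x y then Δ.additiveSeq (c + 1 + (j + 1)) y else 0) -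
          Δ.additiveSeq (c + 1 + j) x := rfl
      have e2 : Δ.additiveSeq (i + 2) x =
        ∑ y, (if Δ.Adj x y then Δ.additiveSeq (i + 1) y else 0) - Δ.additiveSeq i x := rfl
      rw [e1, h1, h2, e2]
      ring
  have := key (c + 1) le_rfl
  rw [Nat.sub_self] at this
  rw [two_mul, this]
  rfl

end Dynkin

/-! ### The additive sequences of the Dynkin trees -/

namespace Dynkin

lemma sum_fin_ite (n a : ℕ) (F : ℕ → ℤ) :
    ∑ y : Fin n, (if y.val + 1 = a then F (y.val + 1) else 0) =
      if 1 ≤ a ∧ a ≤ n then F a else 0 := by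
  split_ifs with h
  · rw [Finset.sum_eq_single (⟨a - 1, by omega⟩ : Fin n)]
    · simp [show a - 1 + 1 = a by omega]
    · intro b _ hb
      rw [if_neg]
      intro hba
      exact hb (Fin.ext (by simp only; omega))
    · simp
  · refine Finset.sum_eq_zero fun y _ => if_neg ?_
    have := y.2
    omega

/-- The additive sequence of `Aₙ` is a pyramid over a square. -/
lemma additiveSeq_A (n : ℕ) (hn : 1 ≤ n) (m : ℕ) (hm : m ≤ n + 1) (x : Fin n) :
    (A n hn).additiveSeq m x = min (min (x.val + 1 : ℤ) (n - x.val)) (min m (n + 1 - m)) := by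
  induction m using Nat.twoStepInduction generalizing x with
  | zero =>
    have h := x.2
    have : (A n hn).additiveSeq 0 x = 0 := rfl
    rw [this]
    omega
  | one =>
    have h := x.2
    have : (A n hn).additiveSeq 1 x = 1 := rfl
    rw [this]
    omega
  | more m ih1 ih2 =>
    have h := x.2
    have e : (A n hn).additiveSeq (m + 2) x =
        ∑ y : Fin n, (if (A n hn).Adj x y then (A n hn).additiveSeq (m + 1) y else 0) -
          (A n hn).additiveSeq m x := rfl
    rw [e, ih1 (by omega)]
    obtain ⟨F, hF⟩ : ∃ F : ℕ → ℤ, ∀ j : ℕ, F j = min (min (j : ℤ) (n + 1 - j))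
      (min (m + 1) (n - m)) := ⟨_, fun _ => rfl⟩
    have hsum : ∀ y : Fin n, (if (A n hn).Adj x y then (A n hn).additiveSeq (m + 1) y else 0) =
        (if y.val + 1 = x.val then F (y.val + 1) else 0) +
          if y.val + 1 = x.val + 2 then F (y.val + 1) else 0 := by
      intro y
      have h1 : (A n hn).Adj x y ↔ y.val + 1 = x.val + 2 ∨ x.val = y.val + 1 := by
        simp only [Adj, Arrow, NumArrow]
        omega
      simp only [h1]
      rw [ih2 (by omega)]
      rw [hF]
      push_cast
      split_ifs <;> omega
    rw [Finset.sum_congr rfl fun y _ => hsum y, Finset.sum_add_distrib, sum_fin_ite, sum_fin_ite,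
      hF, hF]
    push_cast
    split_ifs <;> grind

/-- The recursion for `Dₙ`, at the end of the long branch, inside it, at the branching vertex, and
at the ends of the short branches. -/
lemma additiveSeq_D_succ (n : ℕ) (hn : 4 ≤ n) (m : ℕ) (x : Fin n) (F : ℕ → ℤ)
    (hF : ∀ y : Fin n, (D n hn).additiveSeq (m + 1) y = F (y.val + 1)) :
    (x.val = 0 ∧ (D n hn).additiveSeq (m + 2) x = F (x.val + 2) - (D n hn).additiveSeq m x) ∨
    (1 ≤ x.val ∧ x.val + 1 ≤ n - 3 ∧
      (D n hn).additiveSeq (m + 2) x = F x.val + F (x.val + 2) - (D n hn).additiveSeq m x) ∨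
    (x.val = n - 3 ∧ (D n hn).additiveSeq (m + 2) x =
      F (n - 3) + F (n - 1) + F n - (D n hn).additiveSeq m x) ∨
    (n - 2 ≤ x.val ∧ (D n hn).additiveSeq (m + 2) x = F (n - 2) - (D n hn).additiveSeq m x) := by
  have h := x.2
  have e : (D n hn).additiveSeq (m + 2) x =
      ∑ y : Fin n, (if (D n hn).Adj x y then F (y.val + 1) else 0) -
        (D n hn).additiveSeq m x := by
    simp only [← hF]
    rfl
  have hadj : ∀ y : Fin n, (D n hn).Adj x y ↔ (x.val + 1 ≤ n - 3 ∧ (y.val + 1 = x.val ∨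
      y.val + 1 = x.val + 2)) ∨ (x.val = n - 3 ∧ (y.val + 1 = n - 3 ∨ y.val + 1 = n - 1 ∨
        y.val + 1 = n)) ∨ (n - 2 ≤ x.val ∧ y.val + 1 = n - 2) := by
    intro y
    have hy := y.2
    simp only [Adj, Arrow, NumArrow]
    omega
  -- a sum over the neighbours is a sum of one-point sums; with fewer than three neighbours, the
  -- place of a missing one is taken by a number greater than `n`
  have key : ∀ a b c : ℕ, (a ≠ b ∧ b ≠ c ∧ a ≠ c) →
      (∀ y : Fin n, (D n hn).Adj x y ↔ y.val + 1 = a ∨ y.val + 1 = b ∨ y.val + 1 = c) →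
      ∑ y : Fin n, (if (D n hn).Adj x y then F (y.val + 1) else 0) =
        (if 1 ≤ a ∧ a ≤ n then F a else 0) + (if 1 ≤ b ∧ b ≤ n then F b else 0) +
          (if 1 ≤ c ∧ c ≤ n then F c else 0) := by
    intro a b c hne hab
    rw [← sum_fin_ite, ← sum_fin_ite, ← sum_fin_ite, ← Finset.sum_add_distrib,
      ← Finset.sum_add_distrib]
    refine Finset.sum_congr rfl fun y _ => ?_
    simp only [hab]
    split_ifs <;> omega
  rw [e]
  by_cases h1 : x.val + 1 ≤ n - 3
  · rw [key x.val (x.val + 2) (n + 1) (by omega) (fun y => by have := y.2; rw [hadj]; omega),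
      if_pos (show 1 ≤ x.val + 2 ∧ x.val + 2 ≤ n by omega),
      if_neg (show ¬ (1 ≤ n + 1 ∧ n + 1 ≤ n) by omega)]
    by_cases h2 : x.val = 0
    · left
      simp [h2]
    · right; left
      rw [if_pos (by omega), add_zero]
      exact ⟨by omega, h1, rfl⟩
  · right; right
    by_cases h2 : x.val = n - 3
    · rw [key (n - 3) (n - 1) n (by omega) (fun y => by have := y.2; rw [hadj]; omega),
        if_pos (by omega), if_pos (by omega), if_pos (by omega)]
      exact Or.inl ⟨h2, rfl⟩
    · rw [key (n - 2) (n + 1) (n + 2) (by omega) (fun y => by have := y.2; rw [hadj]; omega),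
        if_pos (by omega), if_neg (by omega), if_neg (by omega), add_zero, add_zero]
      exact Or.inr ⟨by omega, rfl⟩

/-- Up to the middle, the additive sequence of `Dₙ` is obtained by folding the additive sequence
of `A₂ₙ₋₃` that starts with `1, …, 1, 2, 1, …, 1`. -/
lemma additiveSeq_D (n : ℕ) (hn : 4 ≤ n) (m : ℕ) (hm : m ≤ n - 1) (x : Fin n) :
    (D n hn).additiveSeq m x = if n - 2 ≤ x.val then (m + 1 : ℤ) / 2 else
      min (x.val + 1) m + if n ≤ x.val + 1 + m ∧ (x.val + n + m) % 2 = 1 then 1 else 0 := by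
  induction m using Nat.twoStepInduction generalizing x with
  | zero =>
    have h := x.2
    have : (D n hn).additiveSeq 0 x = 0 := rfl
    rw [this]
    split_ifs <;> omega
  | one =>
    have h := x.2
    have : (D n hn).additiveSeq 1 x = 1 := rfl
    rw [this]
    split_ifs <;> omega
  | more m ih1 ih2 =>
    have h := x.2
    obtain ⟨F, hF⟩ : ∃ F : ℕ → ℤ, ∀ j : ℕ, F j = if n - 1 ≤ j then (m + 2 : ℤ) / 2 else
        min j (m + 1) + if n ≤ j + (m + 1) ∧ (j + n + m) % 2 = 1 then 1 else 0 :=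
      ⟨_, fun _ => rfl⟩
    have hF₁ : ∀ j, n - 1 ≤ j → F j = (m + 2 : ℤ) / 2 := fun j hj => by rw [hF, if_pos hj]
    have hF₂ : ∀ j, j < n - 1 → F j =
        min j (m + 1) + if n ≤ j + (m + 1) ∧ (j + n + m) % 2 = 1 then 1 else 0 := fun j hj => by
      rw [hF, if_neg (by omega)]
    have hih : ∀ y : Fin n, (D n hn).additiveSeq (m + 1) y = F (y.val + 1) := by
      intro y
      rw [ih2 (by omega), hF]
      push_cast
      split_ifs <;> omega
    have e0 := ih1 (by omega) x
    rcases additiveSeq_D_succ n hn m x F hih with ⟨h0, e⟩ | ⟨h1, h2, e⟩ | ⟨h0, e⟩ | ⟨h0, e⟩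
    · rw [if_neg (by omega)] at e0 ⊢
      rw [e, e0, hF₂ _ (by omega)]
      push_cast
      split_ifs <;> omega
    · rw [if_neg (by omega)] at e0 ⊢
      rw [e, e0, hF₂ _ (by omega), hF₂ _ (by omega)]
      push_cast
      split_ifs <;> omega
    · rw [if_neg (by omega)] at e0 ⊢
      rw [e, e0, hF₂ _ (by omega), hF₁ _ (by omega), hF₁ _ (by omega)]
      push_cast
      split_ifs <;> omega
    · rw [if_pos (by omega)] at e0 ⊢
      rw [e, e0, hF₂ _ (by omega)]
      push_cast
      split_ifs <;> omega

set_option maxRecDepth 100000 in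
lemma additiveSeq_E6 : ∀ (hn : 6 ≤ 6) (hn' : 6 ≤ 8) (x : Fin 6),
    (E 6 hn hn').additiveSeq 7 x = (E 6 hn hn').additiveSeq 5 x := by
  decide

set_option maxRecDepth 100000 in
lemma additiveSeq_E7 : ∀ (hn : 6 ≤ 7) (hn' : 7 ≤ 8) (x : Fin 7),
    (E 7 hn hn').additiveSeq 10 x = (E 7 hn hn').additiveSeq 8 x := by
  decide

set_option maxRecDepth 100000 in
lemma additiveSeq_E8 : ∀ (hn : 6 ≤ 8) (hn' : 8 ≤ 8) (x : Fin 8),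
    (E 8 hn hn').additiveSeq 16 x = (E 8 hn hn').additiveSeq 14 x := by
  decide

/-- For `Dₙ` and `Eₙ` the Coxeter number is even, and the sequence is symmetric about half of it. -/
lemma additiveSeq_coxeter (Δ : Dynkin) : Δ.additiveSeq Δ.coxeter = 0 := by
  cases Δ with
  | A n hn =>
    funext (x : Fin n)
    have h := x.2
    change (A n hn).additiveSeq (n + 1) x = 0
    rw [additiveSeq_A n hn (n + 1) le_rfl]
    push_cast
    omega
  | D n hn =>
    obtain ⟨c, rfl⟩ : ∃ c, n = c + 2 := ⟨n - 2, by omega⟩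
    change (D (c + 2) hn).additiveSeq (2 * (c + 2) - 2) = 0
    rw [show 2 * (c + 2) - 2 = 2 * (c + 1) by omega]
    refine additiveSeq_reflect _ ?_
    funext (x : Fin (c + 2))
    have h := x.2
    obtain ⟨F, hF⟩ : ∃ F : ℕ → ℤ, ∀ j : ℕ, F j = if c + 1 ≤ j then (c + 2 : ℤ) / 2 else
        min j (c + 1) + if c + 2 ≤ j + (c + 1) ∧ (j + (c + 2) + c) % 2 = 1 then 1 else 0 :=
      ⟨_, fun _ => rfl⟩
    have hF₁ : ∀ j, c + 1 ≤ j → F j = (c + 2 : ℤ) / 2 := fun j hj => by rw [hF, if_pos hj]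
    have hF₂ : ∀ j, j < c + 1 → F j = min j (c + 1) +
        if c + 2 ≤ j + (c + 1) ∧ (j + (c + 2) + c) % 2 = 1 then 1 else 0 := fun j hj => by
      rw [hF, if_neg (by omega)]
    have hih : ∀ y : Fin (c + 2), (D (c + 2) hn).additiveSeq (c + 1) y = F (y.val + 1) := by
      intro y
      rw [additiveSeq_D (c + 2) hn (c + 1) (by omega), hF]
      push_cast
      split_ifs <;> omega
    have e0 := additiveSeq_D (c + 2) hn c (by omega) x
    rcases additiveSeq_D_succ (c + 2) hn c x F hih with ⟨h0, e⟩ | ⟨h1, h2, e⟩ | ⟨h0, e⟩ | ⟨h0, e⟩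
    · rw [if_neg (by omega)] at e0
      rw [e, e0, hF₂ _ (by omega)]
      push_cast
      split_ifs <;> omega
    · rw [if_neg (by omega)] at e0
      rw [e, e0, hF₂ _ (by omega), hF₂ _ (by omega)]
      push_cast
      split_ifs <;> omega
    · rw [if_neg (by omega)] at e0
      rw [e, e0, hF₂ _ (by omega), hF₁ _ (by omega), hF₁ _ (by omega)]
      push_cast
      split_ifs <;> omega
    · rw [if_pos (by omega)] at e0
      rw [e, e0, hF₂ _ (by omega)]
      push_cast
      split_ifs <;> omega
  | E n hn hn' =>
    have key : ∀ c, (E n hn hn').coxeter = 2 * (c + 1) →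
        (E n hn hn').additiveSeq (c + 2) = (E n hn hn').additiveSeq c →
          (E n hn hn').additiveSeq (E n hn hn').coxeter = 0 := fun c hc h => by
      rw [hc]
      exact additiveSeq_reflect _ h
    obtain rfl | rfl | rfl : n = 6 ∨ n = 7 ∨ n = 8 := by omega
    · exact key 5 rfl (funext (additiveSeq_E6 hn hn'))
    · exact key 8 rfl (funext (additiveSeq_E7 hn hn'))
    · exact key 14 rfl (funext (additiveSeq_E8 hn hn'))

end Dynkin

/-! ### Quotients of `ℤΔ` -/

namespace StableTranslationQuiver

/-- There is a path of length `n` from `x` to `y`. -/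
def HasPath (Q : StableTranslationQuiver) (x : Q.V) : ℕ → Q.V → Prop
  | 0, y => x = y
  | n + 1, y => ∃ z, HasPath Q x n z ∧ Q.Arrow z y

variable {Q : StableTranslationQuiver} {G : Subgroup Q.Aut}

/-- The orbit of a vertex. -/
def orbit (G : Subgroup Q.Aut) (v : Q.V) : (Q.quotient G).V := Quotient.mk _ v

lemma exists_orbit_eq (x : (Q.quotient G).V) : ∃ v, orbit G v = x :=
  ⟨x.out, Quotient.out_eq x⟩

lemma orbit_eq_iff {v w : Q.V} : orbit G v = orbit G w ↔ ∃ g ∈ G, g.1 w = v := by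
  refine Quotient.eq.trans ?_
  change (∃ g : G, g • w = v) ↔ _
  exact ⟨fun ⟨g, hg⟩ => ⟨g.1, g.2, hg⟩, fun ⟨g, h, hg⟩ => ⟨⟨g, h⟩, hg⟩⟩

lemma arrow_orbit {v w : Q.V} (h : Q.Arrow v w) :
    (Q.quotient G).Arrow (orbit G v) (orbit G w) := ⟨v, w, rfl, rfl, h⟩

lemma tau_orbit (v : Q.V) : (Q.quotient G).τ (orbit G v) = orbit G (Q.τ v) := rfl

lemma exists_arrow_of_arrow_orbit {v : Q.V} {y : (Q.quotient G).V}
    (h : (Q.quotient G).Arrow (orbit G v) y) : ∃ w, orbit G w = y ∧ Q.Arrow v w := by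
  obtain ⟨v', w, hv, rfl, h⟩ := h
  obtain ⟨g, hg, rfl⟩ := orbit_eq_iff.1 (show orbit G v' = orbit G v from hv)
  refine ⟨g⁻¹.1 w, orbit_eq_iff.2 ⟨g⁻¹, inv_mem hg, rfl⟩, (g.2.1 _ _).1 ?_⟩
  have : g.1 (g⁻¹.1 w) = w := g.1.apply_symm_apply w
  rwa [this]

lemma exists_arrow_of_arrow_orbit' {v : Q.V} {y : (Q.quotient G).V}
    (h : (Q.quotient G).Arrow y (orbit G v)) : ∃ w, orbit G w = y ∧ Q.Arrow w v := by
  obtain ⟨w, v', rfl, hv, h⟩ := h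
  obtain ⟨g, hg, rfl⟩ := orbit_eq_iff.1 (show orbit G v' = orbit G v from hv)
  refine ⟨g⁻¹.1 w, orbit_eq_iff.2 ⟨g⁻¹, inv_mem hg, rfl⟩, (g.2.1 _ _).1 ?_⟩
  have : g.1 (g⁻¹.1 w) = w := g.1.apply_symm_apply w
  rwa [this]

end StableTranslationQuiver

namespace Dynkin

open StableTranslationQuiver

variable {Δ : Dynkin} {G : Subgroup Δ.repetition.Aut}

lemma exists_level_of_hasPath {n : ℕ} {v : Δ.repetition.V} {y : (Δ.repetition.quotient G).V}
    (h : (Δ.repetition.quotient G).HasPath (orbit G v) n y) :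
    ∃ w, orbit G w = y ∧ Δ.level w = Δ.level v + n := by
  induction n generalizing y with
  | zero => exact ⟨v, h, by simp⟩
  | succ n ih =>
    obtain ⟨z, hz, hzy⟩ := h
    obtain ⟨w, rfl, hw⟩ := ih hz
    obtain ⟨w', rfl, hw'⟩ := exists_arrow_of_arrow_orbit hzy
    exact ⟨w', rfl, by rw [Δ.level_arrow hw', hw]; push_cast; ring⟩

lemma not_arrow_of_arrow {x y : Δ.Vertex} (h : Δ.Arrow x y) : ¬ Δ.Arrow y x := fun h' => by
  have h1 := Δ.numHeight_arrow h
  have h2 := Δ.numHeight_arrow h'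
  omega

/-- A path of length `n ≥ 2` that is parallel to an arrow is long: if both are lifted to `ℤΔ` with
the same source, their ends have different degrees, and they differ by a power of `φ`. -/
lemma IsLargeGenerator.le_of_hasPath {φ : Δ.repetition.Aut} (hφ : Δ.IsLargeGenerator φ)
    {n : ℕ} (hn : 2 ≤ n)
    {x y : (Δ.repetition.quotient (Subgroup.zpowers φ)).V}
    (hxy : (Δ.repetition.quotient (Subgroup.zpowers φ)).Arrow x y)
    (h : (Δ.repetition.quotient (Subgroup.zpowers φ)).HasPath x n y) : Δ.coxeter ≤ n + 1 := by
  obtain ⟨c, hc, hc', -⟩ := hφ.exists_shifts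
  obtain ⟨v, rfl⟩ := exists_orbit_eq x
  obtain ⟨w, rfl, hw⟩ := exists_level_of_hasPath h
  obtain ⟨w', hww', hw'⟩ := exists_arrow_of_arrow_orbit hxy
  obtain ⟨_, ⟨j, rfl⟩, rfl⟩ := orbit_eq_iff.1 hww'
  have h1 := Δ.level_arrow hw'
  have h2 := hc.zpow j w
  rw [h2, hw] at h1
  have h3 : (n : ℤ) - 1 = -(j * c) := by linarith
  have h4 : |j * c| = n - 1 := by
    rw [← abs_neg, ← h3, abs_of_nonneg (by omega)]
  rw [abs_mul] at h4
  have h5 : 1 ≤ |j| := Int.one_le_abs (by rintro rfl; simp at h4; omega)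
  have h6 : |c| ≤ |j| * |c| := le_mul_of_one_le_left (abs_nonneg c) h5
  omega

/-- Different arrows with the same source have ends in different orbits. -/
lemma IsLargeGenerator.eq_of_orbit_eq {φ : Δ.repetition.Aut} (hφ : Δ.IsLargeGenerator φ)
    {v w w' : Δ.repetition.V} (hw : Δ.repetition.Arrow v w)
    (hw' : Δ.repetition.Arrow v w')
    (h : orbit (Subgroup.zpowers φ) w = orbit (Subgroup.zpowers φ) w') : w = w' := by
  obtain ⟨c, hc, -, hc'⟩ := hφ.exists_shifts
  obtain ⟨_, ⟨j, rfl⟩, rfl⟩ := orbit_eq_iff.1 h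
  have h1 := hc.zpow j w'
  rw [Δ.level_arrow hw, Δ.level_arrow hw'] at h1
  have h2 : j * c = 0 := by linarith
  rcases mul_eq_zero.1 h2 with rfl | h0
  · rfl
  · rcases hw with ⟨-, h3⟩ | ⟨-, h3⟩ <;> exact absurd h3 (hc' h0 _ _)

lemma IsLargeGenerator.additiveSeq_orbit {φ : Δ.repetition.Aut} (hφ : Δ.IsLargeGenerator φ)
    [Fintype (Δ.repetition.quotient (Subgroup.zpowers φ)).V] (n : ℕ) (v : Δ.repetition.V) :
    (Δ.repetition.quotient (Subgroup.zpowers φ)).additiveSeq n (orbit _ v) =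
      Δ.additiveSeq n v.2 := by
  classical
  induction n using Nat.twoStepInduction generalizing v with
  | zero => rfl
  | one => rfl
  | more n ih1 ih2 =>
    have e1 : (Δ.repetition.quotient (Subgroup.zpowers φ)).additiveSeq (n + 2) (orbit _ v) =
        ∑ y, (if (Δ.repetition.quotient (Subgroup.zpowers φ)).Arrow (orbit _ v) y then
          (Δ.repetition.quotient (Subgroup.zpowers φ)).additiveSeq (n + 1) y else 0) -
        (Δ.repetition.quotient (Subgroup.zpowers φ)).additiveSeq n
          ((Δ.repetition.quotient (Subgroup.zpowers φ)).τ.symm (orbit _ v)) := by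
      rw [StableTranslationQuiver.additiveSeq]
    have e2 : Δ.additiveSeq (n + 2) v.2 =
        ∑ y, (if Δ.Adj v.2 y then Δ.additiveSeq (n + 1) y else 0) - Δ.additiveSeq n v.2 := rfl
    have e3 : (Δ.repetition.quotient (Subgroup.zpowers φ)).τ.symm (orbit _ v) =
        orbit _ ((v.1 + 1, v.2) : Δ.repetition.V) := by
      rw [Equiv.symm_apply_eq, tau_orbit]
      congr 1
      exact Prod.ext (by simp) rfl
    rw [e1, e2, e3, ih1]
    congr 1
    rw [← Finset.sum_filter, ← Finset.sum_filter]
    -- the successors of `v` correspond to the neighbours of its second component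
    let l : Δ.Vertex → Δ.repetition.V := fun x =>
      if Δ.Arrow v.2 x then (v.1, x) else (v.1 + 1, x)
    have hl2 : ∀ x, (l x).2 = x := fun x => by
      simp only [l]
      split_ifs <;> rfl
    have hl : ∀ x, Δ.Adj v.2 x → Δ.repetition.Arrow v (l x) := by
      intro x hx
      simp only [l]
      split_ifs with h
      · exact Or.inl ⟨rfl, h⟩
      · exact Or.inr ⟨by simp, hx.resolve_left h⟩
    have hl' : ∀ w, Δ.repetition.Arrow v w → Δ.Adj v.2 w.2 ∧ l w.2 = w := by
      rintro w (⟨h1, h2⟩ | ⟨h1, h2⟩)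
      · refine ⟨Or.inl h2, ?_⟩
        simp only [l, if_pos h2, h1]
      · refine ⟨Or.inr h2, ?_⟩
        simp only [l, if_neg (not_arrow_of_arrow h2), h1, sub_add_cancel]
    refine (Finset.sum_bij (fun x _ => orbit _ (l x)) ?_ ?_ ?_ ?_).symm
    · intro x hx
      simp only [Finset.mem_filter, Finset.mem_univ, true_and] at hx ⊢
      exact arrow_orbit (hl x hx)
    · intro x hx x' hx' h
      simp only [Finset.mem_filter, Finset.mem_univ, true_and] at hx hx'
      rw [← hl2 x, hφ.eq_of_orbit_eq (hl x hx) (hl x' hx') h, hl2]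
    · intro y hy
      simp only [Finset.mem_filter, Finset.mem_univ, true_and] at hy
      obtain ⟨w, rfl, hw⟩ := exists_arrow_of_arrow_orbit hy
      exact ⟨w.2, by simpa using (hl' w hw).1, by rw [(hl' w hw).2]⟩
    · intro x hx
      rw [ih2, hl2]

lemma IsLargeGenerator.additiveSeq_coxeter {φ : Δ.repetition.Aut} (hφ : Δ.IsLargeGenerator φ)
    [Fintype (Δ.repetition.quotient (Subgroup.zpowers φ)).V] :
    (Δ.repetition.quotient (Subgroup.zpowers φ)).additiveSeq Δ.coxeter = 0 := by
  funext x
  obtain ⟨v, rfl⟩ := exists_orbit_eq x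
  rw [hφ.additiveSeq_orbit, Dynkin.additiveSeq_coxeter]
  rfl

open Classical in
/-- A function on the arrows that changes its sign under `σ` and for which the sum over the arrows
ending at any fixed vertex vanishes is zero. Since `Δ` is a tree, its vertices can be removed one
after the other such that each of them has at most one remaining edge. -/
lemma eq_zero_of_sum_eq_zero [Fintype (Δ.repetition.quotient G).V]
    (e : (Δ.repetition.quotient G).V → (Δ.repetition.quotient G).V → ℤ)
    (hσ : ∀ y z, (Δ.repetition.quotient G).Arrow y z →
      e ((Δ.repetition.quotient G).τ z) y = -e y z)
    (hsum : ∀ z, ∑ y, (if (Δ.repetition.quotient G).Arrow y z then e y z else 0) = 0) {y z}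
    (hyz : (Δ.repetition.quotient G).Arrow y z) : e y z = 0 := by
  let ρ : Δ.repetition.V → ℕ := fun v => Δ.numRank (v.2.val + 1)
  have adj : ∀ {a b : Δ.repetition.V}, Δ.repetition.Arrow a b → Δ.Adj b.2 a.2 := by
    rintro a b (⟨-, h⟩ | ⟨-, h⟩)
    · exact Or.inr h
    · exact Or.inl h
  -- a predecessor with the same second component is the same
  have uniq : ∀ {a a' b : Δ.repetition.V}, Δ.repetition.Arrow a b → Δ.repetition.Arrow a' b →
      a.2 = a'.2 → a = a' := by
    rintro ⟨p, x⟩ ⟨p', x'⟩ ⟨q, y⟩ h h' hx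
    have hx : x = x' := hx
    subst hx
    rcases h with ⟨h1, h2⟩ | ⟨h1, h2⟩ <;> rcases h' with ⟨h3, h4⟩ | ⟨h3, h4⟩
    · exact Prod.ext (h1.trans h3.symm) rfl
    · exact absurd h4 (not_arrow_of_arrow h2)
    · exact absurd h4 (not_arrow_of_arrow h2)
    · exact Prod.ext (h1.trans h3.symm) rfl
  have key : ∀ (r : ℕ) (a b : Δ.repetition.V), Δ.repetition.Arrow a b → min (ρ a) (ρ b) = r →
      e (orbit G a) (orbit G b) = 0 := by
    intro r
    induction r using Nat.strong_induction_on with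
    | _ r ih =>
      have main : ∀ a b : Δ.repetition.V, Δ.repetition.Arrow a b → ρ b ≤ ρ a → ρ b = r →
          e (orbit G a) (orbit G b) = 0 := by
        intro a b hab hle hr
        rw [← hsum (orbit G b), Finset.sum_eq_single (orbit G a), if_pos (arrow_orbit hab)]
        · intro y _ hy
          split_ifs with h
          · obtain ⟨a', rfl, ha'⟩ := exists_arrow_of_arrow_orbit' h
            have hlt : ρ a' < ρ b := by
              by_contra hlt
              have : a = a' := uniq hab ha'
                (Δ.eq_of_numRank_le (adj hab) (adj ha') hle (not_lt.1 hlt))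
              exact hy (by rw [this])
            exact ih (ρ a') (by omega) a' b ha' (by omega)
          · rfl
        · simp
      intro a b hab hr
      rcases le_total (ρ b) (ρ a) with h | h
      · exact main a b hab h (by omega)
      · have hτ : ρ (Δ.repetition.τ b) = ρ b := rfl
        have := main (Δ.repetition.τ b) a ((Δ.repetition.arrow_τ b a).2 hab) (by omega) (by omega)
        rw [← tau_orbit, hσ _ _ (arrow_orbit hab)] at this
        omega
  obtain ⟨b, rfl⟩ := exists_orbit_eq z
  obtain ⟨a, rfl, hab⟩ := exists_arrow_of_arrow_orbit' hyz
  exact key _ a b hab rfl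

end Dynkin

/-! ### Normalization of the irreducible maps -/

/-- The multiplicative group of an algebraically closed field is divisible, so that it is an
injective abelian group. -/
lemma exists_additive_units_extension {k : Type*} [Field k] [IsAlgClosed k]
    {M N : Type*} [AddCommGroup M] [AddCommGroup N] (f : M →+ N) (hf : Function.Injective f)
    (g : M →+ Additive kˣ) : ∃ h : N →+ Additive kˣ, h.comp f = g := by
  let i : DivisibleBy (Additive kˣ) ℕ := divisibleByOfSMulRightSurj _ _ fun {n} hn x => by
    obtain ⟨z, hz⟩ := IsAlgClosed.exists_pow_nat_eq (x.toMul : k) (Nat.pos_of_ne_zero hn)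
    have hz0 : z ≠ 0 := by
      rintro rfl
      rw [zero_pow hn] at hz
      exact x.toMul.ne_zero hz.symm
    exact ⟨Additive.ofMul (Units.mk0 z hz0),
      congrArg Additive.ofMul (show Units.mk0 z hz0 ^ n = x.toMul from Units.ext hz)⟩
  let j : DivisibleBy (Additive kˣ) ℤ := AddGroup.divisibleByIntOfDivisibleByNat _
  exact (Module.Baer.of_divisible (Additive kˣ)).extension_property_addMonoidHom f hf g

/-- The arrows carry no nonzero integer-valued function that changes its sign under `σ` and whose
sum over the arrows ending at any fixed vertex vanishes. -/
def StableTranslationQuiver.NoCirculation (Q : StableTranslationQuiver) [Fintype Q.V] : Prop :=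
  open Classical in
  ∀ e : Q.V → Q.V → ℤ, (∀ y z, Q.Arrow y z → e (Q.τ z) y = -e y z) →
    (∀ z, ∑ y, (if Q.Arrow y z then e y z else 0) = 0) → ∀ y z, Q.Arrow y z → e y z = 0

/-- Scalars on the arrows can be changed by rescaling the arrows and the meshes. The conditions are
independent characters of a torus, and the group `kˣ` is divisible. -/
lemma StableTranslationQuiver.NoCirculation.exists_rescaling {k : Type*} [Field k] [IsAlgClosed k]
    {Q : StableTranslationQuiver} [Fintype Q.V] (hQ : Q.NoCirculation) (c : Q.V → Q.V → kˣ) :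
    ∃ (a : Q.V → Q.V → kˣ) (b : Q.V → kˣ),
      ∀ y z, Q.Arrow y z → a (Q.τ z) y * a y z = b z * c (Q.τ z) y := by
  classical
  let R := {p : Q.V × Q.V // Q.Arrow p.1 p.2}
  -- the inverse of `σ`
  let σ' : R → R := fun p => ⟨(p.1.2, Q.τ.symm p.1.1), (Q.arrow_τ _ _).1 (by
    rw [Equiv.apply_symm_apply]; exact p.2)⟩
  let σ : R → R := fun p => ⟨(Q.τ p.1.2, p.1.1), (Q.arrow_τ _ _).2 p.2⟩
  have hσ : ∀ p q, σ' p = q ↔ p = σ q := by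
    rintro ⟨⟨x, y⟩, h⟩ ⟨⟨x', y'⟩, h'⟩
    refine (Subtype.ext_iff.trans Prod.ext_iff).trans
      (Iff.trans ?_ (Subtype.ext_iff.trans Prod.ext_iff).symm)
    change y = x' ∧ Q.τ.symm x = y' ↔ x = Q.τ y' ∧ y = x'
    rw [Equiv.symm_apply_eq]
    tauto
  let f : (R → ℤ) →+ (R → ℤ) × (Q.V → ℤ) :=
    { toFun := fun n => (fun p => n p + n (σ' p), fun z => ∑ p : R, if p.1.2 = z then n p else 0)
      map_zero' := by ext <;> simp
      map_add' := fun n n' => by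
        ext
        · simp only [Pi.add_apply, Prod.mk_add_mk]; ring
        · simp only [Pi.add_apply, Prod.mk_add_mk, ← Finset.sum_add_distrib]
          exact Finset.sum_congr rfl fun p _ => by split_ifs <;> simp }
  have hf : Function.Injective f := by
    rw [injective_iff_map_eq_zero]
    intro n hn
    let e : Q.V → Q.V → ℤ := fun y z => if h : Q.Arrow y z then n ⟨(y, z), h⟩ else 0
    have he : ∀ p : R, e p.1.1 p.1.2 = n p := fun p => dif_pos p.2
    have h1 : ∀ p, n p + n (σ' p) = 0 := fun p => congrFun (congrArg Prod.fst hn) p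
    have h2 : ∀ z, ∑ p : R, (if p.1.2 = z then n p else 0) = 0 :=
      fun z => congrFun (congrArg Prod.snd hn) z
    have h3 := hQ e (fun y z h => by
        have h4 := h1 (σ ⟨(y, z), h⟩)
        rw [(hσ _ _).2 rfl, ← he, ← he] at h4
        exact eq_neg_of_add_eq_zero_left h4) (fun z => by
      refine (Finset.sum_filter _ _).symm.trans
        (Eq.trans ?_ ((Finset.sum_filter _ _).trans (h2 z)))
      refine Finset.sum_bij' (fun y hy => ⟨(y, z), (Finset.mem_filter.1 hy).2⟩)
        (fun p _ => p.1.1) ?_ ?_ ?_ ?_ ?_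
      · intro y hy; simp
      · rintro ⟨⟨y, z'⟩, h⟩ hp
        obtain rfl : z' = z := by simpa using hp
        simpa using h
      · intro y hy; rfl
      · rintro ⟨⟨y, z'⟩, h⟩ hp
        obtain rfl : z' = z := by simpa using hp
        rfl
      · intro y hy
        exact he ⟨(y, z), (Finset.mem_filter.1 hy).2⟩)
    funext p
    rw [← he]
    exact h3 _ _ p.2
  -- `f` is the map of character groups, dual to the action of the scalars `a` and `b`
  let g : (R → ℤ) →+ Additive kˣ :=
    { toFun := fun n => ∑ p : R, n p • Additive.ofMul (c (σ p).1.1 (σ p).1.2)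
      map_zero' := by simp
      map_add' := fun n n' => by
        rw [← Finset.sum_add_distrib]
        exact Finset.sum_congr rfl fun p _ => add_zsmul _ _ _ }
  obtain ⟨χ, hχ⟩ := exists_additive_units_extension f hf g
  refine ⟨fun y z => if h : Q.Arrow y z then (χ (Pi.single ⟨(y, z), h⟩ 1, 0)).toMul else 1,
    fun z => (χ (0, Pi.single z (-1))).toMul, fun y z h => ?_⟩
  have h' : Q.Arrow (Q.τ z) y := (Q.arrow_τ z y).2 h
  simp only [h, h', dif_pos]
  have h1 : f (Pi.single ⟨(y, z), h⟩ 1) = (Pi.single ⟨(y, z), h⟩ 1, 0) +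
      (Pi.single ⟨(Q.τ z, y), h'⟩ 1, 0) - (0, Pi.single z (-1)) := by
    refine Prod.ext ?_ ?_
    · funext p
      simp only [f, AddMonoidHom.coe_mk, ZeroHom.coe_mk, Prod.fst_sub, Prod.fst_add, sub_zero,
        Pi.add_apply, Pi.single_apply, hσ]
      rfl
    · funext w
      simp only [f, AddMonoidHom.coe_mk, ZeroHom.coe_mk, Prod.snd_sub, Prod.snd_add, add_zero,
        zero_sub, Pi.neg_apply, Pi.single_apply]
      rw [Finset.sum_eq_single ⟨(y, z), h⟩ (fun p _ hp => by rw [if_neg hp, ite_self]) (by simp)]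
      by_cases hw : w = z
      · simp [hw]
      · simp [hw, Ne.symm hw]
  have h2 : χ (f (Pi.single ⟨(y, z), h⟩ 1)) = g (Pi.single ⟨(y, z), h⟩ 1) :=
    DFunLike.congr_fun hχ _
  have h3 : g (Pi.single ⟨(y, z), h⟩ 1) = Additive.ofMul (c (Q.τ z) y) := by
    simp only [g, AddMonoidHom.coe_mk, ZeroHom.coe_mk]
    rw [Finset.sum_eq_single ⟨(y, z), h⟩ (fun p _ hp => by rw [Pi.single_eq_of_ne hp, zero_smul])
      (by simp), Pi.single_eq_same, one_smul]
  rw [h1, h3, map_sub, map_add, sub_eq_iff_eq_add] at h2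
  have h4 := congrArg Additive.toMul h2
  rw [toMul_add, toMul_add, toMul_ofMul] at h4
  rw [mul_comm, h4, mul_comm]

namespace ARSystem

variable {k : Type*} [Field k] {T : Type*} [Category T] [Preadditive T] [HasZeroObject T]
  [HasShift T ℤ] [∀ n : ℤ, (shiftFunctor T n).Additive] [Pretriangulated T] [Linear k T]
  {Q : StableTranslationQuiver} {A : ARSystem k T Q} {s : ℤ → A.IrrFamily}

lemma pathSpan_eq_bot_of_not_hasPath (l : ℤ) {n : ℕ} {x y : Q.V} (h : ¬ Q.HasPath x n y) :
    pathSpan s l x n y = ⊥ := by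
  induction n generalizing y with
  | zero => exact pathSpan_zero_of_ne h
  | succ n ih =>
    refine eq_bot_iff.2 (pathSpan_succ_le fun z f hf => ?_)
    by_cases hzy : Q.Arrow z y
    · rw [ih fun hz => h ⟨z, hz, hzy⟩, Submodule.mem_bot] at hf
      rw [hf, zero_comp]
      exact zero_mem _
    · rw [(s (l + n)).map_eq_zero z y hzy, comp_zero]
      exact zero_mem _

lemma pathSpan_eq_bot_of_le {l : ℤ} {m n : ℕ} (hmn : m ≤ n) {x : Q.V}
    (h : ∀ y, pathSpan s l x m y = ⊥) (y : Q.V) : pathSpan s l x n y = ⊥ := by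
  induction n, hmn using Nat.le_induction generalizing y with
  | base => exact h y
  | succ n _ ih =>
    refine eq_bot_iff.2 (pathSpan_succ_le fun z f hf => ?_)
    rw [ih, Submodule.mem_bot] at hf
    rw [hf, zero_comp]
    exact zero_mem _

variable [Fintype Q.V] [IsIdempotentComplete T] [∀ X Y : T, Module.Finite k (X ⟶ Y)]
  [IsAlgClosed k]

/-- If all paths of length at least two that are parallel to the arrow `x → y` vanish, then the
square of the radical vanishes there. -/
lemma radSq_eq_bot_of_arrow (s : ℤ → A.IrrFamily) {x y : Q.V} (hxy : Q.Arrow x y)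
    (h : ∀ n, 2 ≤ n → pathSpan s 0 x n y = ⊥) : homRadicalSq k (A.M x) (A.M y) = ⊥ := by
  rw [eq_bot_iff]
  intro f hf
  obtain ⟨N, hN⟩ := A.exists_radPow_eq_bot
  have hN' : ∀ x y, A.radPow x (N + 2) y = ⊥ := radPow_add_eq_bot hN 2
  obtain ⟨g, hg, hgf⟩ := exists_sum_pathSpan_left s hN' 0 f
  have hg2 : ∑ i ∈ Finset.range N, g (i + 1 + 1) = 0 := Finset.sum_eq_zero fun i _ => by
    have := hg (i + 2)
    rwa [h _ (by omega), Submodule.mem_bot] at this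
  rw [Finset.sum_range_succ', Finset.sum_range_succ', hg2, zero_add, zero_add] at hgf
  have hg0 : g 0 = 0 := by
    refine eq_zero_of_mem_pathSpan_zero (hg 0) ?_
    rw [eq_sub_of_add_eq' hgf]
    exact sub_mem (homRadicalSq_le hf) (mem_rad_of_mem_pathSpan_succ (hg 1))
  rw [hg0, add_zero] at hgf
  obtain ⟨p, hp, hpg⟩ := exists_sum_right (m := 0) (by simp) (hg 1)
  obtain ⟨c, hc⟩ := exists_of_mem_pathSpan_zero (hp x)
  have hfc : f = c • (s 0).map x y := by
    rw [← hgf, ← hpg, Finset.sum_eq_single x _ (by simp), hc, Linear.smul_comp, Category.id_comp]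
    intro z _ hz
    have := hp z
    rw [pathSpan_zero_of_ne hz.symm, Submodule.mem_bot] at this
    rw [this, zero_comp]
  by_cases hc0 : c = 0
  · rw [hfc, hc0, zero_smul]; exact zero_mem _
  · exfalso
    apply ((s 0).isIrr x y hxy).2
    have := Submodule.smul_mem _ c⁻¹ hf
    rwa [hfc, smul_smul, inv_mul_cancel₀ hc0, one_smul] at this

/-- If the square of the radical vanishes between the ends of every arrow, then irreducible maps
can be chosen such that the composites of maps of one single family satisfy the mesh relations. -/
lemma exists_isMesh_self (hQ : Q.NoCirculation)
    (hsq : ∀ x y, Q.Arrow x y → homRadicalSq k (A.M x) (A.M y) = ⊥) :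
    ∃ t : A.IrrFamily, IsMesh t t := by
  classical
  obtain ⟨s⟩ := A.nonempty_irrFamily
  obtain ⟨s', hs'⟩ := exists_isMesh_left s
  have hc : ∀ x y, ∃ c : kˣ, s'.map x y = (c : k) • s.map x y := by
    intro x y
    by_cases hxy : Q.Arrow x y
    · obtain ⟨c, hc⟩ := (s.isIrr x y hxy).exists_smul_sub_mem A hxy (s'.map_mem_rad x y)
      rw [hsq x y hxy, Submodule.mem_bot, sub_eq_zero] at hc
      refine ⟨Units.mk0 c fun h0 => (s'.isIrr x y hxy).2 ?_, hc⟩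
      rw [hc, h0, zero_smul]
      exact zero_mem _
    · exact ⟨1, by rw [s.map_eq_zero x y hxy, s'.map_eq_zero x y hxy, smul_zero]⟩
  -- the mesh relations hold with `s'` in the first place and `s` in the second; along every arrow
  -- the two families are proportional, and a rescaling of `s` removes the difference
  choose c hc using hc
  obtain ⟨a, b, hab⟩ := hQ.exists_rescaling c
  have hab' : ∀ y z, Q.Arrow y z → (a (Q.τ z) y : k) * a y z = b z * c (Q.τ z) y :=
    fun y z h => by exact_mod_cast congrArg Units.val (hab y z h)
  have hs0 : ∀ y z, ¬ Q.Arrow y z → s.map (Q.τ z) y = 0 ∧ s.map y z = 0 := fun y z h =>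
    ⟨s.map_eq_zero _ _ fun h' => h ((Q.arrow_τ z y).1 h'), s.map_eq_zero _ _ h⟩
  let t : A.IrrFamily :=
    { map := fun x y => (a x y : k) • s.map x y
      isIrr := fun x y h => ⟨Submodule.smul_mem _ _ (s.isIrr x y h).1, fun h' =>
        (s.isIrr x y h).2 (by
          have := Submodule.smul_mem _ ((a x y)⁻¹ : kˣ).val h'
          rwa [smul_smul, Units.inv_mul, one_smul] at this)⟩
      map_eq_zero := fun x y h => by rw [s.map_eq_zero x y h, smul_zero] }
  refine ⟨t, fun z => ?_, fun {w z} p hp => ?_, fun {w z} q hq => ?_⟩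
  · have h1 : ∀ y, t.map (Q.τ z) y ≫ t.map y z = (b z : k) • s'.map (Q.τ z) y ≫ s.map y z := by
      intro y
      by_cases h : Q.Arrow y z
      · simp only [t, hc, Linear.smul_comp, Linear.comp_smul, smul_smul]
        rw [mul_comm, hab' y z h]
      · simp only [t, (hs0 y z h).2, smul_zero, comp_zero]
    simp only [h1, ← Finset.smul_sum, hs'.comp_eq_zero, smul_zero]
  · obtain ⟨h, hh⟩ := hs'.lift (fun y => (a y z : k) • p y) (z := z) (by
      simpa only [t, Linear.smul_comp, Linear.comp_smul] using hp)
    refine ⟨((b z)⁻¹ : kˣ).val • h, fun y hy => ?_⟩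
    have h1 := hh y hy
    rw [hc] at h1
    have h2 : (a y z : k) • p y = (a y z : k) • ((((b z)⁻¹ : kˣ).val • h) ≫ t.map (Q.τ z) y) := by
      rw [h1]
      simp only [t, Linear.smul_comp, Linear.comp_smul, smul_smul, Units.val_inv_eq_inv_val]
      congr 1
      have := hab' y z hy
      field_simp
      linear_combination -this
    exact (smul_right_injective _ (a y z).ne_zero) h2
  · obtain ⟨h, hh⟩ := hs'.desc (fun y => ((a (Q.τ z) y : k) * ((c (Q.τ z) y)⁻¹ : kˣ).val) • q y)
      (z := z) (by
        rw [← hq]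
        refine Finset.sum_congr rfl fun y _ => ?_
        simp only [t, hc, Linear.smul_comp, Linear.comp_smul, smul_smul]
        congr 1
        rw [mul_assoc, Units.inv_mul, mul_one])
    refine ⟨((b z)⁻¹ : kˣ).val • h, fun y hy => ?_⟩
    have h1 := hh y hy
    have h2 : ((a (Q.τ z) y : k) * ((c (Q.τ z) y)⁻¹ : kˣ).val) • q y =
        ((a (Q.τ z) y : k) * ((c (Q.τ z) y)⁻¹ : kˣ).val) •
          (t.map y z ≫ (((b z)⁻¹ : kˣ).val • h)) := by
      rw [h1]
      simp only [t, Linear.smul_comp, Linear.comp_smul, smul_smul, Units.val_inv_eq_inv_val]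
      conv_lhs => rw [← one_smul k (s.map y z ≫ h)]
      congr 1
      have := hab' y z hy
      field_simp
      linear_combination -this
    exact (smul_right_injective _ (mul_ne_zero (Units.ne_zero _) (Units.ne_zero _))) h2

end ARSystem

/-! ### The mesh category -/

section Free

variable (k : Type*) [Field k] {C : Type*} [Category C]

lemma mem_span_embedding {X Y : C} (f : (Free.embedding k C).obj X ⟶ (Free.embedding k C).obj Y) :
    f ∈ Submodule.span k (Set.range fun p : X ⟶ Y => (Free.embedding k C).map p) := by
  induction f using Finsupp.induction_linear with
  | zero => exact zero_mem _
  | add f g hf hg => exact add_mem hf hg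
  | single p r =>
    have h := Submodule.smul_mem _ r (Submodule.subset_span
      (s := Set.range fun p : X ⟶ Y => (Free.embedding k C).map p) ⟨p, rfl⟩)
    exact (congrArg (· ∈ Submodule.span k (Set.range fun p : X ⟶ Y => (Free.embedding k C).map p))
      (Finsupp.smul_single_one p r)).mp h

variable {D : Type*} [Category D] [Preadditive D] [Linear k D] (F : C ⥤ D)

/-- The linear extension of a functor on the morphisms from `X` to `Y`. -/
noncomputable def freeLiftMap (X Y : C) :
    ((Free.embedding k C).obj X ⟶ (Free.embedding k C).obj Y) →ₗ[k] (F.obj X ⟶ F.obj Y) :=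
  Finsupp.linearCombination k fun p : X ⟶ Y => F.map p

lemma freeLiftMap_embedding {X Y : C} (p : X ⟶ Y) :
    freeLiftMap k F X Y ((Free.embedding k C).map p) = F.map p :=
  (Finsupp.linearCombination_single k 1 p).trans (one_smul k _)

lemma freeLiftMap_comp {X Y Z : C} (f : (Free.embedding k C).obj X ⟶ (Free.embedding k C).obj Y)
    (g : (Free.embedding k C).obj Y ⟶ (Free.embedding k C).obj Z) :
    freeLiftMap k F X Z (f ≫ g) = freeLiftMap k F X Y f ≫ freeLiftMap k F Y Z g := by
  induction mem_span_embedding k f using Submodule.span_induction with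
  | mem f hf =>
    obtain ⟨p, rfl⟩ := hf
    induction mem_span_embedding k g using Submodule.span_induction with
    | mem g hg =>
      obtain ⟨q, rfl⟩ := hg
      rw [← Functor.map_comp, freeLiftMap_embedding, freeLiftMap_embedding, freeLiftMap_embedding,
        F.map_comp]
    | zero => rw [comp_zero, map_zero, map_zero, comp_zero]
    | add g g' _ _ h h' => rw [Preadditive.comp_add, map_add, map_add, Preadditive.comp_add, h, h']
    | smul c g _ h => rw [Linear.comp_smul, map_smul, map_smul, Linear.comp_smul, h]
  | zero => rw [zero_comp, map_zero, map_zero, zero_comp]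
  | add g g' _ _ h h' => rw [Preadditive.add_comp, map_add, map_add, Preadditive.add_comp, h, h']
  | smul c g _ h => rw [Linear.smul_comp, map_smul, map_smul, Linear.smul_comp, h]

/-- The extension of a functor to the `k`-linear completion. The Hom-sets of the two categories may
live in different universes, unlike in `CategoryTheory.Free.lift`. -/
noncomputable def freeLift : Free k C ⥤ D where
  obj X := F.obj X
  map {X Y} f := freeLiftMap k F X Y f
  map_id X := (freeLiftMap_embedding k F (𝟙 (show C from X))).trans (F.map_id _)
  map_comp f g := freeLiftMap_comp k F f g

instance : (freeLift k F).Additive where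
  map_add {X Y} f g := (freeLiftMap k F X Y).map_add f g

instance : (freeLift k F).Linear k where
  map_smul {X Y} f c := (freeLiftMap k F X Y).map_smul c f

end Free

namespace StableTranslationQuiver

variable (Q : StableTranslationQuiver) (k : Type*) [Field k]

/-- The span of the paths of length `n` from `x` to `y` in the path category. -/
noncomputable def pathDeg (x : Q.V) :
    ℕ → ∀ y : Q.V, Submodule k (Q.pathObj k x ⟶ Q.pathObj k y)
  | 0, y => Submodule.span k {f | ∃ h : x = y, f = eqToHom (congrArg (Q.pathObj k) h)}
  | n + 1, y => ⨆ z : {z // Q.Arrow z y},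
      (pathDeg x n z.1).map (Linear.rightComp k (Q.pathObj k x) (Q.pathArrow k z.2))

variable {Q k}

lemma comp_pathArrow_mem {x y z : Q.V} {n : ℕ} {f : Q.pathObj k x ⟶ Q.pathObj k z}
    (hf : f ∈ Q.pathDeg k x n z) (h : Q.Arrow z y) :
    f ≫ Q.pathArrow k h ∈ Q.pathDeg k x (n + 1) y :=
  Submodule.mem_iSup_of_mem (⟨z, h⟩ : {z // Q.Arrow z y}) ⟨f, hf, rfl⟩

lemma id_mem_pathDeg (x : Q.V) : 𝟙 (Q.pathObj k x) ∈ Q.pathDeg k x 0 x :=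
  Submodule.subset_span ⟨rfl, rfl⟩

lemma exists_of_mem_pathDeg_zero {x y : Q.V} {f : Q.pathObj k x ⟶ Q.pathObj k y}
    (hf : f ∈ Q.pathDeg k x 0 y) :
    f = 0 ∨ ∃ (h : x = y) (c : k), f = c • eqToHom (congrArg (Q.pathObj k) h) := by
  by_cases h : x = y
  · right
    have h' : {f | ∃ h : x = y, f = eqToHom (congrArg (Q.pathObj k) h)} =
        {eqToHom (congrArg (Q.pathObj k) h)} := by
      ext g
      simp [h]
    rw [pathDeg, h', Submodule.mem_span_singleton] at hf
    obtain ⟨c, rfl⟩ := hf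
    exact ⟨h, c, rfl⟩
  · left
    have h' : {f | ∃ h : x = y, f = eqToHom (congrArg (Q.pathObj k) h)} = ∅ := by
      ext g
      simp [h]
    rwa [pathDeg, h', Submodule.span_empty, Submodule.mem_bot] at hf

lemma exists_of_mem_pathDeg_succ {x y : Q.V} [Fintype {z // Q.Arrow z y}] {n : ℕ}
    {f : Q.pathObj k x ⟶ Q.pathObj k y} (hf : f ∈ Q.pathDeg k x (n + 1) y) :
    ∃ p : ∀ z : {z // Q.Arrow z y}, Q.pathObj k x ⟶ Q.pathObj k z.1,
      (∀ z, p z ∈ Q.pathDeg k x n z.1) ∧ f = ∑ z, p z ≫ Q.pathArrow k z.2 := by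
  rw [pathDeg, Submodule.mem_iSup_iff_exists_finsupp] at hf
  obtain ⟨g, hg, rfl⟩ := hf
  choose p hp hp' using hg
  refine ⟨p, hp, ?_⟩
  rw [Finsupp.sum_fintype _ _ (fun _ => rfl)]
  exact Finset.sum_congr rfl fun z _ => (hp' z).symm

lemma path_mem_pathDeg {x y : Q.V} (p : Quiver.Path x y) :
    (show Q.pathObj k x ⟶ Q.pathObj k y from (Free.embedding k (Paths Q.V)).map p) ∈
      Q.pathDeg k x p.length y := by
  induction p with
  | nil => exact id_mem_pathDeg x
  | cons p a ih =>
    have h := (Free.embedding k (Paths Q.V)).map_comp p ((Paths.of Q.V).map a)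
    exact (congrArg (· ∈ Q.pathDeg k x (p.length + 1) _) h).mpr (comp_pathArrow_mem ih a.down)

/-- Every morphism of the path category is a sum of homogeneous ones. -/
lemma exists_sum_pathDeg {x y : Q.V} (f : Q.pathObj k x ⟶ Q.pathObj k y) :
    ∃ (N : ℕ) (g : ℕ → (Q.pathObj k x ⟶ Q.pathObj k y)),
      (∀ n, g n ∈ Q.pathDeg k x n y) ∧ ∀ M, N ≤ M → ∑ n ∈ Finset.range M, g n = f := by
  have hf : f ∈ ⨆ n, Q.pathDeg k x n y := by
    refine Submodule.span_le.2 ?_ (mem_span_embedding k (C := Paths Q.V) f)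
    rintro _ ⟨p, rfl⟩
    exact Submodule.mem_iSup_of_mem (p := fun n => Q.pathDeg k x n y) _ (path_mem_pathDeg p)
  rw [Submodule.mem_iSup_iff_exists_finsupp] at hf
  obtain ⟨g, hg, rfl⟩ := hf
  refine ⟨g.support.sup id + 1, g, hg, fun M hM => ?_⟩
  rw [Finsupp.sum_of_support_subset g ((Finset.subset_range_sup_succ _).trans
    (Finset.range_subset_range.2 hM)) _ (fun _ _ => rfl)]

end StableTranslationQuiver

namespace ARSystem

variable {k : Type*} [Field k] {T : Type*} [Category T] [Preadditive T] [HasZeroObject T]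
  [HasShift T ℤ] [∀ n : ℤ, (shiftFunctor T n).Additive] [Pretriangulated T] [Linear k T]
  {Q : StableTranslationQuiver} {A : ARSystem k T Q}

namespace IrrFamily

/-- The functor from the path category that is given by the maps of the family. -/
noncomputable def pathFunctor (t : A.IrrFamily) : Q.PathCat k ⥤ T :=
  freeLift k (Paths.lift { obj := A.M, map := fun {x y} _ => t.map x y })

instance (t : A.IrrFamily) : t.pathFunctor.Additive := by
  unfold pathFunctor; infer_instance

instance (t : A.IrrFamily) : t.pathFunctor.Linear k := by
  unfold pathFunctor; infer_instance

/-- The functor `IrrFamily.pathFunctor` on morphisms. -/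
noncomputable def ev (t : A.IrrFamily) (x y : Q.V) :
    (Q.pathObj k x ⟶ Q.pathObj k y) →ₗ[k] (A.M x ⟶ A.M y) :=
  t.pathFunctor.mapLinearMap k

variable (t : A.IrrFamily)

lemma ev_comp {x y z : Q.V} (f : Q.pathObj k x ⟶ Q.pathObj k y)
    (g : Q.pathObj k y ⟶ Q.pathObj k z) : t.ev x z (f ≫ g) = t.ev x y f ≫ t.ev y z g :=
  t.pathFunctor.map_comp f g

lemma ev_id (x : Q.V) : t.ev x x (𝟙 _) = 𝟙 _ := t.pathFunctor.map_id _

lemma ev_pathArrow {x y : Q.V} (h : Q.Arrow x y) : t.ev x y (Q.pathArrow k h) = t.map x y := by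
  exact (freeLiftMap_embedding k (Paths.lift { obj := A.M, map := fun {x y} _ => t.map x y })
    ((Paths.of Q.V).map (PLift.up h))).trans (Paths.lift_toPath _ _)

lemma ev_mem_pathSpan (l : ℤ) {x y : Q.V} {n : ℕ} {f : Q.pathObj k x ⟶ Q.pathObj k y}
    (hf : f ∈ Q.pathDeg k x n y) : t.ev x y f ∈ pathSpan (fun _ => t) l x n y := by
  induction n generalizing y with
  | zero =>
    rcases StableTranslationQuiver.exists_of_mem_pathDeg_zero hf with rfl | ⟨rfl, c, rfl⟩
    · rw [map_zero]; exact zero_mem _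
    · rw [map_smul, eqToHom_refl, ev_id]
      exact Submodule.smul_mem _ _ (id_mem_pathSpan l x)
  | succ n ih =>
    have : Fintype {z // Q.Arrow z y} := (Q.finite_pred y).fintype
    obtain ⟨p, hp, rfl⟩ := StableTranslationQuiver.exists_of_mem_pathDeg_succ hf
    rw [map_sum]
    refine sum_mem fun z _ => ?_
    rw [ev_comp, ev_pathArrow]
    exact comp_map_mem_pathSpan (s := fun _ => t) rfl (ih (hp z)) y

lemma exists_ev_eq {l : ℤ} {x y : Q.V} {n : ℕ} {f : A.M x ⟶ A.M y}
    (hf : f ∈ pathSpan (fun _ => t) l x n y) : ∃ p ∈ Q.pathDeg k x n y, t.ev x y p = f := by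
  suffices H : pathSpan (fun _ => t) l x n y ≤ (Q.pathDeg k x n y).map (t.ev x y) from H hf
  clear hf f
  induction n generalizing y with
  | zero =>
    refine Submodule.span_le.2 ?_
    rintro _ ⟨rfl, rfl⟩
    exact ⟨𝟙 _, StableTranslationQuiver.id_mem_pathDeg x, t.ev_id x⟩
  | succ n ih =>
    refine pathSpan_succ_le fun z f hf => ?_
    obtain ⟨p, hp, rfl⟩ := ih hf
    by_cases h : Q.Arrow z y
    · exact ⟨_, StableTranslationQuiver.comp_pathArrow_mem hp h, by rw [ev_comp, ev_pathArrow]⟩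
    · rw [t.map_eq_zero z y h, comp_zero]
      exact zero_mem _

variable {t} [Fintype Q.V]

lemma _root_.ARSystem.IsMesh.ev_mesh (ht : IsMesh t t) (x : Q.V) :
    t.ev _ _ (Q.mesh k x) = 0 := by
  classical
  rw [StableTranslationQuiver.mesh, finsum_eq_sum_of_fintype, map_sum, ← ht.comp_eq_zero x,
    Q.sum_arrow (y := x) _ fun z hz => by rw [t.map_eq_zero z x hz, comp_zero]]
  exact Finset.sum_congr rfl fun y _ => by rw [ev_comp, ev_pathArrow, ev_pathArrow]

lemma _root_.ARSystem.IsMesh.ev_eq_zero (ht : IsMesh t t) {x y : Q.V}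
    {f : Q.pathObj k x ⟶ Q.pathObj k y} (hf : f ∈ Q.meshIdeal k _ _) : t.ev x y f = 0 := by
  suffices H : Q.meshIdeal k _ _ ≤ LinearMap.ker (t.ev x y) from H hf
  refine Submodule.span_le.2 ?_
  rintro _ ⟨z, p, q, rfl⟩
  change t.ev x y (p ≫ Q.mesh k z ≫ q) = 0
  rw [ev_comp, ev_comp, ht.ev_mesh, zero_comp, comp_zero]

variable [IsIdempotentComplete T] [∀ X Y : T, Module.Finite k (X ⟶ Y)] [IsAlgClosed k]

lemma ev_surjective (t : A.IrrFamily) (x y : Q.V) : Function.Surjective (t.ev x y) := by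
  intro f
  obtain ⟨N, hN⟩ := A.exists_radPow_eq_bot
  obtain ⟨g, hg, rfl⟩ := exists_sum_pathSpan_left (fun _ => t) hN 0 f
  choose p _ hp using fun i => t.exists_ev_eq (hg i)
  exact ⟨∑ i ∈ Finset.range N, p i, by rw [map_sum]; exact Finset.sum_congr rfl fun i _ => hp i⟩

/-- Homogeneous relations between paths are consequences of the mesh relations, because of the
exactness at the meshes. -/
lemma _root_.ARSystem.IsMesh.mem_meshIdeal_of_mem_pathDeg (ht : IsMesh t t) {x y : Q.V} {n : ℕ}
    {f : Q.pathObj k x ⟶ Q.pathObj k y} (hf : f ∈ Q.pathDeg k x n y) (h0 : t.ev x y f = 0) :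
    f ∈ Q.meshIdeal k _ _ := by
  classical
  induction n generalizing y with
  | zero =>
    rcases StableTranslationQuiver.exists_of_mem_pathDeg_zero hf with rfl | ⟨rfl, c, rfl⟩
    · exact zero_mem _
    · rw [map_smul, eqToHom_refl, ev_id] at h0
      obtain rfl := (smul_eq_zero.1 h0).resolve_right (A.indec x).id_ne_zero
      rw [zero_smul]
      exact zero_mem _
  | succ n ih =>
    obtain ⟨p, hp, rfl⟩ := StableTranslationQuiver.exists_of_mem_pathDeg_succ hf
    let p' : ∀ z, A.M x ⟶ A.M z := fun z => if h : Q.Arrow z y then t.ev x z (p ⟨z, h⟩) else 0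
    have hp' : ∀ z : {z // Q.Arrow z y}, p' z.1 = t.ev x z (p z) := fun z => dif_pos z.2
    obtain ⟨h, hh, hhp⟩ := exists_mem_predSpan (s := fun _ => t) (l := 0) (n := n) (y := y)
      (fun _ => ht) p' (fun z => by
        by_cases hz : Q.Arrow z y
        · rw [hp' ⟨z, hz⟩]; exact t.ev_mem_pathSpan 0 (hp ⟨z, hz⟩)
        · simp [p', hz]) (by
      rw [Q.sum_arrow (y := y) _ fun z hz => by rw [t.map_eq_zero z y hz, comp_zero], ← h0, map_sum]
      exact Finset.sum_congr rfl fun z _ => by rw [ev_comp, ev_pathArrow, hp'])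
    obtain ⟨q, rfl, hq⟩ : ∃ q : Q.pathObj k x ⟶ Q.pathObj k (Q.τ y), t.ev _ _ q = h ∧
        ∀ z (hz : Q.Arrow (Q.τ y) z), q ≫ Q.pathArrow k hz ∈ Q.pathDeg k x n z := by
      cases n with
      | zero =>
        rw [predSpan, Submodule.mem_bot] at hh
        exact ⟨0, by rw [hh, map_zero], fun z hz => by rw [zero_comp]; exact zero_mem _⟩
      | succ n =>
        obtain ⟨q, hq, rfl⟩ := t.exists_ev_eq hh
        exact ⟨q, rfl, fun z hz => StableTranslationQuiver.comp_pathArrow_mem hq hz⟩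
    have h1 : ∑ z, p z ≫ Q.pathArrow k z.2 =
        ∑ z, (p z - q ≫ Q.pathArrow k ((Q.arrow_τ y z.1).2 z.2)) ≫ Q.pathArrow k z.2 +
          q ≫ Q.mesh k y := by
      rw [StableTranslationQuiver.mesh, finsum_eq_sum_of_fintype, Preadditive.comp_sum,
        ← Finset.sum_add_distrib]
      exact Finset.sum_congr rfl fun z _ => by
        rw [Preadditive.sub_comp, Category.assoc, sub_add_cancel]
    rw [h1]
    refine add_mem (sum_mem fun z _ => Q.meshIdeal_comp_right k _ (ih (sub_mem (hp z) (hq _ _)) ?_))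
      (Q.meshIdeal_comp_left k q (Submodule.subset_span ⟨y, 𝟙 _, 𝟙 _, by simp⟩))
    rw [map_sub, ev_comp, ev_pathArrow, ← hp', hhp z.1 z.2, sub_self]

lemma _root_.ARSystem.IsMesh.mem_meshIdeal (ht : IsMesh t t) {x y : Q.V}
    {f : Q.pathObj k x ⟶ Q.pathObj k y} (h0 : t.ev x y f = 0) : f ∈ Q.meshIdeal k _ _ := by
  obtain ⟨N, hN⟩ := A.exists_radPow_eq_bot
  obtain ⟨n, g, hg, hgf⟩ := StableTranslationQuiver.exists_sum_pathDeg f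
  have hf := hgf (N + n) (by omega)
  rw [← hf]
  refine sum_mem fun i hi => ht.mem_meshIdeal_of_mem_pathDeg (hg i) ?_
  refine pathSpan_independent_left (s := fun _ => t) (fun _ => ht) (radPow_add_eq_bot hN n)
    (N + n) 0 (fun i => t.ev x y (g i)) (fun i => t.ev_mem_pathSpan 0 (hg i)) ?_ i
    (Finset.mem_range.1 hi)
  rw [← map_sum, hf, h0]

end IrrFamily

end ARSystem

/-! ### The equivalences -/

section Mat

variable {C : Type*} [Category C] [Preadditive C] {D : Type*} [Category D] [Preadditive D]
  [HasFiniteBiproducts D]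

/-- The extension of an additive functor to the additive completion. The Hom-sets of the two
categories may live in different universes, unlike in `CategoryTheory.Mat_.lift`. -/
noncomputable def matLift (F : C ⥤ D) [F.Additive] : Mat_ C ⥤ D where
  obj X := ⨁ fun i => F.obj (X.X i)
  map {X Y} f := biproduct.matrix fun (i : X.ι) (j : Y.ι) => F.map (f i j)
  map_id X := by
    classical
    refine biproduct.hom_ext _ _ fun j => biproduct.hom_ext' _ _ fun i => ?_
    rw [biproduct.matrix_π, biproduct.ι_desc, Category.id_comp]
    by_cases h : i = j
    · subst h
      rw [Mat_.id_apply_self, F.map_id, biproduct.ι_π_self]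
    · rw [Mat_.id_apply_of_ne _ _ _ h, F.map_zero, biproduct.ι_π_ne _ h]
  map_comp {X Y Z} f g := by
    refine biproduct.hom_ext _ _ fun j => biproduct.hom_ext' _ _ fun i => ?_
    rw [biproduct.matrix_π, biproduct.ι_desc, Category.assoc, biproduct.matrix_π,
      ← Category.assoc, biproduct.ι_matrix, biproduct.lift_desc, Mat_.comp_apply, F.map_sum]
    simp only [F.map_comp]

section

variable (F : C ⥤ D) [F.Additive]

/-- The inclusion of a summand of the image of a formal direct sum. -/
noncomputable def matLiftι (X : Mat_ C) (i : X.ι) : F.obj (X.X i) ⟶ (matLift F).obj X :=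
  biproduct.ι (fun i => F.obj (X.X i)) i

/-- The projection to a summand of the image of a formal direct sum. -/
noncomputable def matLiftπ (X : Mat_ C) (i : X.ι) : (matLift F).obj X ⟶ F.obj (X.X i) :=
  biproduct.π (fun i => F.obj (X.X i)) i

lemma matLiftι_map_matLiftπ {X Y : Mat_ C} (f : X ⟶ Y) (i : X.ι) (j : Y.ι) :
    matLiftι F X i ≫ (matLift F).map f ≫ matLiftπ F Y j = F.map (f i j) := by
  change biproduct.ι _ i ≫ biproduct.matrix _ ≫ biproduct.π _ j = _
  rw [biproduct.matrix_π, biproduct.ι_desc]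

lemma matLift_hom_ext {X Y : Mat_ C} {f g : (matLift F).obj X ⟶ (matLift F).obj Y}
    (h : ∀ i j, matLiftι F X i ≫ f ≫ matLiftπ F Y j = matLiftι F X i ≫ g ≫ matLiftπ F Y j) :
    f = g :=
  biproduct.hom_ext _ _ fun j => biproduct.hom_ext' _ _ fun i => h i j

instance : (matLift F).Additive where
  map_add {X Y f g} := matLift_hom_ext F fun i j => by
    rw [Preadditive.add_comp, Preadditive.comp_add, matLiftι_map_matLiftπ, matLiftι_map_matLiftπ,
      matLiftι_map_matLiftπ, ← F.map_add]
    rfl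

lemma matLift_linear (k : Type*) [Field k] [Linear k C] [Linear k D] [F.Linear k] :
    (matLift F).Linear k where
  map_smul {X Y} f c := matLift_hom_ext F fun i j => by
    rw [Linear.smul_comp, Linear.comp_smul, matLiftι_map_matLiftπ, matLiftι_map_matLiftπ,
      ← F.map_smul]
    rfl

instance [F.Faithful] : (matLift F).Faithful where
  map_injective {X Y f g} h := Mat_.hom_ext _ _ fun i j => F.map_injective (by
    rw [← matLiftι_map_matLiftπ, ← matLiftι_map_matLiftπ, h])

instance [F.Full] : (matLift F).Full where
  map_surjective {X Y} f := by
    let p : X ⟶ Y := fun i j => F.preimage (matLiftι F X i ≫ f ≫ matLiftπ F Y j)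
    exact ⟨p, matLift_hom_ext F fun i j =>
      (matLiftι_map_matLiftπ F p i j).trans (F.map_preimage _)⟩

end

end Mat

namespace ARSystem

variable {k : Type*} [Field k] {T : Type*} [Category T] [Preadditive T] [HasZeroObject T]
  [HasShift T ℤ] [∀ n : ℤ, (shiftFunctor T n).Additive] [Pretriangulated T] [Linear k T]
  {Q : StableTranslationQuiver} {A : ARSystem k T Q} [Fintype Q.V] {t : A.IrrFamily}

/-- The functor from the mesh category given by a family of irreducible maps that satisfies the mesh
relations. -/
noncomputable def IsMesh.functor (ht : IsMesh t t) : Q.MeshCat k ⥤ T :=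
  CategoryTheory.Quotient.lift (Q.meshRel k) t.pathFunctor fun x y f g h => by
    rw [← sub_eq_zero, ← Functor.map_sub]
    exact ht.ev_eq_zero (x := x) (y := y) h

instance (ht : IsMesh t t) : ht.functor.Additive where
  map_add {X Y f g} := by
    obtain ⟨f, rfl⟩ := (CategoryTheory.Quotient.functor (Q.meshRel k)).map_surjective f
    obtain ⟨g, rfl⟩ := (CategoryTheory.Quotient.functor (Q.meshRel k)).map_surjective g
    rw [← Functor.map_add]
    exact t.pathFunctor.map_add

instance (ht : IsMesh t t) : ht.functor.Linear k where
  map_smul {X Y} f c := by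
    obtain ⟨f, rfl⟩ := (CategoryTheory.Quotient.functor (Q.meshRel k)).map_surjective f
    exact t.pathFunctor.map_smul c f

section

variable [IsIdempotentComplete T] [∀ X Y : T, Module.Finite k (X ⟶ Y)] [IsAlgClosed k]

instance (ht : IsMesh t t) : ht.functor.Full where
  map_surjective {X Y} f := by
    obtain ⟨p, hp⟩ := t.ev_surjective X.as Y.as f
    exact ⟨(CategoryTheory.Quotient.functor (Q.meshRel k)).map p, hp⟩

instance (ht : IsMesh t t) : ht.functor.Faithful where
  map_injective {X Y f g} h := by
    obtain ⟨f, rfl⟩ := (CategoryTheory.Quotient.functor (Q.meshRel k)).map_surjective f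
    obtain ⟨g, rfl⟩ := (CategoryTheory.Quotient.functor (Q.meshRel k)).map_surjective g
    refine CategoryTheory.Quotient.sound _ (ht.mem_meshIdeal (x := X.as) (y := Y.as) ?_)
    exact (map_sub (t.ev X.as Y.as) f g).trans (sub_eq_zero.2 h)

/-- If a single family of irreducible maps satisfies the mesh relations, then `T` is standard. -/
theorem IsMesh.isStandard (ht : IsMesh t t) : IsStandard T k Q := by
  constructor
  · let F : Q.MeshCat k ⥤ IndObj T :=
      ObjectProperty.lift (fun X : T => Indecomposable X) ht.functor fun x => A.indec x.as
    have : F.EssSurj := ⟨fun X => by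
      obtain ⟨x, ⟨e⟩⟩ := A.exists_iso X.obj X.property
      exact ⟨⟨x⟩, ⟨ObjectProperty.isoMk _ e.symm⟩⟩⟩
    have : F.Full := Functor.Full.of_comp_faithful_iso (ObjectProperty.liftCompιIso _ ht.functor _)
    have : F.Faithful := Functor.Faithful.of_comp_iso (ObjectProperty.liftCompιIso _ ht.functor _)
    have : F.IsEquivalence := { }
    have h₁ : F.Additive := ⟨fun {X Y f g} => by
      apply (ObjectProperty.ι _).map_injective
      exact ht.functor.map_add⟩
    have h₂ : F.Linear k := ⟨fun {X Y} f c => by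
      apply (ObjectProperty.ι _).map_injective
      exact ht.functor.map_smul c f⟩
    have : F.asEquivalence.functor.Additive := h₁
    have : F.asEquivalence.functor.Linear k := h₂
    exact ⟨F.asEquivalence.symm, F.asEquivalence.inverse_additive,
      F.asEquivalence.inverseLinear k⟩
  · let F : Mat_ (Q.MeshCat k) ⥤ T := matLift ht.functor
    have : F.EssSurj := ⟨fun X => by
      obtain ⟨ι, _, v, a, b, h1, h2, h3⟩ := A.exists_decomp X
      obtain ⟨e⟩ := nonempty_iso_biproduct (fun i => A.M (v i)) a b h1 h2 h3
      exact ⟨⟨ι, fun i => ⟨v i⟩⟩, ⟨e.symm⟩⟩⟩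
    have : F.IsEquivalence := { }
    have h₁ : F.asEquivalence.functor.Additive := inferInstanceAs (matLift ht.functor).Additive
    have h₂ : F.asEquivalence.functor.Linear k := matLift_linear ht.functor k
    exact ⟨F.asEquivalence.symm, F.asEquivalence.inverse_additive,
      F.asEquivalence.inverseLinear k⟩

end

end ARSystem

section

variable {k : Type*} [Field k] {T : Type*} [Category T] [Preadditive T] [HasZeroObject T]
  [HasShift T ℤ] [∀ n : ℤ, (shiftFunctor T n).Additive] [Pretriangulated T] [Linear k T]
  {Q : StableTranslationQuiver}

/-- The representatives of the indecomposable objects belonging to an identification of the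
Auslander-Reiten quiver. -/
noncomputable def ARQuiverIso.arSystem (Γ : ARQuiverIso T k Q) : ARSystem k T Q :=
  have h : ∀ x, Γ.θ (indClass (Γ.θ.symm x).out.obj (Γ.θ.symm x).out.property) = x := fun x =>
    (Equiv.eq_symm_apply _).1 (_root_.Quotient.out_eq _)
  have hiso : ∀ {X Y : T} (hX : Indecomposable X) (hY : Indecomposable Y),
      indClass X hX = indClass Y hY ↔ Nonempty (X ≅ Y) := fun hX hY =>
    _root_.Quotient.eq.trans ⟨fun ⟨e⟩ => ⟨(ObjectProperty.ι _).mapIso e⟩,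
      fun ⟨e⟩ => ⟨ObjectProperty.isoMk _ e⟩⟩
  { M := fun x => (Γ.θ.symm x).out.obj
    indec := fun x => (Γ.θ.symm x).out.property
    eq_of_iso := fun {x y} e => by
      rw [← h x, ← h y]
      exact congrArg Γ.θ ((hiso _ _).2 ⟨e⟩)
    exists_iso := fun X hX => ⟨Γ.θ (indClass X hX), (hiso hX _).1 (Γ.θ.injective (h _).symm)⟩
    irrDim_arrow := fun x y hxy => Γ.irrDim_of_arrow _ _ _ _ (by rwa [h, h])
    irrDim_not_arrow := fun x y hxy => Γ.irrDim_of_not_arrow _ _ _ _ (by rwa [h, h])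
    translation := fun t ht z e => by
      refine (hiso ht.indecomposable₁ (Γ.θ.symm (Q.τ z)).out.property).1 (Γ.θ.injective ?_)
      rw [h, Γ.translation t ht,
        (hiso ht.indecomposable₃ (Γ.θ.symm z).out.property).2 ⟨e⟩, h] }

end

lemma Dynkin.coxeter_ne_zero (Δ : Dynkin) : Δ.coxeter ≠ 0 := by
  cases Δ with
  | A n hn => exact Nat.succ_ne_zero n
  | D n hn => simp only [Dynkin.coxeter]; omega
  | E n hn hn' => simp only [Dynkin.coxeter]; split_ifs <;> omega

theorem theorem6p3p3 {k : Type*} [Field k] [IsAlgClosed k]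
    {T : Type*} [Category T] [Preadditive T] [Linear k T] [HasZeroObject T] [HasShift T ℤ]
    [∀ n : ℤ, (shiftFunctor T n).Additive] [∀ n : ℤ, (shiftFunctor T n).Linear k]
    [Pretriangulated T] [IsTriangulated T] [IsIdempotentComplete T]
    (homFinite : ∀ X Y : T, Module.Finite k (X ⟶ Y))
    (finite : Finite (IndClass T))
    (Δ : Dynkin) (φ : Δ.repetition.Aut) (hφ : Δ.IsLargeGenerator φ)
    (G : Subgroup Δ.repetition.Aut) (hG : G = Subgroup.zpowers φ)
    (hΓ : Nonempty (ARQuiverIso T k (Δ.repetition.quotient G))) :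
    IsStandard T k (Δ.repetition.quotient G) := by
  subst hG
  obtain ⟨Γ⟩ := hΓ
  have : Finite (Δ.repetition.quotient (Subgroup.zpowers φ)).V := Finite.of_equiv _ Γ.θ
  have := Fintype.ofFinite (Δ.repetition.quotient (Subgroup.zpowers φ)).V
  let A := Γ.arSystem
  obtain ⟨s, hs⟩ := A.exists_chain_isMesh
  obtain ⟨m, hm⟩ := Nat.exists_eq_succ_of_ne_zero Δ.coxeter_ne_zero
  have hseq := hφ.additiveSeq_coxeter
  rw [hm] at hseq
  obtain ⟨t, ht⟩ := ARSystem.exists_isMesh_self (A := A)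
    (fun e hσ hsum y z hyz => Dynkin.eq_zero_of_sum_eq_zero e hσ hsum hyz) fun x y hxy =>
      ARSystem.radSq_eq_bot_of_arrow s hxy fun n hn => by
        by_cases h : (Δ.repetition.quotient (Subgroup.zpowers φ)).HasPath x n y
        · have := hφ.le_of_hasPath hn hxy h
          exact ARSystem.pathSpan_eq_bot_of_le (m := m) (by omega)
            (ARSystem.pathSpan_eq_bot_of_additiveSeq hs hseq 0 x) y
        · exact ARSystem.pathSpan_eq_bot_of_not_hasPath 0 h
  exact ht.isStandard
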